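/- **Setting.** Let $\pi:Y\to X$ be a smooth fibration (surjective submersion), $\dim X=n\ge 1$, $\dim Y=n+m$, with jet prolongations $J^kY$ (fibred coordinates $x^i,y^\sigma_I$, where $I$ is a multi-index with $|I|\le k$ and its letters are unordered). Write $\omega^\sigma_I=dy^\sigma_I-y^\sigma_{Ii}dx^i$ for the contact 1-forms and $d_i$ for the formal derivatives, acting on forms as Lie derivatives, $d_I=d_{i_1}\cdots d_{i_s}$. Let $p_l\alpha$ be the $l$-contact component of (the pull-back to $J^{k+1}Y$ of) a form $\alpha$ on $J^kY$, $h=p_0$, and $d_H\alpha=\sum_l p_l\,d\,p_l\alpha$. For an $(n+1)$-form $\alpha$ on $J^kY$ the interior Euler operator is $$\mathcal I(\alpha)=\omega^\sigma\wedge\sum_{|I|\le k}(-1)^{|I|}d_I\Big(\frac{\partial}{\partial y^\sigma_I}\rfloor p_1\alpha\Big).$$ Over the domain of a fibred chart, a *residual form* $\mathcal R(\alpha)$ of $\alpha$ is a smooth contact $n$-form $R$ on some jet prolongation with, up to pull-backs, $p_1\alpha=\mathcal I(\alpha)+p_1\,d\,p_1R$. For a $\pi$-projectable vector field $\psi$ on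 $Y$, $J^k\psi$ is its prolongation, and $J^k\psi=J^k\psi_V+\psi_H$, up to pull-backs, its splitting into the vertical part and the horizontal part $\psi_H=\psi^i d_i$; on forms generated by the $\omega^\sigma$, contraction with $J^k\psi_V$ involves only $\psi_V=(\psi^\sigma-y^\sigma_i\psi^i)\partial/\partial y^\sigma$ and is written $\psi_V\rfloor$. For a Lagrangian (horizontal $n$-form) $\lambda$ the Noether current is $$\epsilon_\psi(\lambda)=J\psi_V\rfloor p_{d_V\lambda}+\psi_H\rfloor\lambda,\qquad p_{d_V\lambda}=-p_1\mathcal R(d\lambda),$$ with the prolongation of $\psi$ of suitable order. **Theorem 3.2.** Let $\rho$ be a smooth $n$-form on $J^rY$ and let $\psi_1,\psi_2$ be smooth $\pi$-projectable vector fields on $Y$. Work over the domain of any fibred chart. (i) Residual forms exist. For every smooth $(n+1)$-form $\alpha$ on the $k$-jets over the chart, put $\Psi^I_\sigma=\frac{\partial}{\partial y^\sigma_I}\rfloor p_1\alpha$ (zero for $|I|>k$) and $\zeta^I_\sigma=\sum_J(-1)^{|J|}\binom{I+J}{J}d_J\Psi^{I+J}_\sigma$. Then a residual form of $\alpha$ is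 $$\mathcal R(\alpha)=-\sum_{I,j}\frac{I_j+1}{|I|+1}\,d_I\Big(\omega^\sigma\wedge\big(\tfrac{\partial}{\partial x^j}\rfloor\zeta^{Ij}_\sigma\big)\Big),$$ where $I_j$ is the multiplicity of $j$ in $I$. (ii) For every choice of residual forms of $d(h\rho)$, $d(\psi_{1,V}\rfloor\mathcal I d(h\rho))$ and $d(d_H\epsilon_{\psi_1}(h\rho))$ one has, up to pull-backs by projections, $$L_{J^{r+1}\psi_2}L_{J^{r+1}\psi_1}h\rho=\psi_{2,V}\rfloor\mathcal I d(\psi_{1,V}\rfloor\mathcal I d(h\rho))+d_H\epsilon_{\psi_2}(\psi_{1,V}\rfloor\mathcal I d(h\rho))+d_H\epsilon_{\psi_2}(d_H\epsilon_{\psi_1}(h\rho)),$$ where the higher Noether currents are $$\epsilon_{\psi_2}(\psi_{1,V}\rfloor\mathcal I d(h\rho))=\psi_{2,H}\rfloor\psi_{1,V}\rfloor\mathcal I d(h\rho)+J\psi_{2,V}\rfloor p_{d_V(\psi_{1,V}\rfloor\mathcal I d(h\rho))},$$ $$\epsilon_{\psi_2}(d_H\epsilon_{\psi_1}(h\rho))=\psi_{2,H}\rfloor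 d_H\big(J\psi_{1,V}\rfloor p_{d_Vh\rho}+\psi_{1,H}\rfloor h\rho\big)+J\psi_{2,V}\rfloor p_{d_Vd_H(J\psi_{1,V}\rfloor p_{d_Vh\rho}+\psi_{1,H}\rfloor h\rho)}.$$ -/

import Mathlib

open scoped Manifold ContDiff

noncomputable section

namespace JetCalc

/-! ### Coordinate jet spaces -/

/-- Multi-indices `I` in `N` letters, of length `|I| ≤ k`; `I i` is the multiplicity of the
letter `i`, so the order of the letters is forgotten. -/
abbrev MIdx (N k : ℕ) : Type := {I : Fin N → ℕ // ∑ i, I i ≤ k}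

instance (N k : ℕ) : Finite (MIdx N k) := by
  refine Finite.of_injective
    (fun I : MIdx N k => fun i : Fin N => (⟨I.1 i, ?_⟩ : Fin (k + 1))) ?_
  · exact Nat.lt_succ_of_le
      ((Finset.single_le_sum (fun j _ => Nat.zero_le (I.1 j)) (Finset.mem_univ i)).trans I.2)
  · intro I J h
    apply Subtype.ext
    funext i
    simpa using congrFun h i

instance (N k : ℕ) : Fintype (MIdx N k) := Fintype.ofFinite _

/-- The multi-index `I` with the letter `i` appended. -/
def app {N : ℕ} (I : Fin N → ℕ) (i : Fin N) : Fin N → ℕ := I + Pi.single i 1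

/-- Coordinates `(x^i, y^σ)` of a fibred chart. -/
abbrev Loc (N m : ℕ) : Type := (Fin N → ℝ) × (Fin m → ℝ)

/-- Coordinates `(x^i, y^σ_I)`, `|I| ≤ k`, on the `k`-th jet prolongation of a fibred chart. -/
abbrev Jet (N m k : ℕ) : Type := (Fin N → ℝ) × (MIdx N k → Fin m → ℝ)

/-- The coordinates `(y^σ_I)_σ` of a jet, for any multi-index (and `0` if `|I|` exceeds the
order of the jet). -/
def coord {N m k : ℕ} (u : Jet N m k) (I : Fin N → ℕ) : Fin m → ℝ :=
  if h : ∑ i, I i ≤ k then u.2 ⟨I, h⟩ else 0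

/-- The projection `π_{l,0}` in coordinates. -/
def pt {N m k : ℕ} (u : Jet N m k) : Loc N m := (u.1, coord u 0)

/-- The jets of order `k` over `W`, that is `π_{k,0}⁻¹(W)`. -/
def jetDom {N m : ℕ} (W : Set (Loc N m)) (k : ℕ) : Set (Jet N m k) := {u | pt u ∈ W}

/-- The projection `π_{l,k}` for `k ≤ l` (for `l < k` the missing coordinates are set to `0`;
this case is not used). -/
def proj {N m : ℕ} (l k : ℕ) : Jet N m l →L[ℝ] Jet N m k :=
  LinearMap.toContinuousLinearMap
    { toFun := fun u => (u.1, fun I => coord u I.1)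
      map_add' := by
        intro u v
        refine Prod.ext rfl (funext fun I => ?_)
        by_cases h : ∑ i, I.1 i ≤ l <;> simp [coord, h]
      map_smul' := by
        intro c u
        refine Prod.ext rfl (funext fun I => ?_)
        by_cases h : ∑ i, I.1 i ≤ l <;> simp [coord, h] }

/-! ### Forms on jet spaces and elementary operations -/

/-- Differential `q`-forms on the coordinate jet space of order `k`. -/
abbrev Form (N m k q : ℕ) : Type := Jet N m k → (Jet N m k) [⋀^Fin q]→L[ℝ] ℝ

/-- The pull-back `π_{l,k}^* η`. -/
def pull {N m k q : ℕ} (l : ℕ) (η : Form N m k q) : Form N m l q :=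
  fun u => (η (proj l k u)).compContinuousLinearMap (proj l k)

/-- `mixed f A B i` is the form
`(v_a)_a ↦ ∑_{S, |S| = i} f ((A v_a)_{a ∈ S}, (B v_a)_{a ∉ S})`, the arguments staying at
their places. -/
def mixed {E F : Type*} [NormedAddCommGroup E] [NormedSpace ℝ E]
    [NormedAddCommGroup F] [NormedSpace ℝ F] {q : ℕ}
    (f : E [⋀^Fin q]→L[ℝ] ℝ) (A B : F →L[ℝ] E) (i : ℕ) : F [⋀^Fin q]→L[ℝ] ℝ where
  toContinuousMultilinearMap := ∑ S ∈ Finset.powersetCard i (Finset.univ : Finset (Fin q)),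
    f.toContinuousMultilinearMap.compContinuousLinearMap (fun a => if a ∈ S then A else B)
  map_eq_zero_of_eq' := by
    intro v a b hv hab
    have hsum : (∑ S ∈ Finset.powersetCard i (Finset.univ : Finset (Fin q)),
        f.toContinuousMultilinearMap.compContinuousLinearMap
          (fun a => if a ∈ S then A else B)) v =
        ∑ S ∈ Finset.powersetCard i (Finset.univ : Finset (Fin q)),
          f (fun a => (if a ∈ S then A else B) (v a)) := by
      simp
    refine hsum.trans ?_
    have hswap : ∀ c, v (Equiv.swap a b c) = v c := by
      intro c
      rcases eq_or_ne c a with rfl | hca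
      · rw [Equiv.swap_apply_left, hv]
      · rcases eq_or_ne c b with rfl | hcb
        · rw [Equiv.swap_apply_right, hv]
        · rw [Equiv.swap_apply_of_ne_of_ne hca hcb]
    have hneg : ∀ S : Finset (Fin q),
        f (fun c => (if c ∈ S.map (Equiv.swap a b).toEmbedding then A else B) (v c)) =
          - f (fun c => (if c ∈ S then A else B) (v c)) := by
      intro S
      refine Eq.trans ?_
        (f.toAlternatingMap.map_swap (fun c => (if c ∈ S then A else B) (v c)) hab)
      refine congrArg f (funext fun c => ?_)
      simp [Finset.mem_map_equiv, hswap]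
    have hre : ∑ S ∈ Finset.powersetCard i (Finset.univ : Finset (Fin q)),
          f (fun c => (if c ∈ S.map (Equiv.swap a b).toEmbedding then A else B) (v c)) =
        ∑ S ∈ Finset.powersetCard i (Finset.univ : Finset (Fin q)),
          f (fun c => (if c ∈ S then A else B) (v c)) := by
      refine Finset.sum_nbij' (fun S => S.map (Equiv.swap a b).toEmbedding)
        (fun S => S.map (Equiv.swap a b).toEmbedding) ?_ ?_ ?_ ?_ ?_
      · intro S hS
        simpa [Finset.mem_powersetCard] using hS
      · intro S hS
        simpa [Finset.mem_powersetCard] using hS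
      · intro S _
        ext c
        simp [Finset.mem_map_equiv]
      · intro S _
        ext c
        simp [Finset.mem_map_equiv]
      · intro S _
        rfl
    rw [Finset.sum_congr rfl (fun S _ => hneg S), Finset.sum_neg_distrib] at hre
    linarith

/-- The Lie derivative of a form `η` on `E` along a vector field `Z : F → E` along the linear map
`p : F → E`, a form on `F`:
`(L_Z η)_u (v_a) = (D_{Z u} η)_{p u} (p v_a) + ∑_a η_{p u} (p v_1, …, D_{v_a} Z, …, p v_q)`,
the derivative at `t = 0` of the pull-back of `η` by `p + t Z`. -/
def lieAlong {E F : Type*} [NormedAddCommGroup E] [NormedSpace ℝ E]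
    [NormedAddCommGroup F] [NormedSpace ℝ F] {q : ℕ}
    (p : F →L[ℝ] E) (Z : F → E) (η : E → E [⋀^Fin q]→L[ℝ] ℝ) (u : F) : F [⋀^Fin q]→L[ℝ] ℝ :=
  (fderiv ℝ η (p u) (Z u)).compContinuousLinearMap p + mixed (η (p u)) (fderiv ℝ Z u) p 1

/-- The Lie derivative of a form on a jet space along a vector field on the same jet space. -/
def lie {N m k q : ℕ} (Z : Jet N m k → Jet N m k) (η : Form N m k q) : Form N m k q :=
  lieAlong (ContinuousLinearMap.id ℝ _) Z η

/-- Contraction `Z ⌋ η` with a vector field along `π_{k+1,k}`, a form of order `k + 1`. -/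
def contract {N m k q : ℕ} (Z : Jet N m (k + 1) → Jet N m k) (η : Form N m k (q + 1)) :
    Form N m (k + 1) q :=
  fun u => ((η (proj (k + 1) k u)).curryLeft (Z u)).compContinuousLinearMap (proj (k + 1) k)

/-- Contraction `v ⌋ η` with a coordinate vector field `v`. -/
def contractConst {N m k q : ℕ} (v : Jet N m k) (η : Form N m k (q + 1)) : Form N m k q :=
  fun u => (η u).curryLeft v

/-- The exterior product `θ ∧ η` of a `1`-form and a `q`-form,
`(θ ∧ η) (v_0, …, v_q) = ∑_a (-1)^a θ (v_a) η (v_0, …, v_{a-1}, v_{a+1}, …, v_q)`. -/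
def wedge {N m k q : ℕ} (θ : Jet N m k → Jet N m k →L[ℝ] ℝ) (η : Form N m k q) :
    Form N m k (q + 1) :=
  fun u => ContinuousAlternatingMap.alternatizeUncurryFin ((θ u).smulRight (η u))

/-- The coordinate vector field `∂/∂x^i`. -/
def dx {N m k : ℕ} (i : Fin N) : Jet N m k := (Pi.single i 1, 0)

/-- The coordinate vector field `∂/∂y^σ_I` (and `0` if `|I|` exceeds the order). -/
def dy {N m k : ℕ} (σ : Fin m) (I : Fin N → ℕ) : Jet N m k :=
  (0, fun J => if J.1 = I then Pi.single σ 1 else 0)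

/-- The contact `1`-form `ω^σ = dy^σ - y^σ_i dx^i`, on jets of order `k + 1`. -/
def contactForm {N m k : ℕ} (σ : Fin m) (u : Jet N m (k + 1)) : Jet N m (k + 1) →L[ℝ] ℝ :=
  LinearMap.toContinuousLinearMap
    { toFun := fun v => coord v 0 σ - ∑ i, coord u (Pi.single i 1) σ * v.1 i
      map_add' := by
        intro v w
        simp [coord, mul_add, Finset.sum_add_distrib]
        ring
      map_smul' := by
        intro c v
        simp [coord, mul_sub, Finset.mul_sum, mul_left_comm] }

/-! ### Contact structure -/

/-- The formal derivative `d_i`, a vector field along `π_{k+1,k}`. -/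
def totalVec {N m k : ℕ} (i : Fin N) (u : Jet N m (k + 1)) : Jet N m k :=
  (Pi.single i 1, fun I => coord u (app I.1 i))

/-- The horizontal part `v ↦ v^i d_i` of a vector tangent to `J^k`, at a point of `J^{k+1}`. -/
def hor {N m k : ℕ} (u : Jet N m (k + 1)) : Jet N m k →L[ℝ] Jet N m k :=
  LinearMap.toContinuousLinearMap
    (∑ i, (LinearMap.proj i ∘ₗ LinearMap.fst ℝ (Fin N → ℝ) (MIdx N k → Fin m → ℝ)).smulRight
      (totalVec i u))

/-- The vertical part `v - v^i d_i`. -/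
def ver {N m k : ℕ} (u : Jet N m (k + 1)) : Jet N m k →L[ℝ] Jet N m k :=
  ContinuousLinearMap.id ℝ _ - hor u

/-- The `i`-contact component `p_i η`, a form of order `k + 1`. -/
def pc {N m k q : ℕ} (i : ℕ) (η : Form N m k q) : Form N m (k + 1) q :=
  fun u => mixed (η (proj (k + 1) k u)) ((ver u).comp (proj (k + 1) k))
    ((hor u).comp (proj (k + 1) k)) i

/-- The horizontal differential `d_H η = ∑_l p_l d p_l η`. -/
def dH {N m k q : ℕ} (η : Form N m k q) : Form N m (k + 2) (q + 1) :=
  ∑ l ∈ Finset.range (q + 1), pc l (extDeriv (pc l η))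

/-- The formal derivative `d_i` of forms (it commutes with `d`, satisfies the Leibniz rule and is
the total derivative on functions). -/
def formalD {N m k q : ℕ} (i : Fin N) (η : Form N m k q) : Form N m (k + 1) q :=
  lieAlong (proj (k + 1) k) (totalVec i) η

/-- Iterated formal derivative of forms. -/
def formalDs {N m k q : ℕ} : (L : List (Fin N)) → Form N m k q → Form N m (k + L.length) q
  | [], η => η
  | i :: L, η => formalD i (formalDs L η)

/-- A list of the letters of a multi-index. -/
def letters {N : ℕ} (I : Fin N → ℕ) : List (Fin N) :=
  (List.finRange N).flatMap fun i => List.replicate (I i) i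

/-- The formal derivative `d_I η`, pulled back to the order `l` (used for `k + |I| ≤ l`). -/
def formalDI {N m k q : ℕ} (l : ℕ) (I : Fin N → ℕ) (η : Form N m k q) : Form N m l q :=
  pull l (formalDs (letters I) η)

/-! ### Interior Euler operator and residual operator -/

/-- The interior Euler operator on `(N+1)`-forms of order `k`:
`𝓘 α = ω^σ ∧ ∑_{|I| ≤ k} (-1)^{|I|} d_I (∂/∂y^σ_I ⌋ p_1 α)`. -/
def euler {N m k : ℕ} (α : Form N m k (N + 1)) : Form N m (2 * k + 1) (N + 1) :=
  ∑ σ, wedge (contactForm σ) (∑ I : MIdx N k, (-1 : ℝ) ^ (∑ i, I.1 i) •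
    formalDI (2 * k + 1) I.1 (contractConst (dy σ I.1) (pc 1 α)))

/-- `ζ^I_σ = ∑_J (-1)^{|J|} (I+J choose J) d_J Ψ^{I+J}_σ`, where
`p_1 α = ∑ ω^σ_I ∧ Ψ^I_σ`, that is `Ψ^I_σ = ∂/∂y^σ_I ⌋ p_1 α`. -/
def zeta {N m k : ℕ} (α : Form N m k (N + 1)) (σ : Fin m) (I : Fin N → ℕ) :
    Form N m (2 * k + 1) N :=
  ∑ J : MIdx N k, ((-1 : ℝ) ^ (∑ i, J.1 i) * ∏ i, ((I i + J.1 i).choose (J.1 i) : ℝ)) •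
    formalDI (2 * k + 1) J.1 (contractConst (dy σ (I + J.1)) (pc 1 α))

/-- The residual operator in fibred coordinates on `(n+2)`-forms, `n + 1` being the dimension of
the base: `p_1 α = ∑_I d_I (ω^σ ∧ ζ^I_σ)` and, with `ω^σ ∧ ζ^I_σ = Φ^I ∧ ds`,
`𝓡 α = - ∑_{I,j} (I_j + 1) / (|I| + 1) d_I Φ^{Ij} ∧ ds_j`. The factor is the number of orderings of
`I` divided by that of `Ij`. Here `Φ^I ∧ ds_j` is written as `ω^σ ∧ (∂/∂x^j ⌋ ζ^I_σ)`, and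
`d_I ds_j = 0`. -/
def residual {n m k : ℕ} (α : Form (n + 1) m k (n + 2)) : Form (n + 1) m (3 * k + 1) (n + 1) :=
  - ∑ I : MIdx (n + 1) k, ∑ j, (((I.1 j + 1 : ℕ) : ℝ) / ((∑ i, I.1 i + 1 : ℕ) : ℝ)) •
    formalDI (3 * k + 1) I.1
      (∑ σ, wedge (contactForm σ) (contractConst (dx j) (zeta α σ (app I.1 j))))

/-- `R` is a residual form of the `(N+1)`-form `α` over `W`: a smooth contact form with
`p_1 α = 𝓘 α + p_1 d p_1 R`, up to pull-backs to a common order. -/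
def IsResidual {N m k l : ℕ} (W : Set (Loc N m)) (α : Form N m k (N + 1)) (R : Form N m l N) :
    Prop :=
  ContDiffOn ℝ ∞ R (jetDom W l) ∧ Set.EqOn (pc 0 R) 0 (jetDom W (l + 1)) ∧
  ∀ K, 2 * k + 1 ≤ K → l + 2 ≤ K →
    Set.EqOn (pull K (pc 1 α)) (pull K (euler α) + pull K (pc 1 (extDeriv (pc 1 R)))) (jetDom W K)

/-! ### Prolongation of projectable vector fields and Noether currents -/

/-- The components `ψ^σ_I` of the prolongation of a vector field `ψ = ψ^i ∂_i + ψ^σ ∂_σ`: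
`ψ^σ_{Ij} = d_j ψ^σ_I - y^σ_{Ii} ∂ψ^i/∂x^j`. -/
def prolongCoeff {N m : ℕ} (ψ : Loc N m → Loc N m) :
    (L : List (Fin N)) → Jet N m L.length → Fin m → ℝ
  | [], u => (ψ (pt u)).2
  | j :: L, u =>
      fderiv ℝ (prolongCoeff ψ L) (proj (L.length + 1) L.length u) (totalVec j u)
        - ∑ i, (fderiv ℝ ψ (pt u) (Pi.single j 1, 0)).1 i •
            coord (k := L.length + 1) u (app (fun a => L.count a) i)

/-- The prolongation `J^k ψ` of a projectable vector field. -/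
def prolong {N m : ℕ} (k : ℕ) (ψ : Loc N m → Loc N m) (u : Jet N m k) : Jet N m k :=
  ((ψ (pt u)).1, fun I => prolongCoeff ψ (letters I.1) (proj k (letters I.1).length u))

/-- The vertical part `J^k ψ_V` of `J^k ψ`, along `π_{k+1,k}`. On forms generated by the `ω^σ`
only its components `ψ^σ - y^σ_i ψ^i` matter, and there it is denoted by `ψ_V`. -/
def vertPart {N m : ℕ} (k : ℕ) (ψ : Loc N m → Loc N m) (u : Jet N m (k + 1)) : Jet N m k :=
  ver u (prolong k ψ (proj (k + 1) k u))

/-- The horizontal part `ψ_H = ψ^i d_i`, along `π_{k+1,k}`. -/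
def horPart {N m : ℕ} (k : ℕ) (ψ : Loc N m → Loc N m) (u : Jet N m (k + 1)) : Jet N m k :=
  hor u (prolong k ψ (proj (k + 1) k u))

/-- The Noether current `ε_ψ(lam) = Jψ_V ⌋ p_{d_V lam} + ψ_H ⌋ lam` of a Lagrangian `lam`, with
the local generalized momentum `p_{d_V lam} = - p_1 R`, where `R` is a residual form of `d lam`. -/
def noetherCurrent {n m k l : ℕ} (ψ : Loc (n + 1) m → Loc (n + 1) m)
    (lam : Form (n + 1) m k (n + 1)) (R : Form (n + 1) m l (n + 1)) :
    Form (n + 1) m (k + l + 2) n :=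
  pull (k + l + 2) (contract (vertPart (l + 1) ψ) (- pc 1 R)) +
    pull (k + l + 2) (contract (horPart k ψ) lam)

/-- The Lagrangian `ψ_V ⌋ 𝓘 d lam`. -/
def eulerContract {n m k : ℕ} (ψ : Loc (n + 1) m → Loc (n + 1) m)
    (lam : Form (n + 1) m k (n + 1)) : Form (n + 1) m (2 * k + 2) (n + 1) :=
  contract (vertPart (2 * k + 1) ψ) (euler (extDeriv lam))

/-! ### Fibred manifolds, fibred charts, forms on jet prolongations -/

/-- Partial derivatives, along a list of letters, of a map on `ℝ^N`. -/
def partials {N : ℕ} {V : Type*} [NormedAddCommGroup V] [NormedSpace ℝ V] :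
    List (Fin N) → ((Fin N → ℝ) → V) → (Fin N → ℝ) → V
  | [], f => f
  | i :: L, f => fun x => fderiv ℝ (partials L f) x (Pi.single i 1)

/-- The coordinates of the `k`-jet at `x` of a section `s`. -/
def jetOf {N m : ℕ} (k : ℕ) (s : (Fin N → ℝ) → Fin m → ℝ) (x : Fin N → ℝ) : Jet N m k :=
  (x, fun I => partials (letters I.1) s x)

/-- The polynomial section whose `k`-jet at `u.1` is `u`. -/
def taylorSection {N m k : ℕ} (u : Jet N m k) (x : Fin N → ℝ) : Fin m → ℝ :=
  ∑ I : MIdx N k, (∏ i, (x i - u.1 i) ^ I.1 i / ((I.1 i).factorial : ℝ)) • u.2 I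

/-- The `k`-jet prolongation `j^k_x s ↦ j^k_{φ x} (Φ ∘ s ∘ φ⁻¹)` of a local isomorphism `Φ` of
fibred coordinate domains over the local diffeomorphism `φ`, with inverse `φinv`, of the bases. -/
def prolongMap {N m : ℕ} (k : ℕ) (Φ : Loc N m → Loc N m) (φ φinv : (Fin N → ℝ) → Fin N → ℝ)
    (u : Jet N m k) : Jet N m k :=
  jetOf k (fun x => (Φ (φinv x, taylorSection u (φinv x))).2) (φ u.1)

section Fibred

variable {EX : Type*} [NormedAddCommGroup EX] [NormedSpace ℝ EX]
  {EY : Type*} [NormedAddCommGroup EY] [NormedSpace ℝ EY]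
  {X : Type*} [TopologicalSpace X] [ChartedSpace EX X]
  {Y : Type*} [TopologicalSpace Y] [ChartedSpace EY Y] [IsManifold 𝓘(ℝ, EY) ∞ Y]

/-- A smooth fibration (surjective submersion) `π : Y → X` with `N`-dimensional base and
`m`-dimensional fibres. -/
structure IsFibration (N m : ℕ) (π : Y → X) : Prop where
  finiteDimensional_base : FiniteDimensional ℝ EX
  finiteDimensional_total : FiniteDimensional ℝ EY
  finrank_base : Module.finrank ℝ EX = N
  finrank_total : Module.finrank ℝ EY = N + m
  smooth : ContMDiff 𝓘(ℝ, EY) 𝓘(ℝ, EX) ∞ π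
  surjective : Function.Surjective π
  submersion : ∀ y, Function.Surjective (mfderiv 𝓘(ℝ, EY) 𝓘(ℝ, EX) π y)

/-- Fibred charts of `π : Y → X`: smooth charts `(x^i, y^σ)` of `Y` and `(x^i)` of `X` such that
`π` reads `(x, y) ↦ x`. -/
structure FiberedChart (N m : ℕ) (π : Y → X) where
  total : OpenPartialHomeomorph Y (Loc N m)
  base : OpenPartialHomeomorph X (Fin N → ℝ)
  smooth_total : ContMDiffOn 𝓘(ℝ, EY) 𝓘(ℝ, Loc N m) ∞ total total.source
  smooth_total_symm : ContMDiffOn 𝓘(ℝ, Loc N m) 𝓘(ℝ, EY) ∞ total.symm total.target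
  smooth_base : ContMDiffOn 𝓘(ℝ, EX) 𝓘(ℝ, Fin N → ℝ) ∞ base base.source
  smooth_base_symm : ContMDiffOn 𝓘(ℝ, Fin N → ℝ) 𝓘(ℝ, EX) ∞ base.symm base.target
  mapsTo : ∀ y ∈ total.source, π y ∈ base.source
  fst_total : ∀ y ∈ total.source, (total y).1 = base (π y)

/-- The domain of a fibred chart, in coordinates. -/
abbrev FiberedChart.dom {N m : ℕ} {π : Y → X} (c : FiberedChart (EX := EX) (EY := EY) N m π) :
    Set (Loc N m) := c.total.target

/-- The change of coordinates between two fibred charts, on jets of order `k`. -/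
def FiberedChart.jetTransition {N m : ℕ} {π : Y → X} (k : ℕ)
    (c c' : FiberedChart (EX := EX) (EY := EY) N m π) : Jet N m k → Jet N m k :=
  prolongMap k (c'.total ∘ c.total.symm) (c'.base ∘ c.base.symm) (c.base ∘ c'.base.symm)

/-- A smooth differential `q`-form on `J^k Y`, given by its expressions in all fibred charts, which
are related by the pull-backs along the changes of jet coordinates. -/
structure JetForm (N m : ℕ) (π : Y → X) (k q : ℕ) where
  inChart : FiberedChart (EX := EX) (EY := EY) N m π → Form N m k q
  smooth : ∀ c, ContDiffOn ℝ ∞ (inChart c) (jetDom c.dom k)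
  compat : ∀ c c', ∀ u ∈ jetDom c.dom k, c.total.symm (pt u) ∈ c'.total.source →
    inChart c u = (inChart c' (c.jetTransition k c' u)).compContinuousLinearMap
      (fderiv ℝ (c.jetTransition k c') u)

/-- Smooth `π`-projectable vector fields on `Y`. -/
structure ProjectableField (π : Y → X) where
  field : ∀ y : Y, TangentSpace 𝓘(ℝ, EY) y
  smooth : ContMDiff 𝓘(ℝ, EY) 𝓘(ℝ, EY).tangent ∞
    (fun y => (⟨y, field y⟩ : TangentBundle 𝓘(ℝ, EY) Y))
  projectable : ∃ ξ : ∀ x : X, TangentSpace 𝓘(ℝ, EX) x,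
    ∀ y, mfderiv 𝓘(ℝ, EY) 𝓘(ℝ, EX) π y (field y) = ξ (π y)

/-- The components of a projectable vector field in a fibred chart. -/
def ProjectableField.inChart {N m : ℕ} {π : Y → X} (ψ : ProjectableField (EX := EX) (EY := EY) π)
    (c : FiberedChart (EX := EX) (EY := EY) N m π) (z : Loc N m) : Loc N m :=
  mfderiv 𝓘(ℝ, EY) 𝓘(ℝ, Loc N m) c.total (c.total.symm z) (ψ.field (c.total.symm z))

end Fibred

end JetCalc

end

open JetCalc

noncomputable section

namespace JetCalc

/-! ### Alternating maps -/

section Alternating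

variable {E F J : Type*} [NormedAddCommGroup E] [NormedSpace ℝ E]
  [NormedAddCommGroup F] [NormedSpace ℝ F] [NormedAddCommGroup J] [NormedSpace ℝ J] {q : ℕ}

/-! An identity of forms on a jet space is tested on prolonged sections. Every jet is the jet of a
polynomial section (`jetOf_taylorSection`), and a tangent vector splits into one tangent to the
prolonged section and a vertical one. Hence horizontal forms are determined by their pull-backs
along sections (`eqOn_of_pb_eq`), and forms of contact degree one, of degree one above the dimension
of the base, by their contractions with prolonged vertical variations (`eqOn_of_pbi_eq`). Under
these tests the jet calculus becomes ordinary calculus on the base: $d_I$ is $\partial_I$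
(`pb_formalDI`, `pbi_formalDI`), $d_H$ is $d$ (`pb_dH`), contracting $\omega^\sigma$ gives
$V^\sigma$ (`pbi_wedge_contactForm`), and $p_1dp_1R$ becomes minus $d$ of the contraction of $R$
(`pbi_extDeriv_pc_one`). The last rule holds because $p_1R$ pulls back to zero along every section
$s+tV$, so that Cartan's formula `pbL_eq` has zero on its left.

Part (i) is then integration by parts. The contraction of $p_1\alpha$ is
$\sum\partial_IV^\sigma\,\Psi^I_\sigma$ (`pbi_pc_one_eq_sum`), which `sum_partials_smul_eq` rewrites
as $\sum_I\partial_I(V^\sigma\zeta^I_\sigma)$. The term $I=0$ is the Euler operator. The others are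
distributed over the choice of a letter $j$ to be split off, with weights adding up to one
(`sum_midx_eq_zero_add`); as $\partial_j$ of a top form is $d$ of its contraction with $\partial_j$
(`extDeriv_contractBase`), they assemble into the exact term coming from the residual form.

For part (ii), the prolongation of a projectable field along a section is a prolonged vertical
variation plus a vector tangent to the section (`prolong_jetOf`). Cartan's formula and the
decomposition of $d\lambda$ by any residual form give the first variation formula
$L\lambda=\psi_V\rfloor\mathcal Id\lambda+d_H\epsilon$ (`pull_lie_eq`). Applying it again to both
summands gives the three terms of the theorem and an Euler–Lagrange term of $d_H\epsilon$. That one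
vanishes (`pbi_euler_extDeriv_dH`): its coefficient times any test function $\varphi$ is the
differential of a form supported in the support of $\varphi$, so by Stokes its integral is zero and
the fundamental lemma of the calculus of variations applies. -/

theorem mixed_apply (f : E [⋀^Fin q]→L[ℝ] ℝ) (A B : F →L[ℝ] E) (i : ℕ) (v : Fin q → F) :
    mixed f A B i v = ∑ S ∈ Finset.powersetCard i (Finset.univ : Finset (Fin q)),
      f (fun a => (if a ∈ S then A else B) (v a)) := by
  change (∑ S ∈ Finset.powersetCard i (Finset.univ : Finset (Fin q)),
    f.toContinuousMultilinearMap.compContinuousLinearMap (fun a => if a ∈ S then A else B)) v = _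
  simp

theorem mixed_zero (f : E [⋀^Fin q]→L[ℝ] ℝ) (A B : F →L[ℝ] E) :
    mixed f A B 0 = f.compContinuousLinearMap B := by
  ext v
  simp [mixed_apply, Function.comp_def]

theorem mixed_one (f : E [⋀^Fin q]→L[ℝ] ℝ) (A B : F →L[ℝ] E) :
    mixed f A B 1 = f.fderivCompContinuousLinearMap B A := by
  ext v
  rw [mixed_apply, Finset.powersetCard_one, Finset.sum_map,
    ContinuousAlternatingMap.fderivCompContinuousLinearMap_apply]
  refine Finset.sum_congr rfl fun i _ => congrArg f (funext fun j => ?_)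
  rcases eq_or_ne j i with rfl | h <;> simp [*]

theorem mixed_one_apply (f : E [⋀^Fin q]→L[ℝ] ℝ) (A B : F →L[ℝ] E) (v : Fin q → F) :
    mixed f A B 1 v = ∑ i, f (Function.update (fun j => B (v j)) i (A (v i))) := by
  rw [mixed_one, ContinuousAlternatingMap.fderivCompContinuousLinearMap_apply]
  refine Finset.sum_congr rfl fun i _ => congrArg f (funext fun j => ?_)
  rcases eq_or_ne j i with rfl | h <;> simp [*]

theorem mixed_comp {H : Type*} [NormedAddCommGroup H] [NormedSpace ℝ H]
    (f : E [⋀^Fin q]→L[ℝ] ℝ) (P : F →L[ℝ] E) (A B : H →L[ℝ] F) (i : ℕ) :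
    mixed (f.compContinuousLinearMap P) A B i = mixed f (P.comp A) (P.comp B) i := by
  ext v
  simp only [mixed_apply, ContinuousAlternatingMap.compContinuousLinearMap_apply]
  refine Finset.sum_congr rfl fun S _ => congrArg f (funext fun a => ?_)
  by_cases h : a ∈ S <;> simp [h]

theorem mixed_compContinuousLinearMap {H : Type*} [NormedAddCommGroup H] [NormedSpace ℝ H]
    (f : E [⋀^Fin q]→L[ℝ] ℝ) (A B : F →L[ℝ] E) (C : H →L[ℝ] F) (i : ℕ) :
    (mixed f A B i).compContinuousLinearMap C = mixed f (A.comp C) (B.comp C) i := by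
  ext v
  simp only [mixed_apply, ContinuousAlternatingMap.compContinuousLinearMap_apply]
  refine Finset.sum_congr rfl fun S _ => congrArg f (funext fun a => ?_)
  by_cases h : a ∈ S <;> simp [h]

/-- An alternating map in more arguments than the dimension of its domain vanishes. -/
theorem alternating_eq_zero_of_finrank_lt [FiniteDimensional ℝ E]
    (h : Module.finrank ℝ E < q) (f : E [⋀^Fin q]→L[ℝ] ℝ) : f = 0 := by
  ext v
  refine f.toAlternatingMap.map_linearDependent v fun hv => ?_
  have := hv.fintype_card_le_finrank
  simp at this
  omega

end Alternating

/-! ### Smoothness of fields of alternating maps -/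

section Smooth

variable {M E : Type*} [NormedAddCommGroup M] [NormedSpace ℝ M]
  [NormedAddCommGroup E] [NormedSpace ℝ E] [FiniteDimensional ℝ E] {q : ℕ} {U : Set M}

/-- Evaluation on tuples of basis vectors embeds alternating maps linearly into a finite-dimensional
coordinate space, and a linear left inverse recovers `f` from its coefficients. Smoothness can
therefore be checked argument by argument. -/
theorem contDiffOn_alternating {f : M → E [⋀^Fin q]→L[ℝ] ℝ}
    (h : ∀ v, ContDiffOn ℝ ∞ (fun x => f x v) U) : ContDiffOn ℝ ∞ f U := by
  let b := Module.finBasis ℝ E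
  let L : (E [⋀^Fin q]→L[ℝ] ℝ) →ₗ[ℝ] ((Fin q → Fin (Module.finrank ℝ E)) → ℝ) :=
    { toFun := fun g c => g (fun a => b (c a))
      map_add' := fun _ _ => rfl
      map_smul' := fun _ _ => rfl }
  have hL : Function.Injective L := by
    intro g g' hg
    apply ContinuousAlternatingMap.toAlternatingMap_injective
    exact Module.Basis.ext_alternating b fun c _ => congrFun hg c
  obtain ⟨R, hR⟩ := L.exists_leftInverse_of_injective (LinearMap.ker_eq_bot.2 hL)
  have hRf : f = fun x => LinearMap.toContinuousLinearMap R (fun c => f x (fun a => b (c a))) := by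
    funext x
    exact (LinearMap.congr_fun hR (f x)).symm
  rw [hRf]
  exact (LinearMap.toContinuousLinearMap R).contDiff.comp_contDiffOn
    (contDiffOn_pi.2 fun c => h _)

/-- Multilinear expansion in a basis makes the value a polynomial in the coordinates of the
arguments and the coefficients of `f`. -/
theorem contDiffOn_alternating_apply {f : M → E [⋀^Fin q]→L[ℝ] ℝ} {g : M → Fin q → E}
    (hf : ContDiffOn ℝ ∞ f U) (hg : ∀ i, ContDiffOn ℝ ∞ (fun x => g x i) U) :
    ContDiffOn ℝ ∞ (fun x => f x (g x)) U := by
  let b := Module.finBasis ℝ E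
  have hexp : ∀ x, f x (g x) = ∑ c : Fin q → Fin (Module.finrank ℝ E),
      (∏ a, b.repr (g x a) (c a)) * f x (fun a => b (c a)) := by
    intro x
    conv_lhs => rw [show g x = fun a => ∑ i, b.repr (g x a) i • b i from
      funext fun a => (b.sum_repr (g x a)).symm]
    have := (f x).toMultilinearMap.map_sum (fun a i => b.repr (g x a) i • b i)
    refine this.trans (Finset.sum_congr rfl fun c _ => ?_)
    exact (f x).toMultilinearMap.map_smul_univ (fun a => b.repr (g x a) (c a)) _
  simp_rw [hexp]
  refine ContDiffOn.sum fun c _ => ContDiffOn.mul (contDiffOn_prod fun a _ => ?_) ?_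
  · exact (LinearMap.toContinuousLinearMap (b.coord (c a))).contDiff.comp_contDiffOn (hg a)
  · exact (ContinuousAlternatingMap.apply ℝ E ℝ (fun a => b (c a))).contDiff.comp_contDiffOn hf

end Smooth

/-! ### Pull-back of forms along maps, contraction and Lie derivative along maps -/

section Pullback

variable {E J F : Type*} [NormedAddCommGroup E] [NormedSpace ℝ E]
  [NormedAddCommGroup J] [NormedSpace ℝ J] [NormedAddCommGroup F] [NormedSpace ℝ F] {q : ℕ}

/-- The pull-back `S^* η`. -/
def pb (S : E → J) (η : J → J [⋀^Fin q]→L[ℝ] ℝ) (x : E) : E [⋀^Fin q]→L[ℝ] ℝ :=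
  (η (S x)).compContinuousLinearMap (fderiv ℝ S x)

/-- The pull-back `S^* (ζ ⌋ η)` for a vector field `ζ` along `S`. -/
def pbi (S ζ : E → J) (η : J → J [⋀^Fin (q + 1)]→L[ℝ] ℝ) (x : E) : E [⋀^Fin q]→L[ℝ] ℝ :=
  ((η (S x)).curryLeft (ζ x)).compContinuousLinearMap (fderiv ℝ S x)

/-- The derivative at `t = 0` of `(S + t ζ)^* η`. -/
def pbL (S ζ : E → J) (η : J → J [⋀^Fin q]→L[ℝ] ℝ) (x : E) : E [⋀^Fin q]→L[ℝ] ℝ :=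
  (fderiv ℝ η (S x) (ζ x)).compContinuousLinearMap (fderiv ℝ S x) +
    (η (S x)).fderivCompContinuousLinearMap (fderiv ℝ S x) (fderiv ℝ ζ x)

theorem pb_apply (S : E → J) (η : J → J [⋀^Fin q]→L[ℝ] ℝ) (x : E) (v : Fin q → E) :
    pb S η x v = η (S x) (fun a => fderiv ℝ S x (v a)) := rfl

theorem pbi_apply (S ζ : E → J) (η : J → J [⋀^Fin (q + 1)]→L[ℝ] ℝ) (x : E) (v : Fin q → E) :
    pbi S ζ η x v = η (S x) (Matrix.vecCons (ζ x) (fun a => fderiv ℝ S x (v a))) := rfl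

theorem two_le_infty : (2 : WithTop ℕ∞) ≤ ∞ :=
  WithTop.coe_le_coe.2 (le_top : (2 : ℕ∞) ≤ ⊤)

theorem extDeriv_pb {S : E → J} {η : J → J [⋀^Fin q]→L[ℝ] ℝ} {x : E}
    (hη : DifferentiableAt ℝ η (S x)) (hS : ContDiffAt ℝ ∞ S x) :
    extDeriv (pb S η) x = pb S (extDeriv η) x :=
  extDeriv_pullback hη hS (by simpa using two_le_infty)

theorem hasFDerivAt_fderiv {S : E → J} {x : E} (hS : ContDiffAt ℝ ∞ S x) :
    HasFDerivAt (fderiv ℝ S) (fderiv ℝ (fderiv ℝ S) x) x :=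
  ((hS.fderiv_right (m := 1) (by simpa [one_add_one_eq_two] using two_le_infty)).differentiableAt
    one_ne_zero).hasFDerivAt

theorem fderiv_fderiv_symm {S : E → J} {x : E} (hS : ContDiffAt ℝ ∞ S x) (v w : E) :
    fderiv ℝ (fderiv ℝ S) x v w = fderiv ℝ (fderiv ℝ S) x w v :=
  (hS.isSymmSndFDerivAt (by simpa using two_le_infty)) v w

/-- Currying is continuous and linear, so this is the product rule; only the values of the
derivative are needed for Cartan's formula. -/
theorem exists_hasFDerivAt_curryLeft {S ζ : E → J} {η : J → J [⋀^Fin (q + 1)]→L[ℝ] ℝ} {x : E}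
    (hη : DifferentiableAt ℝ η (S x)) (hS : DifferentiableAt ℝ S x)
    (hζ : DifferentiableAt ℝ ζ x) :
    ∃ A : E →L[ℝ] J [⋀^Fin q]→L[ℝ] ℝ,
      HasFDerivAt (fun y => (η (S y)).curryLeft (ζ y)) A x ∧
      ∀ w, A w = (fderiv ℝ η (S x) (fderiv ℝ S x w)).curryLeft (ζ x) +
        (η (S x)).curryLeft (fderiv ℝ ζ x w) := by
  let c := (ContinuousAlternatingMap.curryLeftLI (𝕜 := ℝ) (E := J) (F := ℝ)
      (n := q)).toContinuousLinearMap
  have h0 : HasFDerivAt (fun y => c (η (S y))) (c.comp ((fderiv ℝ η (S x)).comp (fderiv ℝ S x))) x :=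
    c.hasFDerivAt.comp (g := c) (f := fun y => η (S y)) x
      (hη.hasFDerivAt.comp (g := η) x hS.hasFDerivAt)
  refine ⟨_, h0.clm_apply hζ.hasFDerivAt, fun w => ?_⟩
  simp [c, add_comm]

theorem differentiableAt_pbi {S ζ : E → J} {η : J → J [⋀^Fin (q + 1)]→L[ℝ] ℝ} {x : E}
    (hη : DifferentiableAt ℝ η (S x)) (hS : ContDiffAt ℝ ∞ S x) (hζ : DifferentiableAt ℝ ζ x) :
    DifferentiableAt ℝ (pbi S ζ η) x := by
  obtain ⟨A, hA, -⟩ := exists_hasFDerivAt_curryLeft hη (hS.differentiableAt (by simp)) hζ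
  exact (hA.continuousAlternatingMapCompContinuousLinearMap (hasFDerivAt_fderiv hS)).differentiableAt

/-- Cartan's formula along a map. -/
theorem pbL_eq {S ζ : E → J} {η : J → J [⋀^Fin (q + 1)]→L[ℝ] ℝ} {x : E}
    (hη : DifferentiableAt ℝ η (S x)) (hS : ContDiffAt ℝ ∞ S x) (hζ : DifferentiableAt ℝ ζ x) :
    pbL S ζ η x = pbi S ζ (extDeriv η) x + extDeriv (pbi S ζ η) x := by
  obtain ⟨A, hA, hA'⟩ := exists_hasFDerivAt_curryLeft hη (hS.differentiableAt (by simp)) hζ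
  have h2 := hA.continuousAlternatingMapCompContinuousLinearMap (hasFDerivAt_fderiv hS)
  have h3 : extDeriv (pbi S ζ η) x = ContinuousAlternatingMap.alternatizeUncurryFin _ :=
    congrArg ContinuousAlternatingMap.alternatizeUncurryFin h2.fderiv
  -- The term that differentiates $dS$ involves the symmetric second derivative of `S`, so
  -- alternation kills it.
  rw [h3, ContinuousAlternatingMap.alternatizeUncurryFin_add,
    ContinuousAlternatingMap.alternatizeUncurryFin_fderivCompContinuousLinearMap_eq_zero _ _
      (fderiv_fderiv_symm hS), add_zero]
  ext v
  simp only [pbL, pbi_apply, extDeriv, ContinuousAlternatingMap.add_apply,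
    ContinuousAlternatingMap.alternatizeUncurryFin_apply,
    ContinuousAlternatingMap.compContinuousLinearMap_apply,
    ContinuousAlternatingMap.fderivCompContinuousLinearMap_eq_alternatizeUncurryFin]
  -- In $d\eta(\zeta,S_*v)$ the first summand is the derivative of $\eta$ along $\zeta$; the others
  -- cancel against terms of $d(\zeta\rfloor\eta)$.
  rw [Fin.sum_univ_succ]
  have h4 : ∀ i : Fin (q + 1), Fin.removeNth (α := fun _ => J) i.succ
      (Matrix.vecCons (ζ x) fun a => fderiv ℝ S x (v a)) =
      Matrix.vecCons (ζ x) (fun a => fderiv ℝ S x (Fin.removeNth i v a)) := by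
    intro i
    funext a
    refine Fin.cases ?_ (fun b => ?_) a <;> simp [Fin.removeNth]
  simp [h4, hA', pow_succ, Finset.sum_add_distrib,
    ContinuousAlternatingMap.alternatizeUncurryFin_apply, Function.comp_def]

/-- By the chain rule, a Lie derivative becomes a variation of the composed map, the form in which
Cartan's formula can be used on prolonged sections. -/
theorem pb_lieAlong {S : E → F} {p : F →L[ℝ] J} {Z : F → J} {η : J → J [⋀^Fin q]→L[ℝ] ℝ} {x : E}
    (hS : DifferentiableAt ℝ S x) (hZ : DifferentiableAt ℝ Z (S x)) :
    pb S (lieAlong p Z η) x = pbL (fun y => p (S y)) (fun y => Z (S y)) η x := by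
  have h1 : fderiv ℝ (fun y => p (S y)) x = p.comp (fderiv ℝ S x) :=
    (p.hasFDerivAt.comp x hS.hasFDerivAt).fderiv
  have h2 : fderiv ℝ (fun y => Z (S y)) x = (fderiv ℝ Z (S x)).comp (fderiv ℝ S x) :=
    (hZ.hasFDerivAt.comp x hS.hasFDerivAt).fderiv
  rw [pb, pbL, lieAlong, h1, h2, ← mixed_one, ← mixed_compContinuousLinearMap]
  rfl

/-- The Lie derivative along the field `∂S/∂e`. -/
theorem pbL_fderiv {S : E → J} {η : J → J [⋀^Fin q]→L[ℝ] ℝ} {x : E}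
    (hη : DifferentiableAt ℝ η (S x)) (hS : ContDiffAt ℝ ∞ S x) (e : E) :
    pbL S (fun y => fderiv ℝ S y e) η x = fderiv ℝ (pb S η) x e := by
  have hS' := (hS.differentiableAt (by simp)).hasFDerivAt
  have h2 := (hη.hasFDerivAt.comp x hS').continuousAlternatingMapCompContinuousLinearMap
    (hasFDerivAt_fderiv hS)
  -- Symmetry of second derivatives: varying `S` along $\partial S/\partial e$ moves $dS$ by its own
  -- derivative in the direction `e`.
  have h3 : fderiv ℝ (fun y => fderiv ℝ S y e) x = fderiv ℝ (fderiv ℝ S) x e := by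
    ext v
    rw [((hasFDerivAt_fderiv hS).clm_apply (hasFDerivAt_const e x)).fderiv]
    simp [fderiv_fderiv_symm hS v e]
  have h4 : fderiv ℝ (pb S η) x = _ := h2.fderiv
  rw [h4, pbL, h3]
  rfl

/-- The contraction with `ζ` of the Lie derivative along the field `∂S/∂e`, if this field and `ζ`
commute. -/
theorem pbi_lieAlong {S ζ : E → F} {p : F →L[ℝ] J} {Z : F → J}
    {η : J → J [⋀^Fin (q + 1)]→L[ℝ] ℝ} {x e : E}
    (hη : DifferentiableAt ℝ η (p (S x))) (hS : ContDiffAt ℝ ∞ S x) (hζ : DifferentiableAt ℝ ζ x)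
    (hZ : DifferentiableAt ℝ Z (S x))
    (hZS : (fun y => Z (S y)) =ᶠ[nhds x] fun y => fderiv ℝ (fun y => p (S y)) y e)
    (hZζ : fderiv ℝ Z (S x) (ζ x) = fderiv ℝ (fun y => p (ζ y)) x e) :
    pbi S ζ (lieAlong p Z η) x =
      fderiv ℝ (pbi (fun y => p (S y)) (fun y => p (ζ y)) η) x e := by
  have hpS : ContDiffAt ℝ ∞ (fun y => p (S y)) x := p.contDiff.contDiffAt.comp x hS
  have hpζ : DifferentiableAt ℝ (fun y => p (ζ y)) x := p.differentiableAt.comp x hζ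
  have hS1 := hS.differentiableAt (by simp)
  have h1 : fderiv ℝ (fun y => p (S y)) x = p.comp (fderiv ℝ S x) :=
    (p.hasFDerivAt.comp x hS1.hasFDerivAt).fderiv
  have h2 : fderiv ℝ (fun y => Z (S y)) x = (fderiv ℝ Z (S x)).comp (fderiv ℝ S x) :=
    (hZ.hasFDerivAt.comp x hS1.hasFDerivAt).fderiv
  have h3 : ∀ v, fderiv ℝ (fun y => Z (S y)) x v = fderiv ℝ (fderiv ℝ (fun y => p (S y))) x e v := by
    intro v
    rw [hZS.fderiv_eq, ((hasFDerivAt_fderiv hpS).clm_apply (hasFDerivAt_const e x)).fderiv]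
    simp [fderiv_fderiv_symm hpS v e]
  obtain ⟨A, hA, hA'⟩ := exists_hasFDerivAt_curryLeft (S := fun y => p (S y)) hη
    (hpS.differentiableAt (by simp)) hpζ
  have h4 : fderiv ℝ (pbi (fun y => p (S y)) (fun y => p (ζ y)) η) x = _ :=
    (hA.continuousAlternatingMapCompContinuousLinearMap (hasFDerivAt_fderiv hpS)).fderiv
  rw [h4]
  ext v
  simp only [pbi_apply, lieAlong, ContinuousAlternatingMap.add_apply,
    add_apply, ContinuousLinearMap.comp_apply, hA',
    ContinuousAlternatingMap.compContinuousLinearMapCLM_apply,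
    ContinuousAlternatingMap.compContinuousLinearMap_apply, mixed_one_apply,
    ← mixed_one]
  have h5 : ∀ i, (fderiv ℝ Z (S x)) (fderiv ℝ S x (v i)) =
      fderiv ℝ (fderiv ℝ (fun y => p (S y))) x e (v i) := by
    intro i; rw [← h3, h2]; rfl
  have h6 : Z (S x) = fderiv ℝ (fun y => p (S y)) x e := hZS.self_of_nhds
  rw [Fin.sum_univ_succ]
  have h7 : (p ∘ Matrix.vecCons (ζ x) fun a => fderiv ℝ S x (v a)) =
    Matrix.vecCons (p (ζ x)) fun a => p (fderiv ℝ S x (v a)) := by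
    funext a
    refine Fin.cases ?_ (fun b => ?_) a <;> simp
  have h8 : (fun j => p (Matrix.vecCons (ζ x) (fun a => fderiv ℝ S x (v a)) j)) =
    Matrix.vecCons (p (ζ x)) fun a => p (fderiv ℝ S x (v a)) := h7
  simp only [h7, h8, h6, Matrix.cons_val_zero, Matrix.cons_val_succ, hZζ, h5, h1,
    ContinuousLinearMap.comp_apply]
  simp [Matrix.vecCons, Function.comp_def, add_assoc]

/-- If `η` vanishes on the family of maps `S + t ζ`, its Lie derivative along `ζ` vanishes on
`S`. -/
theorem pbL_eq_zero {S ζ : E → J} {η : J → J [⋀^Fin q]→L[ℝ] ℝ} {x : E}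
    (hη : DifferentiableAt ℝ η (S x))
    (h : ∀ᶠ t : ℝ in nhds 0, (η (S x + t • ζ x)).compContinuousLinearMap
      (fderiv ℝ S x + t • fderiv ℝ ζ x) = 0) : pbL S ζ η x = 0 := by
  have h1 : HasFDerivAt (fun t : ℝ => S x + t • ζ x)
      ((ContinuousLinearMap.id ℝ ℝ).smulRight (ζ x)) 0 := by
    simpa using ((hasFDerivAt_id (𝕜 := ℝ) (0 : ℝ)).smul_const (ζ x)).const_add (S x)
  have h2 : HasFDerivAt (fun t : ℝ => fderiv ℝ S x + t • fderiv ℝ ζ x)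
      ((ContinuousLinearMap.id ℝ ℝ).smulRight (fderiv ℝ ζ x)) 0 := by
    simpa using ((hasFDerivAt_id (𝕜 := ℝ) (0 : ℝ)).smul_const (fderiv ℝ ζ x)).const_add
      (fderiv ℝ S x)
  have hη' : HasFDerivAt η (fderiv ℝ η (S x)) (S x + (0 : ℝ) • ζ x) := by
    simpa using hη.hasFDerivAt
  have h3 := (hη'.comp (0 : ℝ) h1).continuousAlternatingMapCompContinuousLinearMap h2
  -- The form in `h`, as a function of `t`, has derivative `pbL` at 0 and is locally constant.
  have h4 := h3.fderiv.symm.trans ((Filter.EventuallyEq.fderiv_eq h).trans (fderiv_const_apply 0))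
  have h5 := DFunLike.congr_fun h4 (1 : ℝ)
  simpa [pbL] using h5

end Pullback

/-! ### Multi-indices and partial derivatives -/

section Partials

variable {N : ℕ} {V : Type*} [NormedAddCommGroup V] [NormedSpace ℝ V]
  {U : Set (Fin N → ℝ)} {f g : (Fin N → ℝ) → V}

theorem count_letters (I : Fin N → ℕ) (a : Fin N) : (letters I).count a = I a := by
  rw [letters, List.count_flatMap]
  have : List.map (List.count a ∘ fun i => List.replicate (I i) i) (List.finRange N) =
      List.map (fun i => if i = a then I i else 0) (List.finRange N) := by
    refine List.map_congr_left fun i _ => ?_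
    simp [List.count_replicate]
  rw [this, ← List.ofFn_eq_map, List.sum_ofFn]
  simp

theorem letters_perm {I : Fin N → ℕ} {L : List (Fin N)} (h : ∀ a, L.count a = I a) :
    (letters I).Perm L :=
  List.perm_iff_count.2 fun a => by rw [count_letters, h]

theorem letters_app (I : Fin N → ℕ) (i : Fin N) : (letters (app I i)).Perm (i :: letters I) := by
  refine letters_perm fun a => ?_
  rw [List.count_cons, count_letters]
  rcases eq_or_ne i a with rfl | h
  · simp [app]
  · simp [app, h, Ne.symm h]

theorem length_letters (I : Fin N → ℕ) : (letters I).length = ∑ i, I i := by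
  rw [← List.sum_toFinset_count_eq_length, Finset.sum_subset (Finset.subset_univ _)]
  · simp [count_letters]
  · intro a _ ha
    simpa [List.count_eq_zero] using ha

theorem sum_app (I : Fin N → ℕ) (i : Fin N) : ∑ j, app I i j = ∑ j, I j + 1 := by
  simp [app, Finset.sum_add_distrib]

@[simp]
theorem letters_zero : letters (0 : Fin N → ℕ) = [] := by
  simp [letters]

theorem contDiffOn_fderiv_apply {M : Type*} [NormedAddCommGroup M] [NormedSpace ℝ M] {f : M → V}
    {U : Set M} (hU : IsOpen U) (hf : ContDiffOn ℝ ∞ f U) {e : M → M} (he : ContDiffOn ℝ ∞ e U) :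
    ContDiffOn ℝ ∞ (fun x => fderiv ℝ f x (e x)) U :=
  (hf.fderiv_of_isOpen hU (by simp)).clm_apply he

theorem contDiffOn_partials (hU : IsOpen U) (hf : ContDiffOn ℝ ∞ f U) (L : List (Fin N)) :
    ContDiffOn ℝ ∞ (partials L f) U := by
  induction L with
  | nil => exact hf
  | cons i L ih => exact contDiffOn_fderiv_apply hU ih contDiffOn_const

theorem partials_congr (hU : IsOpen U) (h : Set.EqOn f g U) (L : List (Fin N)) :
    Set.EqOn (partials L f) (partials L g) U := by
  induction L with
  | nil => exact h
  | cons i L ih =>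
    intro x hx
    change fderiv ℝ (partials L f) x _ = fderiv ℝ (partials L g) x _
    rw [(ih.eventuallyEq_of_mem (hU.mem_nhds hx)).fderiv_eq]

theorem partials_append (L L' : List (Fin N)) (f : (Fin N → ℝ) → V) :
    partials (L ++ L') f = partials L (partials L' f) := by
  induction L with
  | nil => rfl
  | cons i L ih =>
    change (fun x => fderiv ℝ (partials (L ++ L') f) x _) = _
    rw [ih]
    rfl

/-- Adjacent transpositions generate all reorderings, and each is the symmetry of a second
derivative. This makes derivatives indexed by lists depend on the multi-index only. -/
theorem partials_perm (hU : IsOpen U) (hf : ContDiffOn ℝ ∞ f U) {L L' : List (Fin N)}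
    (h : L.Perm L') : Set.EqOn (partials L f) (partials L' f) U := by
  induction h with
  | nil => exact fun _ _ => rfl
  | cons i _ ih => exact partials_congr (L := [i]) hU ih
  | swap i j L =>
    intro x hx
    have hL := (contDiffOn_partials hU hf L).contDiffAt (hU.mem_nhds hx)
    change fderiv ℝ (fun y => fderiv ℝ (partials L f) y _) x _ =
      fderiv ℝ (fun y => fderiv ℝ (partials L f) y _) x _
    rw [((hasFDerivAt_fderiv hL).clm_apply (hasFDerivAt_const _ x)).fderiv,
      ((hasFDerivAt_fderiv hL).clm_apply (hasFDerivAt_const _ x)).fderiv]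
    simpa using fderiv_fderiv_symm hL _ _
  | trans _ _ ih ih' => exact ih.trans ih'

theorem partials_clm {V' : Type*} [NormedAddCommGroup V'] [NormedSpace ℝ V'] (A : V →L[ℝ] V')
    (hU : IsOpen U) (hf : ContDiffOn ℝ ∞ f U) (L : List (Fin N)) :
    Set.EqOn (partials L fun x => A (f x)) (fun x => A (partials L f x)) U := by
  induction L with
  | nil => exact fun _ _ => rfl
  | cons i L ih =>
    intro x hx
    have h := ((contDiffOn_partials hU hf L).contDiffAt (hU.mem_nhds hx)).differentiableAt (by simp)
    have h' : HasFDerivAt (fun x => A (partials L f x)) _ x := A.hasFDerivAt.comp x h.hasFDerivAt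
    change fderiv ℝ (partials L fun x => A (f x)) x _ = A (fderiv ℝ (partials L f) x _)
    rw [(ih.eventuallyEq_of_mem (hU.mem_nhds hx)).fderiv_eq,
      h'.fderiv]
    rfl

theorem partials_add (hU : IsOpen U) (hf : ContDiffOn ℝ ∞ f U) (hg : ContDiffOn ℝ ∞ g U)
    (L : List (Fin N)) : Set.EqOn (partials L (f + g)) (partials L f + partials L g) U := by
  induction L with
  | nil => exact fun _ _ => rfl
  | cons i L ih =>
    intro x hx
    have h := ((contDiffOn_partials hU hf L).contDiffAt (hU.mem_nhds hx)).differentiableAt (by simp)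
    have h' := ((contDiffOn_partials hU hg L).contDiffAt (hU.mem_nhds hx)).differentiableAt (by simp)
    change fderiv ℝ (partials L (f + g)) x _ = _
    rw [(ih.eventuallyEq_of_mem (hU.mem_nhds hx)).fderiv_eq, fderiv_add h h']
    rfl

theorem partials_zero (L : List (Fin N)) : partials L (0 : (Fin N → ℝ) → V) = 0 := by
  induction L with
  | nil => rfl
  | cons i L ih =>
    change (fun x => fderiv ℝ (partials L 0) x _) = _
    rw [ih]
    funext x
    simp

theorem partials_sum {ι : Type*} (t : Finset ι) (F : ι → (Fin N → ℝ) → V) (hU : IsOpen U)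
    (hF : ∀ a ∈ t, ContDiffOn ℝ ∞ (F a) U) (L : List (Fin N)) :
    Set.EqOn (partials L (∑ a ∈ t, F a)) (∑ a ∈ t, partials L (F a)) U := by
  classical
  induction t using Finset.induction_on with
  | empty => simp [partials_zero, Set.eqOn_refl]
  | insert a t ha ih =>
    rw [Finset.sum_insert ha, Finset.sum_insert ha]
    have h1 : ContDiffOn ℝ ∞ (∑ a ∈ t, F a) U := by
      have := ContDiffOn.sum (t := U) (f := F) (s := t)
        fun b hb => hF b (Finset.mem_insert_of_mem hb)
      simpa [← Finset.sum_apply] using this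
    refine (partials_add hU (hF a (Finset.mem_insert_self _ _)) h1 L).trans fun x hx => ?_
    simp only [Pi.add_apply]
    rw [ih (fun b hb => hF b (Finset.mem_insert_of_mem hb)) hx]

theorem partials_const_smul (c : ℝ) (hU : IsOpen U) (hf : ContDiffOn ℝ ∞ f U) (L : List (Fin N)) :
    Set.EqOn (partials L (c • f)) (c • partials L f) U :=
  partials_clm (c • ContinuousLinearMap.id ℝ V) hU hf L

theorem fderiv_eq_sum_single {A : (Fin N → ℝ) →L[ℝ] V} (v : Fin N → ℝ) :
    A v = ∑ i, v i • A (Pi.single i 1) := by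
  conv_lhs => rw [pi_eq_sum_univ' v]
  simp [map_sum]

theorem partials_app (hU : IsOpen U) (hf : ContDiffOn ℝ ∞ f U) (I : Fin N → ℕ) (i : Fin N) :
    Set.EqOn (partials (letters (app I i)) f)
      (fun x => fderiv ℝ (partials (letters I) f) x (Pi.single i 1)) U :=
  partials_perm hU hf (letters_app I i)

end Partials

/-! ### Coordinates and projections -/

section Coordinates

variable {N m k l : ℕ}

theorem coord_of_le {u : Jet N m k} {I : Fin N → ℕ} (h : ∑ i, I i ≤ k) :
    coord u I = u.2 ⟨I, h⟩ := dif_pos h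

/-- The coordinate `y_I` as a continuous linear map. -/
def coordL (I : Fin N → ℕ) : Jet N m k →L[ℝ] Fin m → ℝ :=
  LinearMap.toContinuousLinearMap
    { toFun := fun u => coord u I
      map_add' := by intro u v; by_cases h : ∑ i, I i ≤ k <;> simp [coord, h]
      map_smul' := by intro c u; by_cases h : ∑ i, I i ≤ k <;> simp [coord, h] }

@[simp]
theorem coordL_apply (I : Fin N → ℕ) (u : Jet N m k) : coordL I u = coord u I := rfl

theorem jet_ext {u v : Jet N m k} (h1 : u.1 = v.1)
    (h2 : ∀ I : Fin N → ℕ, ∑ i, I i ≤ k → coord u I = coord v I) : u = v := by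
  refine Prod.ext h1 (funext fun I => ?_)
  have := h2 I.1 I.2
  rwa [coord_of_le I.2, coord_of_le I.2] at this

@[simp]
theorem proj_fst (u : Jet N m l) : (proj l k u).1 = u.1 := rfl

theorem coord_proj {I : Fin N → ℕ} (u : Jet N m l) (h : ∑ i, I i ≤ k) :
    coord (proj l k u) I = coord u I := coord_of_le h

theorem proj_proj {K : ℕ} (h : k ≤ l) (u : Jet N m K) :
    proj l k (proj K l u) = proj K k u := by
  refine jet_ext rfl fun I hI => ?_
  rw [coord_proj _ hI, coord_proj _ hI, coord_proj _ (hI.trans h)]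

@[simp]
theorem pt_proj (u : Jet N m l) : pt (proj l k u) = pt u := by
  refine Prod.ext rfl (coord_proj _ ?_)
  simp

/-- The projection `π_{k,0}` as a continuous linear map. -/
def ptL : Jet N m k →L[ℝ] Loc N m := (ContinuousLinearMap.fst ℝ _ _).prod (coordL 0)

theorem isOpen_jetDom {W : Set (Loc N m)} (hW : IsOpen W) (k : ℕ) : IsOpen (jetDom W k) :=
  hW.preimage ptL.continuous

theorem proj_mem_jetDom {W : Set (Loc N m)} {u : Jet N m l} (hu : u ∈ jetDom W l) :
    proj l k u ∈ jetDom W k := by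
  change pt (proj l k u) ∈ W
  rwa [pt_proj]

/-- The linear part of the affine map `totalVec i`. -/
def totalLin (i : Fin N) : Jet N m (k + 1) →L[ℝ] Jet N m k :=
  (0 : Jet N m (k + 1) →L[ℝ] Fin N → ℝ).prod
    (ContinuousLinearMap.pi fun I : MIdx N k => coordL (app I.1 i))

theorem totalVec_eq (i : Fin N) (u : Jet N m (k + 1)) :
    totalVec i u = (Pi.single i 1, 0) + totalLin i u := by
  simp [totalVec, totalLin]

theorem hasFDerivAt_totalVec (i : Fin N) (u : Jet N m (k + 1)) :
    HasFDerivAt (totalVec i) (totalLin i : Jet N m (k + 1) →L[ℝ] Jet N m k) u := by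
  have : (totalVec i : Jet N m (k + 1) → Jet N m k) =
      fun u => (Pi.single i 1, 0) + totalLin i u := funext fun u => totalVec_eq i u
  rw [this]
  exact (totalLin i).hasFDerivAt.const_add _

theorem contDiff_totalVec (i : Fin N) :
    ContDiff ℝ ∞ (totalVec i : Jet N m (k + 1) → Jet N m k) := by
  have : (totalVec i : Jet N m (k + 1) → Jet N m k) =
      fun u => (Pi.single i 1, 0) + totalLin i u := funext fun u => totalVec_eq i u
  rw [this]
  exact contDiff_const.add (totalLin i).contDiff

theorem coord_totalVec (i : Fin N) (u : Jet N m (k + 1)) {I : Fin N → ℕ} (h : ∑ j, I j ≤ k) :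
    coord (totalVec i u) I = coord u (app I i) := coord_of_le h

theorem hor_apply (u : Jet N m (k + 1)) (w : Jet N m k) :
    hor u w = ∑ i, w.1 i • totalVec i u := by
  simp [hor]

theorem hor_fst (u : Jet N m (k + 1)) (w : Jet N m k) : (hor u w).1 = w.1 := by
  rw [hor_apply, Prod.fst_sum]
  funext j
  simp [totalVec, Finset.sum_apply, Pi.single_apply]

theorem ver_fst (u : Jet N m (k + 1)) (w : Jet N m k) : (ver u w).1 = 0 := by
  simp [ver, hor_fst]

theorem hor_of_vertical (u : Jet N m (k + 1)) {w : Jet N m k} (h : w.1 = 0) : hor u w = 0 := by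
  simp [hor_apply, h]

theorem ver_of_vertical (u : Jet N m (k + 1)) {w : Jet N m k} (h : w.1 = 0) : ver u w = w := by
  simp [ver, hor_of_vertical u h]

end Coordinates

/-! ### Prolongations of sections and of vertical variations -/

section Sections

variable {N m k l : ℕ} {U : Set (Fin N → ℝ)} {s V : (Fin N → ℝ) → Fin m → ℝ}

/-- The prolongation of a vertical variation `V` of a section. -/
def vjet (k : ℕ) (V : (Fin N → ℝ) → Fin m → ℝ) (x : Fin N → ℝ) : Jet N m k :=
  (0, fun I => partials (letters I.1) V x)

theorem coord_jetOf {I : Fin N → ℕ} (h : ∑ i, I i ≤ k) (x : Fin N → ℝ) :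
    coord (jetOf k s x) I = partials (letters I) s x := coord_of_le h

theorem coord_vjet {I : Fin N → ℕ} (h : ∑ i, I i ≤ k) (x : Fin N → ℝ) :
    coord (vjet k V x) I = partials (letters I) V x := coord_of_le h

theorem proj_jetOf (h : k ≤ l) (x : Fin N → ℝ) : proj l k (jetOf l s x) = jetOf k s x :=
  jet_ext rfl fun _ hI => by rw [coord_proj _ hI, coord_jetOf hI, coord_jetOf (hI.trans h)]

theorem proj_vjet (h : k ≤ l) (x : Fin N → ℝ) : proj l k (vjet l V x) = vjet k V x :=
  jet_ext rfl fun _ hI => by rw [coord_proj _ hI, coord_vjet hI, coord_vjet (hI.trans h)]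

@[simp]
theorem pt_jetOf (x : Fin N → ℝ) : pt (jetOf k s x) = (x, s x) := by
  refine Prod.ext rfl ?_
  change coord _ 0 = _
  rw [coord_jetOf (by simp), letters_zero]
  rfl

theorem contDiffOn_jetOf (hU : IsOpen U) (hs : ContDiffOn ℝ ∞ s U) (k : ℕ) :
    ContDiffOn ℝ ∞ (jetOf k s) U :=
  contDiffOn_id.prodMk (contDiffOn_pi.2 fun _ => contDiffOn_partials hU hs _)

theorem contDiffOn_vjet (hU : IsOpen U) (hV : ContDiffOn ℝ ∞ V U) (k : ℕ) :
    ContDiffOn ℝ ∞ (vjet k V) U :=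
  contDiffOn_const.prodMk (contDiffOn_pi.2 fun _ => contDiffOn_partials hU hV _)

/-- Differentiating $y_I=\partial_Is$ in the direction $i$ gives the coordinate $y_{Ii}$ of the next
jet, so the formal derivatives span the tangent space of a prolonged section. -/
theorem fderiv_jetOf_apply (hU : IsOpen U) (hs : ContDiffOn ℝ ∞ s U) {x : Fin N → ℝ} (hx : x ∈ U)
    (v : Fin N → ℝ) : fderiv ℝ (jetOf k s) x v = ∑ i, v i • totalVec i (jetOf (k + 1) s x) := by
  have h : ∀ I : MIdx N k, HasFDerivAt (partials (letters I.1) s)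
      (fderiv ℝ (partials (letters I.1) s) x) x := fun I =>
    (((contDiffOn_partials hU hs _).contDiffAt (hU.mem_nhds hx)).differentiableAt
      (by simp)).hasFDerivAt
  have h1 : HasFDerivAt (jetOf k s) _ x := (hasFDerivAt_id x).prodMk (hasFDerivAt_pi.2 h)
  rw [fderiv_eq_sum_single v, h1.fderiv]
  refine Finset.sum_congr rfl fun i _ => congrArg (v i • ·) ?_
  refine Prod.ext rfl (funext fun I => ?_)
  change fderiv ℝ (partials (letters I.1) s) x _ = coord _ _
  rw [coord_jetOf (by rw [sum_app]; exact Nat.succ_le_succ I.2), partials_app hU hs I.1 i hx]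

theorem fderiv_jetOf_single (hU : IsOpen U) (hs : ContDiffOn ℝ ∞ s U) {x : Fin N → ℝ} (hx : x ∈ U)
    (i : Fin N) : fderiv ℝ (jetOf k s) x (Pi.single i 1) = totalVec i (jetOf (k + 1) s x) := by
  rw [fderiv_jetOf_apply hU hs hx]
  simp [Pi.single_apply]

theorem fderiv_jetOf_fst (hU : IsOpen U) (hs : ContDiffOn ℝ ∞ s U) {x : Fin N → ℝ} (hx : x ∈ U)
    (v : Fin N → ℝ) : (fderiv ℝ (jetOf k s) x v).1 = v := by
  rw [fderiv_jetOf_apply hU hs hx, Prod.fst_sum]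
  funext j
  simp [totalVec, Finset.sum_apply, Pi.single_apply]

theorem hor_jetOf (hU : IsOpen U) (hs : ContDiffOn ℝ ∞ s U) {x : Fin N → ℝ} (hx : x ∈ U)
    (w : Jet N m k) : hor (jetOf (k + 1) s x) w = fderiv ℝ (jetOf k s) x w.1 := by
  rw [hor_apply, fderiv_jetOf_apply hU hs hx]

theorem fderiv_vjet_single (hU : IsOpen U) (hV : ContDiffOn ℝ ∞ V U) {x : Fin N → ℝ} (hx : x ∈ U)
    (i : Fin N) : fderiv ℝ (vjet k V) x (Pi.single i 1) = totalLin i (vjet (k + 1) V x) := by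
  have h : ∀ I : MIdx N k, HasFDerivAt (partials (letters I.1) V)
      (fderiv ℝ (partials (letters I.1) V) x) x := fun I =>
    (((contDiffOn_partials hU hV _).contDiffAt (hU.mem_nhds hx)).differentiableAt
      (by simp)).hasFDerivAt
  have h1 : HasFDerivAt (vjet k V) _ x :=
    (hasFDerivAt_const (0 : Fin N → ℝ) x).prodMk (hasFDerivAt_pi.2 h)
  rw [h1.fderiv]
  refine Prod.ext rfl (funext fun I => ?_)
  change fderiv ℝ (partials (letters I.1) V) x _ = coord _ _
  rw [coord_vjet (by rw [sum_app]; exact Nat.succ_le_succ I.2), partials_app hU hV I.1 i hx]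

/-- In coordinates the jet is linear in the section, so deforming $s$ to $s+tV$ moves its
prolongation along a straight line with velocity `vjet`. -/
theorem jetOf_add_smul (hU : IsOpen U) (hs : ContDiffOn ℝ ∞ s U) (hV : ContDiffOn ℝ ∞ V U)
    {x : Fin N → ℝ} (hx : x ∈ U) (t : ℝ) :
    jetOf k (s + t • V) x = jetOf k s x + t • vjet k V x := by
  refine jet_ext (by simp [jetOf, vjet]) fun I hI => ?_
  rw [coord_jetOf hI, partials_add (g := t • V) hU hs (hV.const_smul t) _ hx, Pi.add_apply,
    partials_const_smul t hU hV _ hx, ← coordL_apply, map_add, map_smul, coordL_apply, coordL_apply,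
    coord_jetOf hI, coord_vjet hI]
  rfl

end Sections

/-! ### Sections with a prescribed jet -/

section Taylor

variable {N m k : ℕ}

/-- The normalized monomial `(x - c)^J / J!`. -/
def taylorMono (c : Fin N → ℝ) (J : Fin N → ℕ) (x : Fin N → ℝ) : ℝ :=
  ∏ i, (x i - c i) ^ J i / ((J i).factorial : ℝ)

theorem contDiff_taylorMono (c : Fin N → ℝ) (J : Fin N → ℕ) : ContDiff ℝ ∞ (taylorMono c J) := by
  unfold taylorMono
  fun_prop

/-- Dividing by $J!$ makes differentiation a pure lowering of the exponent. The case distinction is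
needed because the subtraction of multi-indices truncates when $J_i=0$. -/
theorem fderiv_taylorMono (c : Fin N → ℝ) (J : Fin N → ℕ) (x : Fin N → ℝ) (i : Fin N) :
    fderiv ℝ (taylorMono c J) x (Pi.single i 1) =
      if 0 < J i then taylorMono c (J - Pi.single i 1) x else 0 := by
  have h : ∀ j ∈ Finset.univ, HasFDerivAt
      (fun x : Fin N → ℝ => (x j - c j) ^ J j / ((J j).factorial : ℝ))
      (((J j : ℝ) * (x j - c j) ^ (J j - 1) / ((J j).factorial : ℝ)) •
        ContinuousLinearMap.proj (R := ℝ) (φ := fun _ : Fin N => ℝ) j) x := by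
    intro j _
    have h1 : HasFDerivAt (fun x : Fin N → ℝ => x j - c j)
        (ContinuousLinearMap.proj (R := ℝ) (φ := fun _ : Fin N => ℝ) j) x :=
      (hasFDerivAt_apply j x).sub_const (c j)
    have h2 := ((hasDerivAt_pow (J j) (x j - c j)).div_const
      ((J j).factorial : ℝ)).comp_hasFDerivAt x h1
    exact h2
  have h3 : HasFDerivAt (taylorMono c J) _ x := HasFDerivAt.finsetProd h
  rw [h3.fderiv]
  simp only [sum_apply, smul_apply,
    ContinuousLinearMap.proj_apply, smul_eq_mul, Pi.single_apply]
  simp only [mul_ite, mul_one, mul_zero, Finset.sum_ite_eq', Finset.mem_univ, if_true]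
  by_cases hi : 0 < J i
  · rw [if_pos hi, taylorMono, ← Finset.mul_prod_erase _ _ (Finset.mem_univ i), mul_comm]
    congr 1
    · obtain ⟨p, hp⟩ : ∃ p, J i = p + 1 := ⟨J i - 1, by omega⟩
      simp only [Pi.sub_apply, Pi.single_eq_same, hp, Nat.factorial_succ]
      push_cast
      have : (p.factorial : ℝ) ≠ 0 := by positivity
      have : (p : ℝ) + 1 ≠ 0 := by positivity
      field_simp
    · refine Finset.prod_congr rfl fun j hj => ?_
      simp [Finset.ne_of_mem_erase hj]
  · have : J i = 0 := by omega
    simp [this]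

theorem partials_taylorMono (c : Fin N → ℝ) (J : Fin N → ℕ) (L : List (Fin N)) :
    partials L (taylorMono c J) =
      if (∀ i, L.count i ≤ J i) then taylorMono c (fun i => J i - L.count i) else 0 := by
  induction L with
  | nil => simp [partials]
  | cons i L ih =>
    funext x
    change fderiv ℝ (partials L (taylorMono c J)) x _ = _
    rw [ih]
    by_cases h : ∀ a, L.count a ≤ J a
    · rw [if_pos h, fderiv_taylorMono]
      by_cases h' : 0 < J i - L.count i
      · rw [if_pos h', if_pos]
        · congr 1
          funext a
          rcases eq_or_ne a i with rfl | ha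
          · simp; omega
          · simp [ha, List.count_cons_of_ne (Ne.symm ha)]
        · intro a
          rcases eq_or_ne a i with rfl | ha
          · simp; omega
          · simpa [List.count_cons_of_ne (Ne.symm ha)] using h a
      · rw [if_neg h', if_neg]
        · rfl
        · intro h''
          have := h'' i
          simp at this
          omega
    · rw [if_neg h, if_neg]
      · simp
      · intro h''
        refine h fun a => le_trans ?_ (h'' a)
        rw [List.count_cons]
        omega

theorem taylorMono_self (c : Fin N → ℝ) (J : Fin N → ℕ) :
    taylorMono c J c = if J = 0 then 1 else 0 := by
  by_cases h : J = 0
  · simp [taylorMono, h]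
  · rw [if_neg h]
    obtain ⟨i, hi⟩ := Function.ne_iff.1 h
    exact Finset.prod_eq_zero (Finset.mem_univ i) (by simp [zero_pow hi])

theorem contDiff_taylorSection (u : Jet N m k) : ContDiff ℝ ∞ (taylorSection u) := by
  have : taylorSection u = fun x => ∑ I : MIdx N k, taylorMono u.1 I.1 x • u.2 I := rfl
  rw [this]
  exact ContDiff.sum fun I _ => (contDiff_taylorMono _ _).smul contDiff_const

theorem partials_taylorSection (u : Jet N m k) {K : Fin N → ℕ} (hK : ∑ i, K i ≤ k) :
    partials (letters K) (taylorSection u) u.1 = coord u K := by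
  classical
  have h0 : taylorSection u = ∑ I : MIdx N k, fun x =>
      ((1 : ℝ →L[ℝ] ℝ).smulRight (u.2 I)) (taylorMono u.1 I.1 x) := by
    funext x; simp [taylorSection, taylorMono, Finset.sum_apply]
  rw [h0, partials_sum _ _ isOpen_univ _ _ (Set.mem_univ _), Finset.sum_apply, coord_of_le hK,
    Finset.sum_eq_single ⟨K, hK⟩]
  · rw [partials_clm _ isOpen_univ (contDiff_taylorMono _ _).contDiffOn _ (Set.mem_univ _),
      partials_taylorMono]
    simp [count_letters, taylorMono_self, ← Pi.zero_def]
  · intro I _ hI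
    rw [partials_clm _ isOpen_univ (contDiff_taylorMono _ _).contDiffOn _ (Set.mem_univ _),
      partials_taylorMono]
    by_cases h : ∀ i, (letters K).count i ≤ I.1 i
    · rw [if_pos h]
      beta_reduce
      rw [taylorMono_self, if_neg]
      · simp
      · intro h'
        refine hI (Subtype.ext (funext fun i => ?_))
        have h1 := congrFun h' i
        have h2 := h i
        simp only [count_letters, Pi.zero_apply] at h1 h2
        change I.1 i = K i
        omega
    · simp [h]
  · intro h; exact absurd (Finset.mem_univ _) h
  · intro I _
    exact (((1 : ℝ →L[ℝ] ℝ).smulRight (u.2 I)).contDiff.comp (contDiff_taylorMono _ _)).contDiffOn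

/-- Each jet is thus realized by a globally smooth section, which is what allows pointwise
identities to be tested on sections. -/
theorem jetOf_taylorSection (u : Jet N m k) : jetOf k (taylorSection u) u.1 = u :=
  jet_ext rfl fun K hK => by rw [coord_jetOf hK, partials_taylorSection u hK]

/-- A vertical vector carries no base point, so its components are made into a polynomial centred at
the base point of `u`. -/
theorem vjet_taylorSection (u w : Jet N m k) (hw : w.1 = 0) :
    vjet k (taylorSection (u.1, w.2)) u.1 = w :=
  jet_ext hw.symm fun K hK => by
    rw [coord_vjet hK]
    exact (partials_taylorSection (u.1, w.2) hK).trans rfl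

end Taylor

/-! ### Horizontal forms and forms of contact degree one -/

section Determination

variable {N m k l q : ℕ}

/-- `f` vanishes if one of its arguments is vertical. -/
def IsHor (f : Jet N m k [⋀^Fin q]→L[ℝ] ℝ) : Prop :=
  ∀ v : Fin q → Jet N m k, (∃ a, (v a).1 = 0) → f v = 0

/-- `f` vanishes if two of its arguments are vertical. -/
def IsContactOne (f : Jet N m k [⋀^Fin q]→L[ℝ] ℝ) : Prop :=
  ∀ v : Fin q → Jet N m k, (∃ a b, a ≠ b ∧ (v a).1 = 0 ∧ (v b).1 = 0) → f v = 0

theorem alternating_map_add_expand {E : Type*} [NormedAddCommGroup E] [NormedSpace ℝ E]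
    (f : E [⋀^Fin q]→L[ℝ] ℝ) (v w : Fin q → E) :
    f (v + w) = ∑ S : Finset (Fin q), f (S.piecewise v w) := by
  classical
  exact f.toMultilinearMap.map_add_univ v w

/-- Expanding $w+(v-w)$ multilinearly, every term but the one in $w$ alone has a vertical argument
$v_a-w_a$. -/
theorem IsHor.congr {f : Jet N m k [⋀^Fin q]→L[ℝ] ℝ} (hf : IsHor f) {v w : Fin q → Jet N m k}
    (h : ∀ a, (v a).1 = (w a).1) : f v = f w := by
  have hv : v = w + (v - w) := by simp
  rw [hv, alternating_map_add_expand, Finset.sum_eq_single Finset.univ]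
  · simp
  · intro S _ hS
    obtain ⟨a, ha⟩ : ∃ a, a ∉ S := by
      by_contra hc
      push Not at hc
      exact hS (Finset.eq_univ_iff_forall.2 hc)
    exact hf _ ⟨a, by simp [ha, h a]⟩
  · intro h; exact absurd (Finset.mem_univ _) h

/-- Each argument splits into a vector in the image of `T` and a vertical one. In the expansion,
terms with two vertical arguments vanish by contact degree, and the term with none vanishes because
`N + 1` vectors come from an `N`-dimensional space. In the remaining terms the single vertical
argument is moved to the front. -/
theorem IsContactOne.eq_zero {f : Jet N m k [⋀^Fin (N + 1)]→L[ℝ] ℝ} (hf : IsContactOne f)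
    (T : (Fin N → ℝ) →L[ℝ] Jet N m k) (hT : ∀ v, (T v).1 = v)
    (h : ∀ w : Jet N m k, w.1 = 0 → ∀ v : Fin N → Fin N → ℝ,
      f (Matrix.vecCons w fun a => T (v a)) = 0) : f = 0 := by
  ext v
  have hv : v = (fun a => T (v a).1) + (fun a => v a - T (v a).1) := by
    funext a; simp
  rw [hv, alternating_map_add_expand]
  refine Finset.sum_eq_zero fun S _ => ?_
  by_cases hS : S = Finset.univ
  · subst hS
    rw [Finset.piecewise_univ]
    have := alternating_eq_zero_of_finrank_lt (by simp) (f.compContinuousLinearMap T)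
    exact DFunLike.congr_fun this fun a => (v a).1
  · obtain ⟨a, ha⟩ : ∃ a, a ∉ S := by
      by_contra hc
      push Not at hc
      exact hS (Finset.eq_univ_iff_forall.2 hc)
    by_cases hb : ∃ b, b ≠ a ∧ b ∉ S
    · obtain ⟨b, hba, hb⟩ := hb
      exact hf _ ⟨a, b, hba.symm, by simp [ha, hT], by simp [hb, hT]⟩
    · push Not at hb
      have : S.piecewise (fun a => T (v a).1) (fun a => v a - T (v a).1) =
          a.insertNth (v a - T (v a).1) (fun b => T (v (a.succAbove b)).1) := by
        rw [Fin.eq_insertNth_iff]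
        refine ⟨by simp [ha], funext fun b => ?_⟩
        simp [Fin.removeNth, hb _ (Fin.succAbove_ne a b)]
      rw [this, ContinuousAlternatingMap.map_insertNth, h _ (by simp [hT])]
      simp

theorem fderiv_jetOf_eq {U : Set (Fin N → ℝ)} {s : (Fin N → ℝ) → Fin m → ℝ} (hU : IsOpen U)
    (hs : ContDiffOn ℝ ∞ s U) (h : k ≤ l) {x : Fin N → ℝ} (hx : x ∈ U) :
    fderiv ℝ (jetOf k s) x = (proj l k).comp (fderiv ℝ (jetOf l s) x) := by
  have h1 := (((contDiffOn_jetOf hU hs l).contDiffAt (hU.mem_nhds hx)).differentiableAt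
    (by simp)).hasFDerivAt
  have h2 : HasFDerivAt (fun y => proj l k (jetOf l s y)) _ x := (proj l k).hasFDerivAt.comp x h1
  rw [← h2.fderiv]
  congr 1
  funext y
  exact (proj_jetOf h y).symm

/-- Horizontal forms are determined by their pull-backs along sections. -/
theorem eqOn_of_pb_eq {W : Set (Loc N m)} {η η' : Form N m k q}
    (hη : ∀ u ∈ jetDom W k, IsHor (η u)) (hη' : ∀ u ∈ jetDom W k, IsHor (η' u))
    (h : ∀ s : (Fin N → ℝ) → Fin m → ℝ, ContDiff ℝ ∞ s → ∀ x, (x, s x) ∈ W →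
      pb (jetOf k s) η x = pb (jetOf k s) η' x) : Set.EqOn η η' (jetDom W k) := by
  intro u hu
  have hs := contDiff_taylorSection u
  have hj := jetOf_taylorSection u
  ext v
  have hx : (u.1, taylorSection u u.1) ∈ W := by
    rw [← pt_jetOf (k := k), hj]; exact hu
  have h1 := DFunLike.congr_fun (h _ hs u.1 hx) fun a => (v a).1
  rw [pb_apply, pb_apply, hj] at h1
  -- A horizontal form sees only base components, so every argument may be replaced by the tangent
  -- vector of the section above it.
  have hfst : ∀ a, (v a).1 = (fderiv ℝ (jetOf k (taylorSection u)) u.1 (v a).1).1 := fun a =>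
    (fderiv_jetOf_fst isOpen_univ hs.contDiffOn (Set.mem_univ _) _).symm
  rw [(hη u hu).congr hfst, (hη' u hu).congr hfst, h1]

/-- `(N+1)`-forms of contact degree one are determined by their contractions with vertical
variations, pulled back along sections. -/
theorem eqOn_of_pbi_eq {W : Set (Loc N m)} {η η' : Form N m k (N + 1)}
    (hη : ∀ u ∈ jetDom W k, IsContactOne (η u)) (hη' : ∀ u ∈ jetDom W k, IsContactOne (η' u))
    (h : ∀ s V : (Fin N → ℝ) → Fin m → ℝ, ContDiff ℝ ∞ s → ContDiff ℝ ∞ V → ∀ x, (x, s x) ∈ W →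
      pbi (jetOf k s) (vjet k V) η x = pbi (jetOf k s) (vjet k V) η' x) :
    Set.EqOn η η' (jetDom W k) := by
  intro u hu
  have hs := contDiff_taylorSection u
  have hj := jetOf_taylorSection u
  have hx : (u.1, taylorSection u u.1) ∈ W := by
    rw [← pt_jetOf (k := k), hj]; exact hu
  rw [← sub_eq_zero]
  refine IsContactOne.eq_zero (T := fderiv ℝ (jetOf k (taylorSection u)) u.1) ?_
    (fderiv_jetOf_fst isOpen_univ hs.contDiffOn (Set.mem_univ _)) ?_
  · intro v hv
    simp [hη u hu v hv, hη' u hu v hv]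
  · intro w hw v
    have h1 := DFunLike.congr_fun
      (h _ _ hs (contDiff_taylorSection ((u.1, w.2) : Jet N m k)) u.1 hx) v
    rw [pbi_apply, pbi_apply, hj, vjet_taylorSection u w hw] at h1
    simp [h1]

end Determination

/-! ### Smoothness of the operations on forms -/

section Smoothness

variable {N m k l q : ℕ} {W : Set (Loc N m)}

theorem contDiffOn_extDeriv {E : Type*} [NormedAddCommGroup E] [NormedSpace ℝ E] {D : Set E}
    (hD : IsOpen D) {η : E → E [⋀^Fin q]→L[ℝ] ℝ} (hη : ContDiffOn ℝ ∞ η D) :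
    ContDiffOn ℝ ∞ (extDeriv η) D :=
  (ContinuousAlternatingMap.alternatizeUncurryFinCLM ℝ E ℝ).contDiff.comp_contDiffOn
    (hη.fderiv_of_isOpen hD (by simp))

theorem contDiffOn_lieAlong {E F : Type*} [NormedAddCommGroup E] [NormedSpace ℝ E]
    [FiniteDimensional ℝ E] [NormedAddCommGroup F] [NormedSpace ℝ F] [FiniteDimensional ℝ F]
    {D : Set E} {D' : Set F} (hD : IsOpen D) (hD' : IsOpen D') {p : F →L[ℝ] E}
    (hp : Set.MapsTo p D' D) {Z : F → E} (hZ : ContDiffOn ℝ ∞ Z D')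
    {η : E → E [⋀^Fin q]→L[ℝ] ℝ} (hη : ContDiffOn ℝ ∞ η D) :
    ContDiffOn ℝ ∞ (lieAlong p Z η) D' := by
  refine contDiffOn_alternating fun v => ?_
  simp only [lieAlong, ContinuousAlternatingMap.add_apply,
    ContinuousAlternatingMap.compContinuousLinearMap_apply, mixed_one_apply]
  have hp' : ContDiffOn ℝ ∞ p D' := p.contDiff.contDiffOn
  refine ContDiffOn.add ?_ (ContDiffOn.sum fun i _ => ?_)
  · refine contDiffOn_alternating_apply ?_ fun i => contDiffOn_const
    exact ((hη.fderiv_of_isOpen hD (m := ∞) (by simp)).comp hp' hp).clm_apply hZ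
  · refine contDiffOn_alternating_apply (hη.comp hp' hp) fun j => ?_
    rcases eq_or_ne j i with rfl | hj
    · simpa using (hZ.fderiv_of_isOpen hD' (m := ∞) (by simp)).clm_apply contDiffOn_const
    · simpa [hj] using contDiffOn_const

theorem mapsTo_proj : Set.MapsTo (proj l k : Jet N m l →L[ℝ] Jet N m k) (jetDom W l) (jetDom W k) :=
  fun _ hu => proj_mem_jetDom hu

variable {η : Form N m k q}

theorem contDiffOn_comp_proj {G : Type*} [NormedAddCommGroup G] [NormedSpace ℝ G]
    {f : Jet N m k → G} (hf : ContDiffOn ℝ ∞ f (jetDom W k)) (l : ℕ) :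
    ContDiffOn ℝ ∞ (fun u : Jet N m l => f (proj l k u)) (jetDom W l) :=
  hf.comp (proj l k).contDiff.contDiffOn mapsTo_proj

theorem contDiffOn_pull (hη : ContDiffOn ℝ ∞ η (jetDom W k)) (l : ℕ) :
    ContDiffOn ℝ ∞ (pull l η) (jetDom W l) :=
  contDiffOn_alternating fun v =>
    contDiffOn_alternating_apply (g := fun _ a => proj l k (v a)) (contDiffOn_comp_proj hη l)
      fun _ => contDiffOn_const

theorem contDiff_hor (w : Jet N m k) : ContDiff ℝ ∞ fun u : Jet N m (k + 1) => hor u w := by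
  simp only [hor_apply]
  exact ContDiff.sum fun i _ => (contDiff_totalVec i).const_smul (w.1 i)

theorem contDiffOn_pc (hη : ContDiffOn ℝ ∞ η (jetDom W k)) (i : ℕ) :
    ContDiffOn ℝ ∞ (pc i η) (jetDom W (k + 1)) := by
  refine contDiffOn_alternating fun v => ?_
  simp only [pc, mixed_apply]
  refine ContDiffOn.sum fun S _ => contDiffOn_alternating_apply (contDiffOn_comp_proj hη _) fun a => ?_
  by_cases h : a ∈ S
  · simpa [h, ver] using contDiffOn_const.sub (contDiff_hor _).contDiffOn
  · simpa [h] using (contDiff_hor _).contDiffOn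

theorem contDiffOn_dH (hW : IsOpen W) (hη : ContDiffOn ℝ ∞ η (jetDom W k)) :
    ContDiffOn ℝ ∞ (dH η) (jetDom W (k + 2)) := by
  have := ContDiffOn.sum (t := jetDom W (k + 2)) (s := Finset.range (q + 1))
    (f := fun l => pc l (extDeriv (pc l η))) (n := ∞) (𝕜 := ℝ)
    fun l _ => contDiffOn_pc (contDiffOn_extDeriv (isOpen_jetDom hW _) (contDiffOn_pc hη l)) l
  simpa [dH, ← Finset.sum_apply] using this

theorem contDiffOn_formalD (hW : IsOpen W) (hη : ContDiffOn ℝ ∞ η (jetDom W k)) (i : Fin N) :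
    ContDiffOn ℝ ∞ (formalD i η) (jetDom W (k + 1)) :=
  contDiffOn_lieAlong (isOpen_jetDom hW _) (isOpen_jetDom hW _) mapsTo_proj
    (contDiff_totalVec i).contDiffOn hη

theorem contDiffOn_formalDs (hW : IsOpen W) (hη : ContDiffOn ℝ ∞ η (jetDom W k))
    (L : List (Fin N)) : ContDiffOn ℝ ∞ (formalDs L η) (jetDom W (k + L.length)) := by
  induction L with
  | nil => exact hη
  | cons i L ih => exact contDiffOn_formalD hW ih i

theorem contDiffOn_formalDI (hW : IsOpen W) (hη : ContDiffOn ℝ ∞ η (jetDom W k)) (l : ℕ)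
    (I : Fin N → ℕ) : ContDiffOn ℝ ∞ (formalDI l I η) (jetDom W l) :=
  contDiffOn_pull (contDiffOn_formalDs hW hη _) l

theorem contDiffOn_contractConst {η : Form N m k (q + 1)} (hη : ContDiffOn ℝ ∞ η (jetDom W k))
    (v : Jet N m k) : ContDiffOn ℝ ∞ (contractConst v η) (jetDom W k) :=
  contDiffOn_alternating fun w =>
    contDiffOn_alternating_apply (g := fun _ => Matrix.vecCons v w) hη fun _ => contDiffOn_const

theorem contDiffOn_contract {η : Form N m k (q + 1)} (hη : ContDiffOn ℝ ∞ η (jetDom W k))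
    {Z : Jet N m (k + 1) → Jet N m k} (hZ : ContDiffOn ℝ ∞ Z (jetDom W (k + 1))) :
    ContDiffOn ℝ ∞ (contract Z η) (jetDom W (k + 1)) := by
  refine contDiffOn_alternating fun v => contDiffOn_alternating_apply
    (g := fun u => Matrix.vecCons (Z u) fun a => proj (k + 1) k (v a))
    (contDiffOn_comp_proj hη _) fun a => ?_
  refine Fin.cases ?_ (fun b => ?_) a
  · simpa using hZ
  · simpa using contDiffOn_const

theorem contactForm_apply (σ : Fin m) (u v : Jet N m (k + 1)) :
    contactForm σ u v = coord v 0 σ - ∑ i, coord u (Pi.single i 1) σ * v.1 i := rfl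

theorem wedge_apply (θ : Jet N m k → Jet N m k →L[ℝ] ℝ) (η : Form N m k q) (u : Jet N m k)
    (v : Fin (q + 1) → Jet N m k) :
    wedge θ η u v = ∑ i : Fin (q + 1), (-1) ^ (i : ℕ) • (θ u (v i) * η u (i.removeNth v)) := by
  simp [wedge, ContinuousAlternatingMap.alternatizeUncurryFin_apply]

theorem contDiffOn_wedge_contactForm {η : Form N m (k + 1) q} (σ : Fin m)
    (hη : ContDiffOn ℝ ∞ η (jetDom W (k + 1))) :
    ContDiffOn ℝ ∞ (wedge (contactForm σ) η) (jetDom W (k + 1)) := by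
  refine contDiffOn_alternating fun v => ?_
  simp only [wedge_apply, zsmul_eq_mul, contactForm_apply]
  refine ContDiffOn.sum fun i _ => contDiffOn_const.mul (ContDiffOn.mul ?_
    (contDiffOn_alternating_apply hη fun _ => contDiffOn_const))
  refine contDiffOn_const.sub (ContDiffOn.sum fun j _ => ContDiffOn.mul ?_ contDiffOn_const)
  exact (contDiff_apply ℝ ℝ σ).comp_contDiffOn (coordL (Pi.single j 1)).contDiff.contDiffOn

theorem contDiffOn_finset_sum {M G ι : Type*} [NormedAddCommGroup M] [NormedSpace ℝ M]
    [NormedAddCommGroup G] [NormedSpace ℝ G] {t : Finset ι} {f : ι → M → G} {D : Set M}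
    (h : ∀ i ∈ t, ContDiffOn ℝ ∞ (f i) D) : ContDiffOn ℝ ∞ (∑ i ∈ t, f i) D := by
  simpa [← Finset.sum_apply] using ContDiffOn.sum h

end Smoothness

/-! ### Horizontality and contact degree of the operations on forms -/

section Degree

variable {N m k l q : ℕ} {W : Set (Loc N m)}

theorem IsHor.sum {ι : Type*} {t : Finset ι} {f : ι → Jet N m k [⋀^Fin q]→L[ℝ] ℝ}
    (h : ∀ i ∈ t, IsHor (f i)) : IsHor (∑ i ∈ t, f i) := by
  intro v hv
  rw [ContinuousAlternatingMap.sum_apply]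
  exact Finset.sum_eq_zero fun i hi => h i hi v hv

theorem IsHor.smul {f : Jet N m k [⋀^Fin q]→L[ℝ] ℝ} (h : IsHor f) (c : ℝ) : IsHor (c • f) := by
  intro v hv
  simp [h v hv]

theorem IsHor.add {f g : Jet N m k [⋀^Fin q]→L[ℝ] ℝ} (hf : IsHor f) (hg : IsHor g) :
    IsHor (f + g) := by
  intro v hv
  simp [hf v hv, hg v hv]

theorem IsContactOne.sum {ι : Type*} {t : Finset ι} {f : ι → Jet N m k [⋀^Fin q]→L[ℝ] ℝ}
    (h : ∀ i ∈ t, IsContactOne (f i)) : IsContactOne (∑ i ∈ t, f i) := by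
  intro v hv
  rw [ContinuousAlternatingMap.sum_apply]
  exact Finset.sum_eq_zero fun i hi => h i hi v hv

theorem IsContactOne.add {f g : Jet N m k [⋀^Fin q]→L[ℝ] ℝ} (hf : IsContactOne f)
    (hg : IsContactOne g) : IsContactOne (f + g) := by
  intro v hv
  simp [hf v hv, hg v hv]

theorem isHor_pull {η : Form N m k q} {u : Jet N m l} (h : IsHor (η (proj l k u))) :
    IsHor (pull l η u) := by
  rintro v ⟨a, ha⟩
  exact h _ ⟨a, by simpa using ha⟩

theorem isContactOne_pull {η : Form N m k q} {u : Jet N m l}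
    (h : IsContactOne (η (proj l k u))) : IsContactOne (pull l η u) := by
  rintro v ⟨a, b, hab, ha, hb⟩
  exact h _ ⟨a, b, hab, by simpa using ha, by simpa using hb⟩

theorem isHor_pc_zero (η : Form N m k q) (u : Jet N m (k + 1)) : IsHor (pc 0 η u) := by
  rintro v ⟨a, ha⟩
  rw [pc, mixed_zero]
  exact (η (proj (k + 1) k u)).map_coord_zero a
    (hor_of_vertical u (w := proj (k + 1) k (v a)) (by simpa using ha))

/-- Each summand of $p_1$ sends only one argument through the vertical projection; of two vertical
arguments, one meets `hor` and is annihilated. -/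
theorem isContactOne_pc_one (η : Form N m k q) (u : Jet N m (k + 1)) :
    IsContactOne (pc 1 η u) := by
  rintro v ⟨a, b, hab, ha, hb⟩
  rw [pc, mixed_one_apply]
  refine Finset.sum_eq_zero fun i _ => ?_
  rcases eq_or_ne i a with rfl | hi
  · refine ContinuousAlternatingMap.map_coord_zero _ b ?_
    simpa [hab.symm] using hor_of_vertical u (w := proj (k + 1) k (v b)) (by simpa using hb)
  · refine ContinuousAlternatingMap.map_coord_zero _ a ?_
    simpa [hi.symm] using hor_of_vertical u (w := proj (k + 1) k (v a)) (by simpa using ha)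

theorem isContactOne_wedge {η : Form N m k q} {u : Jet N m k} (h : IsHor (η u))
    (θ : Jet N m k → Jet N m k →L[ℝ] ℝ) : IsContactOne (wedge θ η u) := by
  rintro v ⟨a, b, hab, ha, hb⟩
  rw [wedge_apply]
  refine Finset.sum_eq_zero fun i _ => ?_
  suffices hz : η u (i.removeNth v) = 0 by simp [hz]
  rcases eq_or_ne i a with rfl | hi
  · obtain ⟨c, hc⟩ := Fin.exists_succAbove_eq hab.symm
    exact h _ ⟨c, by simpa [Fin.removeNth, hc] using hb⟩
  · obtain ⟨c, hc⟩ := Fin.exists_succAbove_eq hi.symm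
    exact h _ ⟨c, by simpa [Fin.removeNth, hc] using ha⟩

theorem isHor_curryLeft {f : Jet N m k [⋀^Fin (q + 1)]→L[ℝ] ℝ} (h : IsContactOne f)
    {v : Jet N m k} (hv : v.1 = 0) : IsHor (f.curryLeft v) := by
  rintro w ⟨a, ha⟩
  exact h _ ⟨0, a.succ, (Fin.succ_ne_zero a).symm, by simpa using hv, by simpa using ha⟩

theorem IsHor.curryLeft {f : Jet N m k [⋀^Fin (q + 1)]→L[ℝ] ℝ} (h : IsHor f) (v : Jet N m k) :
    IsHor (f.curryLeft v) := by
  rintro w ⟨a, ha⟩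
  exact h _ ⟨a.succ, by simpa using ha⟩

/-- Vertical vectors form a constant subspace. Since $\eta$ kills it throughout a neighbourhood, so
does its derivative in any direction; the other terms are covered because `p` and the derivative of
`Z` preserve verticality. -/
theorem isHor_lieAlong {p : Jet N m l →L[ℝ] Jet N m k} (hp : ∀ w, w.1 = 0 → (p w).1 = 0)
    {Z : Jet N m l → Jet N m k} {u : Jet N m l} (hZ : ∀ w, w.1 = 0 → (fderiv ℝ Z u w).1 = 0)
    {η : Form N m k q} {D : Set (Jet N m k)} (hD : D ∈ nhds (p u))
    (hη : ∀ y ∈ D, IsHor (η y)) (hd : DifferentiableAt ℝ η (p u)) :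
    IsHor (lieAlong p Z η u) := by
  rintro v ⟨a, ha⟩
  rw [lieAlong, ContinuousAlternatingMap.add_apply, mixed_one_apply,
    ContinuousAlternatingMap.compContinuousLinearMap_apply]
  have h0 : ∀ w : Fin q → Jet N m k, (w a).1 = 0 → ∀ z, fderiv ℝ η (p u) z w = 0 := by
    intro w hw z
    have h1 : HasFDerivAt (fun y => η y w) _ (p u) :=
      (ContinuousAlternatingMap.apply ℝ (Jet N m k) ℝ w).hasFDerivAt.comp (p u) hd.hasFDerivAt
    have h2 : (fun y => η y w) =ᶠ[nhds (p u)] fun _ => 0 := by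
      filter_upwards [hD] with y hy using hη y hy w ⟨a, hw⟩
    have h3 := h1.fderiv.symm.trans (h2.fderiv_eq.trans (fderiv_const_apply 0))
    exact DFunLike.congr_fun h3 z
  rw [h0 _ (hp _ ha), zero_add]
  refine Finset.sum_eq_zero fun i _ => hη _ (mem_of_mem_nhds hD) _ ⟨a, ?_⟩
  rcases eq_or_ne a i with rfl | hi
  · simpa using hZ _ ha
  · simpa [hi] using hp _ ha

theorem isHor_formalDs (hW : IsOpen W) {η : Form N m k q} (hs : ContDiffOn ℝ ∞ η (jetDom W k))
    (hη : ∀ u ∈ jetDom W k, IsHor (η u)) (L : List (Fin N)) :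
    ∀ u ∈ jetDom W (k + L.length), IsHor (formalDs L η u) := by
  induction L with
  | nil => exact hη
  | cons i L ih =>
    intro u hu
    have hD := (isOpen_jetDom hW (k + L.length)).mem_nhds (proj_mem_jetDom hu)
    refine isHor_lieAlong (D := jetDom W (k + L.length)) (fun w hw => by simpa using hw)
      (fun w _ => ?_) hD ih
      (((contDiffOn_formalDs hW hs L).contDiffAt hD).differentiableAt (by simp))
    rw [(hasFDerivAt_totalVec i u).fderiv]
    rfl

theorem isHor_formalDI (hW : IsOpen W) {η : Form N m k q} (hs : ContDiffOn ℝ ∞ η (jetDom W k))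
    (hη : ∀ u ∈ jetDom W k, IsHor (η u)) (I : Fin N → ℕ) {u : Jet N m l} (hu : u ∈ jetDom W l) :
    IsHor (formalDI l I η u) :=
  isHor_pull (isHor_formalDs hW hs hη _ _ (proj_mem_jetDom hu))

/-- The positive contact components of horizontal forms vanish. -/
theorem pc_eq_zero {η : Form N m k q} {u : Jet N m (k + 1)} (h : IsHor (η (proj (k + 1) k u)))
    {i : ℕ} (hi : i ≠ 0) : pc i η u = 0 := by
  ext v
  rw [pc, mixed_apply]
  refine Finset.sum_eq_zero fun S hS => ?_
  obtain ⟨a, ha⟩ : S.Nonempty := by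
    rw [Finset.nonempty_iff_ne_empty]
    rintro rfl
    simp at hS
    omega
  exact h _ ⟨a, by simp [ha, ver_fst]⟩

theorem isHor_dH (hW : IsOpen W) {η : Form N m k q} (hη : ∀ u ∈ jetDom W k, IsHor (η u))
    {u : Jet N m (k + 2)} (hu : u ∈ jetDom W (k + 2)) : IsHor (dH η u) := by
  rw [dH, Finset.sum_apply]
  refine IsHor.sum fun l _ => ?_
  rcases eq_or_ne l 0 with rfl | hl
  · exact isHor_pc_zero _ _
  -- For $l>0$ the component $p_l\eta$ vanishes on a whole neighbourhood, so its exterior derivative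
  -- vanishes too and only $p_0dp_0\eta$ remains.
  · have h1 : pc l η =ᶠ[nhds (proj (k + 2) (k + 1) u)] 0 := by
      filter_upwards [(isOpen_jetDom hW (k + 1)).mem_nhds (proj_mem_jetDom hu)] with y hy
      exact pc_eq_zero (hη _ (proj_mem_jetDom hy)) hl
    have h2 : extDeriv (pc l η) (proj (k + 2) (k + 1) u) = 0 := by
      rw [h1.extDeriv_eq, extDeriv, Pi.zero_def, fderiv_const_apply]
      exact map_zero (ContinuousAlternatingMap.alternatizeUncurryFinCLM ℝ _ _)
    rw [pc_eq_zero (h2 ▸ fun _ _ => rfl) hl]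
    exact fun _ _ => rfl

end Degree

/-! ### Pull-backs along prolonged sections -/

section SectionPullback

variable {N m k l q : ℕ} {W : Set (Loc N m)} {U : Set (Fin N → ℝ)}
  {s V : (Fin N → ℝ) → Fin m → ℝ} {x : Fin N → ℝ}

theorem mapsTo_jetOf (hsW : ∀ x ∈ U, (x, s x) ∈ W) (k : ℕ) :
    Set.MapsTo (jetOf k s) U (jetDom W k) := by
  intro x hx
  change pt (jetOf k s x) ∈ W
  rw [pt_jetOf]
  exact hsW x hx

theorem pb_pull (hU : IsOpen U) (hs : ContDiffOn ℝ ∞ s U) (hx : x ∈ U) (h : k ≤ l)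
    (η : Form N m k q) : pb (jetOf l s) (pull l η) x = pb (jetOf k s) η x := by
  rw [pb, pb, fderiv_jetOf_eq hU hs h hx, pull, proj_jetOf h]
  rfl

theorem pbi_pull (hU : IsOpen U) (hs : ContDiffOn ℝ ∞ s U) (hx : x ∈ U) (h : k ≤ l)
    (η : Form N m k (q + 1)) :
    pbi (jetOf l s) (vjet l V) (pull l η) x = pbi (jetOf k s) (vjet k V) η x := by
  ext v
  rw [pbi_apply, pbi_apply, fderiv_jetOf_eq hU hs h hx, pull, proj_jetOf h]
  refine congrArg (η _) (funext fun a => ?_)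
  refine Fin.cases ?_ (fun b => ?_) a
  · simpa using proj_vjet h x
  · simp

theorem pb_contract (hU : IsOpen U) (hs : ContDiffOn ℝ ∞ s U) (hx : x ∈ U)
    (Z : Jet N m (k + 1) → Jet N m k) (η : Form N m k (q + 1)) :
    pb (jetOf (k + 1) s) (contract Z η) x =
      pbi (jetOf k s) (fun y => Z (jetOf (k + 1) s y)) η x := by
  rw [pb, pbi, contract, proj_jetOf (Nat.le_succ k), fderiv_jetOf_eq hU hs (Nat.le_succ k) hx]
  rfl

theorem hor_proj_fderiv_jetOf (hU : IsOpen U) (hs : ContDiffOn ℝ ∞ s U) (hx : x ∈ U)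
    (v : Fin N → ℝ) : hor (jetOf (k + 1) s x) (proj (k + 1) k (fderiv ℝ (jetOf (k + 1) s) x v)) =
      fderiv ℝ (jetOf k s) x v := by
  rw [hor_jetOf hU hs hx, proj_fst, fderiv_jetOf_fst hU hs hx]

theorem ver_proj_fderiv_jetOf (hU : IsOpen U) (hs : ContDiffOn ℝ ∞ s U) (hx : x ∈ U)
    (v : Fin N → ℝ) :
    ver (jetOf (k + 1) s x) (proj (k + 1) k (fderiv ℝ (jetOf (k + 1) s) x v)) = 0 := by
  change proj (k + 1) k (fderiv ℝ (jetOf (k + 1) s) x v) - hor _ _ = 0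
  rw [hor_proj_fderiv_jetOf hU hs hx, fderiv_jetOf_eq hU hs (Nat.le_succ k) hx]
  exact sub_self _

theorem pb_pc_zero (hU : IsOpen U) (hs : ContDiffOn ℝ ∞ s U) (hx : x ∈ U) (η : Form N m k q) :
    pb (jetOf (k + 1) s) (pc 0 η) x = pb (jetOf k s) η x := by
  ext v
  rw [pb_apply, pb_apply, pc, mixed_zero, proj_jetOf (Nat.le_succ k)]
  exact congrArg (η _) (funext fun a => hor_proj_fderiv_jetOf hU hs hx (v a))

/-- A vector tangent to a prolonged section has no vertical part, and a positive contact component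
evaluates the form on at least one vertical part. -/
theorem pb_pc_of_ne_zero (hU : IsOpen U) (hs : ContDiffOn ℝ ∞ s U) (hx : x ∈ U) (η : Form N m k q)
    {i : ℕ} (hi : i ≠ 0) : pb (jetOf (k + 1) s) (pc i η) x = 0 := by
  ext v
  rw [pb_apply, pc, mixed_apply]
  refine Finset.sum_eq_zero fun S hS => ?_
  obtain ⟨a, ha⟩ : S.Nonempty := by
    rw [Finset.nonempty_iff_ne_empty]
    rintro rfl
    simp at hS
    omega
  refine ContinuousAlternatingMap.map_coord_zero _ a ?_
  simpa [ha] using ver_proj_fderiv_jetOf hU hs hx (v a)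

/-- The variation has to occupy the vertical slot of $p_1$: any other choice evaluates the vertical
part of a tangent vector of the section, which is zero. -/
theorem pbi_pc_one (hU : IsOpen U) (hs : ContDiffOn ℝ ∞ s U) (hx : x ∈ U)
    (η : Form N m k (q + 1)) :
    pbi (jetOf (k + 1) s) (vjet (k + 1) V) (pc 1 η) x = pbi (jetOf k s) (vjet k V) η x := by
  ext v
  rw [pbi_apply, pbi_apply, pc, mixed_one_apply, proj_jetOf (Nat.le_succ k), Fin.sum_univ_succ,
    Finset.sum_eq_zero, add_zero]
  · refine congrArg (η _) (funext fun a => ?_)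
    refine Fin.cases ?_ (fun b => ?_) a
    · simpa [proj_vjet] using ver_of_vertical _ rfl
    · simpa using hor_proj_fderiv_jetOf hU hs hx (v b)
  · intro i _
    refine ContinuousAlternatingMap.map_coord_zero _ i.succ ?_
    simpa using ver_proj_fderiv_jetOf hU hs hx (v i)

/-- Along a prolonged section $d_i$ is the image of the coordinate field $\partial_i$, and a Lie
derivative along such a field is an ordinary derivative of the pull-back. -/
theorem pb_formalD (hU : IsOpen U) (hs : ContDiffOn ℝ ∞ s U) (hx : x ∈ U) {η : Form N m k q}
    (hη : DifferentiableAt ℝ η (jetOf k s x)) (i : Fin N) :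
    pb (jetOf (k + 1) s) (formalD i η) x = fderiv ℝ (pb (jetOf k s) η) x (Pi.single i 1) := by
  have hS : ∀ k, ContDiffAt ℝ ∞ (jetOf k s) x := fun k =>
    (contDiffOn_jetOf hU hs k).contDiffAt (hU.mem_nhds hx)
  have h1 : (fun y => proj (k + 1) k (jetOf (k + 1) s y)) = jetOf k s :=
    funext fun y => proj_jetOf (Nat.le_succ k) y
  have h2 : (fun y => totalVec i (jetOf (k + 1) s y)) =ᶠ[nhds x]
      fun y => fderiv ℝ (jetOf k s) y (Pi.single i 1) := by
    filter_upwards [hU.mem_nhds hx] with y hy using (fderiv_jetOf_single hU hs hy i).symm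
  rw [formalD, pb_lieAlong ((hS _).differentiableAt (by simp))
    (hasFDerivAt_totalVec i _).differentiableAt, ← pbL_fderiv hη (hS _), h1, pbL, pbL,
    h2.fderiv_eq]
  have h3 := h2.self_of_nhds
  simp only at h3
  rw [h3]

/-- The variation can be carried along because prolonged vertical variations commute with $d_i$:
differentiating `vjet` applies the linear part of `totalVec`. -/
theorem pbi_formalD (hU : IsOpen U) (hs : ContDiffOn ℝ ∞ s U) (hV : ContDiffOn ℝ ∞ V U)
    (hx : x ∈ U) {η : Form N m k (q + 1)}
    (hη : DifferentiableAt ℝ η (jetOf k s x)) (i : Fin N) :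
    pbi (jetOf (k + 1) s) (vjet (k + 1) V) (formalD i η) x =
      fderiv ℝ (pbi (jetOf k s) (vjet k V) η) x (Pi.single i 1) := by
  have h1 : (fun y => proj (k + 1) k (jetOf (k + 1) s y)) = jetOf k s :=
    funext fun y => proj_jetOf (Nat.le_succ k) y
  have h3 : (fun y => proj (k + 1) k (vjet (k + 1) V y)) = vjet k V :=
    funext fun y => proj_vjet (Nat.le_succ k) y
  rw [formalD, pbi_lieAlong (e := Pi.single i 1), h1, h3]
  · rwa [proj_jetOf (Nat.le_succ k)]
  · exact (contDiffOn_jetOf hU hs _).contDiffAt (hU.mem_nhds hx)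
  · exact ((contDiffOn_vjet hU hV _).contDiffAt (hU.mem_nhds hx)).differentiableAt (by simp)
  · exact (hasFDerivAt_totalVec i _).differentiableAt
  · rw [h1]
    filter_upwards [hU.mem_nhds hx] with y hy using (fderiv_jetOf_single hU hs hy i).symm
  · rw [h3, (hasFDerivAt_totalVec i _).fderiv, fderiv_vjet_single hU hV hx]

theorem differentiableAt_of_contDiffOn_jetDom (hW : IsOpen W) {η : Form N m k q}
    (hη : ContDiffOn ℝ ∞ η (jetDom W k)) {u : Jet N m k} (hu : u ∈ jetDom W k) :
    DifferentiableAt ℝ η u :=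
  (hη.contDiffAt ((isOpen_jetDom hW k).mem_nhds hu)).differentiableAt (by simp)

theorem pb_formalDI (hU : IsOpen U) (hs : ContDiffOn ℝ ∞ s U) (hW : IsOpen W)
    (hsW : ∀ x ∈ U, (x, s x) ∈ W) {η : Form N m k q} (hη : ContDiffOn ℝ ∞ η (jetDom W k))
    {I : Fin N → ℕ} (h : k + ∑ i, I i ≤ l) :
    Set.EqOn (pb (jetOf l s) (formalDI l I η)) (partials (letters I) (pb (jetOf k s) η)) U := by
  have key : ∀ L : List (Fin N), Set.EqOn (pb (jetOf (k + L.length) s) (formalDs L η))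
      (partials L (pb (jetOf k s) η)) U := by
    intro L
    induction L with
    | nil => exact fun _ _ => rfl
    | cons i L ih =>
      intro x hx
      refine (pb_formalD hU hs hx (differentiableAt_of_contDiffOn_jetDom hW
        (contDiffOn_formalDs hW hη L) (mapsTo_jetOf hsW _ hx)) i).trans ?_
      rw [(ih.eventuallyEq_of_mem (hU.mem_nhds hx)).fderiv_eq]
      rfl
  intro x hx
  rw [formalDI, pb_pull hU hs hx (by rwa [length_letters]), key _ hx]

theorem pbi_formalDI (hU : IsOpen U) (hs : ContDiffOn ℝ ∞ s U) (hV : ContDiffOn ℝ ∞ V U)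
    (hW : IsOpen W) (hsW : ∀ x ∈ U, (x, s x) ∈ W) {η : Form N m k (q + 1)}
    (hη : ContDiffOn ℝ ∞ η (jetDom W k)) {I : Fin N → ℕ} (h : k + ∑ i, I i ≤ l) :
    Set.EqOn (pbi (jetOf l s) (vjet l V) (formalDI l I η))
      (partials (letters I) (pbi (jetOf k s) (vjet k V) η)) U := by
  have key : ∀ L : List (Fin N),
      Set.EqOn (pbi (jetOf (k + L.length) s) (vjet (k + L.length) V) (formalDs L η))
      (partials L (pbi (jetOf k s) (vjet k V) η)) U := by
    intro L
    induction L with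
    | nil => exact fun _ _ => rfl
    | cons i L ih =>
      intro x hx
      refine (pbi_formalD hU hs hV hx (differentiableAt_of_contDiffOn_jetDom hW
        (contDiffOn_formalDs hW hη L) (mapsTo_jetOf hsW _ hx)) i).trans ?_
      rw [(ih.eventuallyEq_of_mem (hU.mem_nhds hx)).fderiv_eq]
      rfl
  intro x hx
  rw [formalDI, pbi_pull hU hs hx (by rwa [length_letters]), key _ hx]

theorem contactForm_fderiv_jetOf (hU : IsOpen U) (hs : ContDiffOn ℝ ∞ s U) (hx : x ∈ U)
    (σ : Fin m) (v : Fin N → ℝ) :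
    contactForm σ (jetOf (k + 1) s x) (fderiv ℝ (jetOf (k + 1) s) x v) = 0 := by
  rw [contactForm_apply, fderiv_jetOf_fst hU hs hx, fderiv_jetOf_apply hU hs hx, ← coordL_apply,
    map_sum, Finset.sum_apply, sub_eq_zero]
  refine Finset.sum_congr rfl fun i _ => ?_
  have h1 : ∑ j, (Pi.single i 1 : Fin N → ℕ) j ≤ k + 1 := by simp
  have h2 : app (0 : Fin N → ℕ) i = Pi.single i 1 := zero_add _
  rw [map_smul, coordL_apply, coord_totalVec _ _ (by simp), h2, coord_jetOf h1,
    coord_jetOf (h1.trans (Nat.le_succ _)), Pi.smul_apply, smul_eq_mul, mul_comm]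

theorem pbi_wedge_contactForm (hU : IsOpen U) (hs : ContDiffOn ℝ ∞ s U) (hx : x ∈ U)
    (σ : Fin m) (η : Form N m (k + 1) q) :
    pbi (jetOf (k + 1) s) (vjet (k + 1) V) (wedge (contactForm σ) η) x =
      V x σ • pb (jetOf (k + 1) s) η x := by
  ext v
  rw [pbi_apply, wedge_apply, Fin.sum_univ_succ, Finset.sum_eq_zero, add_zero]
  · have h1 : contactForm σ (jetOf (k + 1) s x) (vjet (k + 1) V x) = V x σ := by
      rw [contactForm_apply, coord_vjet (by simp), letters_zero]
      simp [vjet, partials]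
    simp only [Matrix.cons_val_zero, h1]
    simp [pb_apply, Fin.removeNth_zero]
  · intro i _
    simp [contactForm_fderiv_jetOf hU hs hx]

/-- `p_1 d` of a contact form of degree one, contracted with a vertical variation. -/
theorem pbi_extDeriv_pc_one (hU : IsOpen U) (hs : ContDiffOn ℝ ∞ s U) (hV : ContDiffOn ℝ ∞ V U)
    (hW : IsOpen W) (hsW : ∀ x ∈ U, (x, s x) ∈ W) (hx : x ∈ U) {η : Form N m k (q + 1)}
    (hη : ContDiffOn ℝ ∞ η (jetDom W k)) :
    pbi (jetOf (k + 2) s) (vjet (k + 2) V) (pc 1 (extDeriv (pc 1 η))) x =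
      - extDeriv (pbi (jetOf k s) (vjet k V) η) x := by
  have hd : DifferentiableAt ℝ (pc 1 η) (jetOf (k + 1) s x) :=
    differentiableAt_of_contDiffOn_jetDom hW (contDiffOn_pc hη 1) (mapsTo_jetOf hsW _ hx)
  -- A contact form pulls back to zero along each section $s+tV$, so its variation at $t=0$
  -- vanishes; Cartan's formula then exchanges contraction and $d$ up to sign.
  have h1 : pbL (jetOf (k + 1) s) (vjet (k + 1) V) (pc 1 η) x = 0 := by
    refine pbL_eq_zero hd (Filter.Eventually.of_forall fun t => ?_)
    have hst : ContDiffOn ℝ ∞ (s + t • V) U := hs.add (hV.const_smul t)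
    have h2 : Set.EqOn (jetOf (k + 1) (s + t • V))
      (fun y => jetOf (k + 1) s y + t • vjet (k + 1) V y) U :=
      fun y hy => jetOf_add_smul hU hs hV hy t
    have h3 := (h2.eventuallyEq_of_mem (hU.mem_nhds hx)).fderiv_eq (𝕜 := ℝ)
    have h4 := ((contDiffOn_jetOf hU hs (k + 1)).contDiffAt (hU.mem_nhds hx)).differentiableAt
      (by simp)
    have h5 := ((contDiffOn_vjet hU hV (k + 1)).contDiffAt (hU.mem_nhds hx)).differentiableAt
      (by simp)
    have h6 := pb_pc_of_ne_zero hU hst hx η one_ne_zero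
    rw [pb, h3, h2 hx] at h6
    rw [← h6]
    congr 1
    exact (h4.hasFDerivAt.add (h5.hasFDerivAt.const_smul t)).fderiv.symm
  have h2 := pbL_eq hd ((contDiffOn_jetOf hU hs (k + 1)).contDiffAt (hU.mem_nhds hx))
    (((contDiffOn_vjet hU hV (k + 1)).contDiffAt (hU.mem_nhds hx)).differentiableAt (by simp))
  have h3 : Set.EqOn (pbi (jetOf (k + 1) s) (vjet (k + 1) V) (pc 1 η))
      (pbi (jetOf k s) (vjet k V) η) U := fun y hy => pbi_pc_one hU hs hy η
  rw [pbi_pc_one hU hs hx, ← (h3.eventuallyEq_of_mem (hU.mem_nhds hx)).extDeriv_eq,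
    eq_neg_iff_add_eq_zero, ← h2, h1]

/-- Positive contact components vanish along a section and $p_0$ is invisible there, so only the
summand $l=0$ survives and it pulls back to $d$. -/
theorem pb_dH (hU : IsOpen U) (hs : ContDiffOn ℝ ∞ s U) (hW : IsOpen W)
    (hsW : ∀ x ∈ U, (x, s x) ∈ W) (hx : x ∈ U) {η : Form N m k q}
    (hη : ContDiffOn ℝ ∞ η (jetDom W k)) :
    pb (jetOf (k + 2) s) (dH η) x = extDeriv (pb (jetOf k s) η) x := by
  have h0 : pb (jetOf (k + 2) s) (dH η) x = ∑ l ∈ Finset.range (q + 1),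
      pb (jetOf (k + 2) s) (pc l (extDeriv (pc l η))) x := by
    ext v
    simp [pb_apply, dH]
  rw [h0, Finset.sum_eq_single 0]
  · have h3 : Set.EqOn (pb (jetOf (k + 1) s) (pc 0 η)) (pb (jetOf k s) η) U :=
      fun y hy => pb_pc_zero hU hs hy η
    rw [pb_pc_zero hU hs hx, ← extDeriv_pb (differentiableAt_of_contDiffOn_jetDom hW
      (contDiffOn_pc hη 0) (mapsTo_jetOf hsW _ hx))
      ((contDiffOn_jetOf hU hs (k + 1)).contDiffAt (hU.mem_nhds hx)),
      (h3.eventuallyEq_of_mem (hU.mem_nhds hx)).extDeriv_eq]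
  · intro l _ hl
    exact pb_pc_of_ne_zero hU hs hx _ hl
  · simp

end SectionPullback

/-! ### Multi-index sums and integration by parts -/

section MultiIndex

variable {N k : ℕ} {G : Type*} [AddCommGroup G] [Module ℝ G]

/-- The finite set of multi-indices of length at most `k`. -/
def midxFinset (N k : ℕ) : Finset (Fin N → ℕ) :=
  (Finset.univ : Finset (MIdx N k)).map (Function.Embedding.subtype _)

@[simp]
theorem mem_midxFinset {I : Fin N → ℕ} : I ∈ midxFinset N k ↔ ∑ i, I i ≤ k := by
  simp [midxFinset]

theorem sum_midx {G : Type*} [AddCommMonoid G] (g : (Fin N → ℕ) → G) :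
    ∑ I : MIdx N k, g I.1 = ∑ I ∈ midxFinset N k, g I := by
  rw [midxFinset, Finset.sum_map]
  rfl

theorem midx_induction {p : (Fin N → ℕ) → Prop} (h0 : p 0) (h : ∀ I i, p I → p (app I i))
    (I : Fin N → ℕ) : p I := by
  generalize hk : ∑ i, I i = d
  induction d generalizing I with
  | zero =>
    have : I = 0 := by
      funext i
      simpa using Finset.sum_eq_zero_iff.1 hk i (Finset.mem_univ i)
    rwa [this]
  | succ d ih =>
    obtain ⟨i, hi⟩ : ∃ i, 0 < I i := by
      by_contra hc
      push Not at hc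
      have : ∑ i, I i = 0 := Finset.sum_eq_zero fun i _ => Nat.le_zero.1 (hc i)
      omega
    have hI : I = app (I - Pi.single i 1) i := by
      funext a
      rcases eq_or_ne a i with rfl | ha
      · simp [app]; omega
      · simp [app, ha]
    rw [hI]
    refine h _ _ (ih _ ?_)
    rw [hI, sum_app] at hk
    omega

theorem app_injective (j : Fin N) : Function.Injective fun I : Fin N → ℕ => app I j :=
  fun _ _ h => add_right_cancel h

/-- Regrouping a sum over multi-indices by the orderings of their letters. -/
theorem sum_midx_eq_zero_add (g : (Fin N → ℕ) → G) (hg : ∀ I, k < ∑ i, I i → g I = 0) :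
    ∑ I : MIdx N k, g I.1 = g 0 + ∑ I : MIdx N k, ∑ j,
      (((I.1 j + 1 : ℕ) : ℝ) / ((∑ i, I.1 i + 1 : ℕ) : ℝ)) • g (app I.1 j) := by
  -- The shift $I\mapsto Ij$ turns the weight into $I_j/|I|$; summed over $j$, these weights give 1
  -- for each $I\ne0$.
  have h1 : ∀ j, ∑ I ∈ midxFinset N k,
      (((I j + 1 : ℕ) : ℝ) / ((∑ i, I i + 1 : ℕ) : ℝ)) • g (app I j) =
      ∑ I ∈ midxFinset N k, ((I j : ℝ) / ((∑ i, I i : ℕ) : ℝ)) • g I := by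
    intro j
    have h2 : midxFinset N k ⊆ midxFinset N (k + 1) := by
      intro I hI
      rw [mem_midxFinset] at hI ⊢
      omega
    -- The shift raises the length by one, so the target is enlarged to length $k+1$, where `hg`
    -- makes the new terms zero.
    rw [Finset.sum_subset h2 (f := fun I => ((I j : ℝ) / ((∑ i, I i : ℕ) : ℝ)) • g I)]
    · refine Finset.sum_of_injOn (fun I => app I j) (app_injective j).injOn ?_ ?_ ?_
      · intro I hI
        simp only [Finset.mem_coe, mem_midxFinset, sum_app] at hI ⊢
        omega
      · intro I hI hI'
        have : I j = 0 := by
          by_contra hc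
          refine hI' ⟨I - Pi.single j 1, ?_, ?_⟩
          · have hI2 : I = app (I - Pi.single j 1) j := by
              funext a
              rcases eq_or_ne a j with rfl | ha
              · simp [app]; omega
              · simp [app, ha]
            rw [hI2, mem_midxFinset, sum_app] at hI
            simpa using hI
          · funext a
            rcases eq_or_ne a j with rfl | ha
            · simp [app]; omega
            · simp [app, ha]
        simp [this]
      · intro I _
        rw [sum_app]
        simp [app]
    · intro I _ hI
      rw [mem_midxFinset, not_le] at hI
      rw [hg I hI, smul_zero]
  have h3 : ∑ I : MIdx N k, ∑ j,
      (((I.1 j + 1 : ℕ) : ℝ) / ((∑ i, I.1 i + 1 : ℕ) : ℝ)) • g (app I.1 j) =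
      ∑ I ∈ midxFinset N k, ∑ j, ((I j : ℝ) / ((∑ i, I i : ℕ) : ℝ)) • g I := by
    rw [Finset.sum_comm, Finset.sum_comm (s := midxFinset N k)]
    refine Finset.sum_congr rfl fun j _ => ?_
    rw [← h1 j]
    exact sum_midx fun I => (((I j + 1 : ℕ) : ℝ) / ((∑ i, I i + 1 : ℕ) : ℝ)) • g (app I j)
  have h0 : (0 : Fin N → ℕ) ∈ midxFinset N k := by simp
  rw [h3, sum_midx g, ← Finset.add_sum_erase _ _ h0, ← Finset.add_sum_erase _ _ h0]
  -- At $I=0$ the weight is $0/0=0$, so this index drops out of the weighted sum and leaves `g 0` to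
  -- be counted separately.
  simp only [Pi.zero_apply, Nat.cast_zero, zero_div, zero_smul, Finset.sum_const_zero, zero_add]
  congr 1
  refine Finset.sum_congr rfl fun I hI => ?_
  rw [← Finset.sum_smul, ← Finset.sum_div, ← Nat.cast_sum, div_self, one_smul]
  rw [Nat.cast_ne_zero]
  intro hc
  refine Finset.ne_of_mem_erase hI (funext fun i => ?_)
  simpa using Finset.sum_eq_zero_iff.1 hc i (Finset.mem_univ i)

/-- The signed multi-index binomial coefficient `(-1)^|J| (L choose J)`. -/
def signedChoose (L J : Fin N → ℕ) : ℝ :=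
  (-1) ^ (∑ i, J i) * ∏ i, ((L i).choose (J i) : ℝ)

theorem signedChoose_eq_zero {L J : Fin N → ℕ} (h : ¬ J ≤ L) : signedChoose L J = 0 := by
  simp only [Pi.le_def, not_forall, not_le] at h
  obtain ⟨i, hi⟩ := h
  rw [signedChoose, Finset.prod_eq_zero (Finset.mem_univ i), mul_zero]
  rw [Nat.choose_eq_zero_of_lt hi, Nat.cast_zero]

theorem signedChoose_app_app (L J : Fin N → ℕ) (i : Fin N) :
    signedChoose (app L i) (app J i) = signedChoose L (app J i) - signedChoose L J := by
  simp only [signedChoose, sum_app]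
  rw [← Finset.mul_prod_erase _ _ (Finset.mem_univ i),
    ← Finset.mul_prod_erase _ (fun j => ((L j).choose (app J i j) : ℝ)) (Finset.mem_univ i),
    ← Finset.mul_prod_erase _ (fun j => ((L j).choose (J j) : ℝ)) (Finset.mem_univ i)]
  have h1 : ∏ j ∈ Finset.univ.erase i, ((app L i j).choose (app J i j) : ℝ) =
      ∏ j ∈ Finset.univ.erase i, ((L j).choose (J j) : ℝ) :=
    Finset.prod_congr rfl fun j hj => by simp [app, Finset.ne_of_mem_erase hj]
  have h2 : ∏ j ∈ Finset.univ.erase i, ((L j).choose (app J i j) : ℝ) =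
      ∏ j ∈ Finset.univ.erase i, ((L j).choose (J j) : ℝ) :=
    Finset.prod_congr rfl fun j hj => by simp [app, Finset.ne_of_mem_erase hj]
  rw [h1, h2]
  have h3 : ((app L i i).choose (app J i i) : ℝ) =
      (L i).choose (J i) + (L i).choose (app J i i) := by
    simp [app, Nat.choose_succ_succ]
  rw [h3]
  ring

theorem signedChoose_app_of_eq_zero (L J : Fin N → ℕ) (i : Fin N) (h : J i = 0) :
    signedChoose (app L i) J = signedChoose L J := by
  simp only [signedChoose]
  congr 1
  refine Finset.prod_congr rfl fun j _ => ?_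
  rcases eq_or_ne j i with rfl | hj
  · simp [h]
  · simp [app, hj]

/-- Pascal's rule for sums with signed binomial coefficients. -/
theorem sum_signedChoose_app (L : Fin N → ℕ) (i : Fin N) (g : (Fin N → ℕ) → G) :
    ∑ J ∈ Finset.Iic (app L i), signedChoose (app L i) J • g J =
      ∑ J ∈ Finset.Iic L, signedChoose L J • g J -
        ∑ J ∈ Finset.Iic L, signedChoose L J • g (app J i) := by
  have hle : L ≤ app L i := le_self_add
  have h1 : ∑ J ∈ Finset.Iic L, signedChoose L J • g J =
      ∑ J ∈ Finset.Iic (app L i), signedChoose L J • g J := by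
    refine Finset.sum_subset (Finset.Iic_subset_Iic.2 hle) fun J _ hJ => ?_
    rw [signedChoose_eq_zero (by simpa using hJ), zero_smul]
  have h2 : ∑ J ∈ Finset.Iic L, signedChoose L J • g (app J i) =
      ∑ J ∈ Finset.Iic (app L i), (signedChoose L J - signedChoose (app L i) J) • g J := by
    refine Finset.sum_of_injOn (fun J => app J i) (app_injective i).injOn ?_ ?_ ?_
    · intro J hJ
      simp only [Finset.coe_Iic, Set.mem_Iic] at hJ ⊢
      exact add_le_add_left hJ _
    -- Indices not of the form $Ji$ have zero multiplicity of $i$, where both binomial coefficients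
    -- agree.
    · intro J hJ hJ'
      have : J i = 0 := by
        by_contra hc
        refine hJ' ⟨J - Pi.single i 1, ?_, ?_⟩
        · rw [Finset.mem_coe, Finset.mem_Iic] at *
          intro a
          have := hJ a
          rcases eq_or_ne a i with rfl | ha
          · simp [app] at this ⊢; omega
          · simpa [app, ha] using this
        · funext a
          rcases eq_or_ne a i with rfl | ha
          · simp [app]; omega
          · simp [app, ha]
      rw [signedChoose_app_of_eq_zero _ _ _ this, sub_self, zero_smul]
    · intro J _
      rw [signedChoose_app_app]
      congr 1
      ring
  rw [h1, h2, ← Finset.sum_sub_distrib]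
  refine Finset.sum_congr rfl fun J _ => ?_
  rw [← sub_smul, sub_sub_cancel]

end MultiIndex

/-! ### Integration by parts with multi-indices. -/

section IntegrationByParts

variable {N k : ℕ} {G : Type*} [NormedAddCommGroup G] [NormedSpace ℝ G]
  {U : Set (Fin N → ℝ)} {v : (Fin N → ℝ) → ℝ} {x : Fin N → ℝ}

/-- This is the inverse Leibniz rule. Appending a letter uses
$(\partial_{Li}v)a=\partial_i((\partial_Lv)a)-(\partial_Lv)\partial_ia$, and Pascal's rule merges
the two sums. The second one needs the induction hypothesis for $\partial_ia$, hence the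
quantification over `a`. -/
theorem sum_signedChoose_partials (hU : IsOpen U) (hv : ContDiffOn ℝ ∞ v U) (L : Fin N → ℕ) :
    ∀ a : (Fin N → ℝ) → G, ContDiffOn ℝ ∞ a U → ∀ x ∈ U,
      ∑ J ∈ Finset.Iic L, signedChoose L J •
        partials (letters (L - J)) (v • partials (letters J) a) x =
      partials (letters L) v x • a x := by
  induction L using midx_induction with
  | h0 =>
    intro a _ x _
    have h0 : Finset.Iic (0 : Fin N → ℕ) = {0} := by ext J; simp
    rw [h0, Finset.sum_singleton]
    simp [signedChoose, partials]
  | h L i ih =>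
    intro a ha x hx
    have hsm : ∀ (M K : List (Fin N)) (b : (Fin N → ℝ) → G), ContDiffOn ℝ ∞ b U →
        ContDiffOn ℝ ∞ (partials M (v • partials K b)) U := fun M K b hb =>
      contDiffOn_partials hU (hv.smul (contDiffOn_partials hU hb K)) M
    have ha' : ContDiffOn ℝ ∞ (partials [i] a) U := contDiffOn_partials hU ha [i]
    rw [sum_signedChoose_app L i fun J =>
      partials (letters (app L i - J)) (v • partials (letters J) a) x]
    have h1 : ∑ J ∈ Finset.Iic L, signedChoose L J •
        partials (letters (app L i - app J i)) (v • partials (letters (app J i)) a) x =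
        partials (letters L) v x • partials [i] a x := by
      rw [← ih _ ha' x hx]
      refine Finset.sum_congr rfl fun J _ => ?_
      have h2 : app L i - app J i = L - J := add_tsub_add_eq_tsub_right _ _ _
      rw [h2]
      congr 1
      refine partials_congr hU (fun y hy => ?_) _ hx
      change v y • partials (letters (app J i)) a y = v y • partials (letters J) (partials [i] a) y
      rw [← partials_append, partials_perm hU ha _ hy]
      exact (letters_app J i).trans (List.perm_append_singleton i (letters J)).symm
    have h3 : ∑ J ∈ Finset.Iic L, signedChoose L J •
        partials (letters (app L i - J)) (v • partials (letters J) a) x =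
        fderiv ℝ (fun y => ∑ J ∈ Finset.Iic L, signedChoose L J •
          partials (letters (L - J)) (v • partials (letters J) a) y) x (Pi.single i 1) := by
      have hd : ∀ J, DifferentiableAt ℝ
          (partials (letters (L - J)) (v • partials (letters J) a)) x := fun J =>
        ((hsm _ _ a ha).contDiffAt (hU.mem_nhds hx)).differentiableAt (by simp)
      have hD : HasFDerivAt (fun y => ∑ J ∈ Finset.Iic L, signedChoose L J •
          partials (letters (L - J)) (v • partials (letters J) a) y) _ x :=
        HasFDerivAt.fun_sum fun J _ => (hd J).hasFDerivAt.const_smul (signedChoose L J)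
      rw [hD.fderiv, sum_apply]
      refine Finset.sum_congr rfl fun J hJ => ?_
      rw [Finset.mem_Iic] at hJ
      have h4 : app L i - J = app (L - J) i := by
        funext b
        have : J b ≤ L b := hJ b
        simp only [app, Pi.sub_apply, Pi.add_apply]
        omega
      rw [h4, partials_app hU (hv.smul (contDiffOn_partials hU ha _)) _ _ hx]
      rfl
    have hLv : ContDiffAt ℝ ∞ (partials (letters L) v) x :=
      (contDiffOn_partials hU hv _).contDiffAt (hU.mem_nhds hx)
    have hax := ha.contDiffAt (hU.mem_nhds hx)
    have h5 : Set.EqOn (fun y => ∑ J ∈ Finset.Iic L, signedChoose L J •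
          partials (letters (L - J)) (v • partials (letters J) a) y)
          (fun y => partials (letters L) v y • a y) U := fun y hy => ih a ha y hy
    have h6 : HasFDerivAt (fun y => partials (letters L) v y • a y) _ x :=
      (hLv.differentiableAt (by simp)).hasFDerivAt.smul (hax.differentiableAt (by simp)).hasFDerivAt
    rw [h1, h3, (h5.eventuallyEq_of_mem (hU.mem_nhds hx)).fderiv_eq, h6.fderiv,
      partials_app hU hv _ _ hx]
    simp [partials]

/-- `∑_L (∂_L v) a_L = ∑_I ∂_I (v ζ^I)` with `ζ^I = ∑_J (-1)^{|J|} (I+J choose J) ∂_J a_{I+J}`. -/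
theorem sum_partials_smul_eq (hU : IsOpen U) (hv : ContDiffOn ℝ ∞ v U)
    {a : (Fin N → ℕ) → (Fin N → ℝ) → G} (ha : ∀ I, ContDiffOn ℝ ∞ (a I) U)
    (h0 : ∀ I, k < ∑ i, I i → Set.EqOn (a I) 0 U) (hx : x ∈ U) :
    ∑ L : MIdx N k, partials (letters L.1) v x • a L.1 x =
      ∑ I : MIdx N k, partials (letters I.1) (v • ∑ J : MIdx N k,
        signedChoose (I.1 + J.1) J.1 • partials (letters J.1) (a (I.1 + J.1))) x := by
  have hsm : ∀ (K : List (Fin N)) (I : Fin N → ℕ), ContDiffOn ℝ ∞ (partials K (a I)) U :=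
    fun K I => contDiffOn_partials hU (ha I) K
  have h1 : ∀ I : MIdx N k, partials (letters I.1) (v • ∑ J : MIdx N k,
      signedChoose (I.1 + J.1) J.1 • partials (letters J.1) (a (I.1 + J.1))) x =
      ∑ J : MIdx N k, signedChoose (I.1 + J.1) J.1 •
        partials (letters I.1) (v • partials (letters J.1) (a (I.1 + J.1))) x := by
    intro I
    have h2 : (v • ∑ J : MIdx N k,
      signedChoose (I.1 + J.1) J.1 • partials (letters J.1) (a (I.1 + J.1))) =
      ∑ J : MIdx N k, signedChoose (I.1 + J.1) J.1 •
        (v • partials (letters J.1) (a (I.1 + J.1))) := by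
      rw [Finset.smul_sum]
      exact Finset.sum_congr rfl fun J _ => smul_comm _ _ _
    rw [h2, partials_sum _ (fun J : MIdx N k => signedChoose (I.1 + J.1) J.1 •
        (v • partials (letters J.1) (a (I.1 + J.1)))) hU
        (fun J _ => (hv.smul (hsm _ _)).const_smul (signedChoose (I.1 + J.1) J.1)) _ hx,
      Finset.sum_apply]
    exact Finset.sum_congr rfl fun J _ => partials_const_smul _ hU (hv.smul (hsm _ _)) _ hx
  simp_rw [h1]
  have h3 : ∀ L : MIdx N k, partials (letters L.1) v x • a L.1 x =
      ∑ J ∈ Finset.Iic L.1, signedChoose L.1 J •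
        partials (letters (L.1 - J)) (v • partials (letters J) (a L.1)) x := fun L =>
    (sum_signedChoose_partials hU hv L.1 _ (ha _) x hx).symm
  simp_rw [h3]
  rw [Finset.sum_sigma', ← Finset.sum_product']
  symm
  -- The pair $(I,J)$ is matched with $L=I+J$ and $J$. Pairs with $|I+J|>k$ have no partner but
  -- contribute zero by `h0`, so the bijection is asked only on nonzero terms.
  refine Finset.sum_bij_ne_zero (fun p _ h => ⟨⟨p.1.1 + p.2.1, ?_⟩, p.2.1⟩) ?_ ?_ ?_ ?_
  · by_contra hc
    refine h ?_
    have h4 : Set.EqOn (v • partials (letters p.2.1) (a (p.1.1 + p.2.1))) 0 U := by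
      intro y hy
      change v y • partials (letters p.2.1) (a (p.1.1 + p.2.1)) y = 0
      rw [partials_congr hU (h0 _ (not_le.1 hc)) _ hy, partials_zero]
      simp
    rw [partials_congr hU h4 _ hx, partials_zero]
    simp
  · intro p _ _
    simp
  · intro p _ _ p' _ _ h
    simp only [Sigma.mk.injEq, Subtype.mk.injEq, heq_eq_eq] at h
    obtain ⟨h5, h6⟩ := h
    rw [h6] at h5
    exact Prod.ext (Subtype.ext (add_right_cancel h5)) (Subtype.ext h6)
  · rintro ⟨L, J⟩ hJ hne
    simp only [Finset.mem_sigma, Finset.mem_univ, Finset.mem_Iic, true_and] at hJ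
    have hL : L.1 - J + J = L.1 := tsub_add_cancel_of_le hJ
    have hJk : ∑ i, J i ≤ k := (Finset.sum_le_sum fun i _ => hJ i).trans L.2
    have hLJ : ∑ i, (L.1 - J) i ≤ k :=
      (Finset.sum_le_sum fun i _ => Nat.sub_le (L.1 i) (J i)).trans L.2
    refine ⟨(⟨L.1 - J, hLJ⟩, ⟨J, hJk⟩), by simp, ?_, ?_⟩
    · simpa [hL] using hne
    · simp [hL]
  · intro p _ _
    simp

end IntegrationByParts

/-! ### The coordinate residual operator -/

section TopForms

variable {n : ℕ} {U : Set (Fin (n + 1) → ℝ)}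

/-- Contraction of forms on `ℝ^(n+1)` with the `j`-th coordinate field. -/
def contractBase (j : Fin (n + 1)) : ((Fin (n + 1) → ℝ) [⋀^Fin (n + 1)]→L[ℝ] ℝ) →L[ℝ]
    ((Fin (n + 1) → ℝ) [⋀^Fin n]→L[ℝ] ℝ) :=
  (ContinuousAlternatingMap.curryLeftLI (𝕜 := ℝ)).toContinuousLinearMap.flip (Pi.single j 1)

theorem contractBase_apply (j : Fin (n + 1)) (f : (Fin (n + 1) → ℝ) [⋀^Fin (n + 1)]→L[ℝ] ℝ) :
    contractBase j f = f.curryLeft (Pi.single j 1) := rfl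

/-- Cartan's formula for a constant field: the contraction of $df$ is absent because $df$ has degree
above the dimension. It exhibits a partial derivative of a top form as exact. -/
theorem extDeriv_contractBase {f : (Fin (n + 1) → ℝ) → (Fin (n + 1) → ℝ) [⋀^Fin (n + 1)]→L[ℝ] ℝ}
    {x : Fin (n + 1) → ℝ} (hf : DifferentiableAt ℝ f x) (j : Fin (n + 1)) :
    extDeriv (fun y => contractBase j (f y)) x = fderiv ℝ f x (Pi.single j 1) := by
  have h := pbL_eq (S := id) (ζ := fun _ => (Pi.single j 1 : Fin (n + 1) → ℝ)) (x := x) hf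
    contDiffAt_id (differentiableAt_const _)
  have h1 : pbi id (fun _ => (Pi.single j 1 : Fin (n + 1) → ℝ)) f =
      fun y => contractBase j (f y) := by
    funext y
    ext v
    simp [pbi_apply, contractBase_apply]
  have h2 : pbi id (fun _ => (Pi.single j 1 : Fin (n + 1) → ℝ)) (extDeriv f) x = 0 := by
    rw [pbi, alternating_eq_zero_of_finrank_lt (by simp) (extDeriv f (id x))]
    ext v
    simp
  rw [h1, h2, zero_add] at h
  rw [← h]
  ext v
  simp [pbL]

end TopForms

/-! ### The forms $\zeta^I_\sigma$ and the Euler operator along sections. -/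

section Residual

variable {N m k l q : ℕ} {W : Set (Loc N m)} {U : Set (Fin N → ℝ)}
  {s V : (Fin N → ℝ) → Fin m → ℝ} {x : Fin N → ℝ}

/-- Although $p_1\alpha$ lives on jets of order $k+1$, it sees tangent vectors only through their
projection to order $k$. Hence $\Psi^I_\sigma=0$ for $|I|>k$. -/
theorem pc_one_of_proj_eq_zero (α : Form N m k (q + 1)) (u : Jet N m (k + 1)) {w : Jet N m (k + 1)}
    (hw : proj (k + 1) k w = 0) : (pc 1 α u).curryLeft w = 0 := by
  ext v
  change pc 1 α u (Matrix.vecCons w v) = 0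
  rw [pc, mixed_one_apply]
  refine Finset.sum_eq_zero fun i _ => ContinuousAlternatingMap.map_coord_zero _ 0 ?_
  refine Fin.cases ?_ (fun b => ?_) i
  · simp [hw]
  · simp [(Fin.succ_ne_zero b).symm, hw]

theorem proj_dy_eq_zero (σ : Fin m) {I : Fin N → ℕ} (h : k < ∑ i, I i) :
    proj (k + 1) k (dy σ I : Jet N m (k + 1)) = 0 := by
  refine jet_ext rfl fun J hJ => ?_
  rw [coord_proj _ hJ, coord_of_le (hJ.trans (Nat.le_succ k)), coord_of_le hJ]
  have : J ≠ I := by rintro rfl; omega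
  simp [dy, this]

theorem contractConst_dy_eq_zero (α : Form N m k (q + 1)) (σ : Fin m) {I : Fin N → ℕ}
    (h : k < ∑ i, I i) : contractConst (dy σ I) (pc 1 α) = 0 :=
  funext fun u => pc_one_of_proj_eq_zero α u (proj_dy_eq_zero σ h)

theorem isHor_contractConst_dy (α : Form N m k (q + 1)) (σ : Fin m) (I : Fin N → ℕ)
    (u : Jet N m (k + 1)) : IsHor (contractConst (dy σ I) (pc 1 α) u) :=
  isHor_curryLeft (isContactOne_pc_one α u) rfl

theorem contDiffOn_contractConst_dy {α : Form N m k (q + 1)} (hα : ContDiffOn ℝ ∞ α (jetDom W k))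
    (σ : Fin m) (I : Fin N → ℕ) :
    ContDiffOn ℝ ∞ (contractConst (dy σ I) (pc 1 α)) (jetDom W (k + 1)) :=
  contDiffOn_contractConst (contDiffOn_pc hα 1) _

theorem zeta_eq (α : Form N m k (N + 1)) (σ : Fin m) (I : Fin N → ℕ) :
    zeta α σ I = ∑ J : MIdx N k, signedChoose (I + J.1) J.1 •
      formalDI (2 * k + 1) J.1 (contractConst (dy σ (I + J.1)) (pc 1 α)) := rfl

/-- For $I=0$ the binomial coefficients are 1, so the Euler operator is the term that integration by
parts leaves undifferentiated. -/
theorem euler_eq (α : Form N m k (N + 1)) :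
    euler α = ∑ σ, wedge (contactForm σ) (zeta α σ 0) := by
  unfold euler zeta
  simp

theorem contDiffOn_zeta (hW : IsOpen W) {α : Form N m k (N + 1)}
    (hα : ContDiffOn ℝ ∞ α (jetDom W k)) (σ : Fin m) (I : Fin N → ℕ) :
    ContDiffOn ℝ ∞ (zeta α σ I) (jetDom W (2 * k + 1)) := by
  rw [zeta_eq]
  exact contDiffOn_finset_sum fun J _ =>
    (contDiffOn_formalDI hW (contDiffOn_contractConst_dy hα σ _) _ _).const_smul
      (signedChoose (I + J.1) J.1)

theorem isHor_zeta (hW : IsOpen W) {α : Form N m k (N + 1)}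
    (hα : ContDiffOn ℝ ∞ α (jetDom W k)) (σ : Fin m) (I : Fin N → ℕ) {u : Jet N m (2 * k + 1)}
    (hu : u ∈ jetDom W (2 * k + 1)) : IsHor (zeta α σ I u) := by
  rw [zeta_eq, Finset.sum_apply]
  exact IsHor.sum fun J _ => (isHor_formalDI hW (contDiffOn_contractConst_dy hα σ _)
    (fun u _ => isHor_contractConst_dy α σ _ u) _ hu).smul _

theorem contDiffOn_euler (hW : IsOpen W) {α : Form N m k (N + 1)}
    (hα : ContDiffOn ℝ ∞ α (jetDom W k)) : ContDiffOn ℝ ∞ (euler α) (jetDom W (2 * k + 1)) := by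
  rw [euler_eq]
  exact contDiffOn_finset_sum fun σ _ =>
    contDiffOn_wedge_contactForm σ (contDiffOn_zeta hW hα σ 0)

theorem isContactOne_euler (hW : IsOpen W) {α : Form N m k (N + 1)}
    (hα : ContDiffOn ℝ ∞ α (jetDom W k)) {u : Jet N m (2 * k + 1)}
    (hu : u ∈ jetDom W (2 * k + 1)) : IsContactOne (euler α u) := by
  rw [euler_eq, Finset.sum_apply]
  exact IsContactOne.sum fun σ _ => isContactOne_wedge (isHor_zeta hW hα σ 0 hu) _

theorem contDiffOn_pb (hU : IsOpen U) (hs : ContDiffOn ℝ ∞ s U) (hsW : ∀ x ∈ U, (x, s x) ∈ W)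
    {η : Form N m k q} (hη : ContDiffOn ℝ ∞ η (jetDom W k)) :
    ContDiffOn ℝ ∞ (pb (jetOf k s) η) U := by
  refine contDiffOn_alternating fun v => ?_
  have hS := contDiffOn_jetOf hU hs k
  exact contDiffOn_alternating_apply (g := fun x a => fderiv ℝ (jetOf k s) x (v a))
    (hη.comp hS (mapsTo_jetOf hsW k)) fun a =>
    (hS.fderiv_of_isOpen hU (m := ∞) (by simp)).clm_apply contDiffOn_const

theorem pb_finset_sum {E J ι : Type*} [NormedAddCommGroup E] [NormedSpace ℝ E]
    [NormedAddCommGroup J] [NormedSpace ℝ J] (S : E → J) (t : Finset ι)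
    (f : ι → J → J [⋀^Fin q]→L[ℝ] ℝ) (x : E) :
    pb S (∑ i ∈ t, f i) x = ∑ i ∈ t, pb S (f i) x := by
  ext v
  simp [pb_apply]

theorem pbi_finset_sum {E J ι : Type*} [NormedAddCommGroup E] [NormedSpace ℝ E]
    [NormedAddCommGroup J] [NormedSpace ℝ J] (S ζ : E → J) (t : Finset ι)
    (f : ι → J → J [⋀^Fin (q + 1)]→L[ℝ] ℝ) (x : E) :
    pbi S ζ (∑ i ∈ t, f i) x = ∑ i ∈ t, pbi S ζ (f i) x := by
  ext v
  simp [pbi_apply]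

theorem pb_zeta (hU : IsOpen U) (hs : ContDiffOn ℝ ∞ s U) (hW : IsOpen W)
    (hsW : ∀ x ∈ U, (x, s x) ∈ W) {α : Form N m k (N + 1)} (hα : ContDiffOn ℝ ∞ α (jetDom W k))
    (σ : Fin m) (I : Fin N → ℕ) :
    Set.EqOn (pb (jetOf (2 * k + 1) s) (zeta α σ I)) (∑ J : MIdx N k, signedChoose (I + J.1) J.1 •
      partials (letters J.1) (pb (jetOf (k + 1) s) (contractConst (dy σ (I + J.1)) (pc 1 α)))) U := by
  intro x hx
  rw [zeta_eq, pb_finset_sum, Finset.sum_apply]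
  refine Finset.sum_congr rfl fun J _ => ?_
  rw [Pi.smul_apply, ← pb_formalDI (l := 2 * k + 1) hU hs hW hsW
    (contDiffOn_contractConst_dy hα σ _) (by have := J.2; omega) hx]
  rfl

theorem pbi_euler (hU : IsOpen U) (hs : ContDiffOn ℝ ∞ s U) (hx : x ∈ U)
    (α : Form N m k (N + 1)) :
    pbi (jetOf (2 * k + 1) s) (vjet (2 * k + 1) V) (euler α) x =
      ∑ σ, V x σ • pb (jetOf (2 * k + 1) s) (zeta α σ 0) x := by
  rw [euler_eq, pbi_finset_sum]
  exact Finset.sum_congr rfl fun σ _ => pbi_wedge_contactForm hU hs hx σ _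

theorem pbi_pc_one_eq_sum (hU : IsOpen U) (hV : ContDiffOn ℝ ∞ V U) (hx : x ∈ U)
    (α : Form N m k (N + 1)) :
    pbi (jetOf (k + 1) s) (vjet (k + 1) V) (pc 1 α) x = ∑ σ, ∑ I : MIdx N k,
      partials (letters I.1) (fun y => V y σ) x •
        pb (jetOf (k + 1) s) (contractConst (dy σ I.1) (pc 1 α)) x := by
  -- The coordinate expression of the prolonged variation, cut off at order $k$; the discarded
  -- components of order $k+1$ are invisible to $p_1\alpha$.
  set w : Jet N m (k + 1) := ∑ σ, ∑ I : MIdx N k,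
    partials (letters I.1) (fun y => V y σ) x • dy σ I.1 with hw
  have h1 : proj (k + 1) k (vjet (k + 1) V x - w) = 0 := by
    refine jet_ext ?_ fun K hK => ?_
    · simp [hw, vjet, dy, Prod.fst_sum]
    · rw [coord_proj _ hK, ← coordL_apply, map_sub, hw, map_sum, coordL_apply,
        coord_vjet (hK.trans (Nat.le_succ k))]
      funext τ
      have h2 : ∀ σ (I : MIdx N k), coord (dy σ I.1 : Jet N m (k + 1)) K τ =
          if σ = τ then (if I = ⟨K, hK⟩ then 1 else 0) else 0 := by
        intro σ I
        rw [coord_of_le (hK.trans (Nat.le_succ k))]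
        by_cases h3 : K = I.1
        · subst h3
          simp [dy, Pi.single_apply, eq_comm]
        · have : I ≠ ⟨K, hK⟩ := fun h => h3 (congrArg Subtype.val h).symm
          simp [dy, h3, this]
      have h4 : partials (letters K) (fun y => V y τ) x = partials (letters K) V x τ :=
        partials_clm (ContinuousLinearMap.proj (R := ℝ) (φ := fun _ : Fin m => ℝ) τ) hU hV _ hx
      simp only [map_sum, map_smul, coordL_apply, Pi.sub_apply, Finset.sum_apply, Pi.smul_apply, h2,
        smul_eq_mul]
      simp [h4, coord]
  have h5 := pc_one_of_proj_eq_zero α (jetOf (k + 1) s x) h1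
  rw [map_sub, sub_eq_zero] at h5
  rw [pbi, h5, hw]
  ext v
  simp [pb, contractConst]

end Residual

/-! ### The decomposition of $p_1\alpha$ by the residual form. -/

section ResidualForm

variable {n m k l q : ℕ} {W : Set (Loc (n + 1) m)} {U : Set (Fin (n + 1) → ℝ)}
  {s V : (Fin (n + 1) → ℝ) → Fin m → ℝ} {x : Fin (n + 1) → ℝ}

/-- The contact form `ω^σ ∧ (∂/∂x^j ⌋ ζ^I_σ)`. -/
def contactZeta (α : Form (n + 1) m k (n + 2)) (I : Fin (n + 1) → ℕ) (j : Fin (n + 1)) :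
    Form (n + 1) m (2 * k + 1) (n + 1) :=
  ∑ σ, wedge (contactForm σ) (contractConst (dx j) (zeta α σ I))

theorem residual_eq (α : Form (n + 1) m k (n + 2)) :
    residual α = - ∑ I : MIdx (n + 1) k, ∑ j,
      (((I.1 j + 1 : ℕ) : ℝ) / ((∑ i, I.1 i + 1 : ℕ) : ℝ)) •
        formalDI (3 * k + 1) I.1 (contactZeta α (app I.1 j) j) := rfl

theorem contDiffOn_contactZeta (hW : IsOpen W) {α : Form (n + 1) m k (n + 2)}
    (hα : ContDiffOn ℝ ∞ α (jetDom W k)) (I : Fin (n + 1) → ℕ) (j : Fin (n + 1)) :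
    ContDiffOn ℝ ∞ (contactZeta α I j) (jetDom W (2 * k + 1)) :=
  contDiffOn_finset_sum fun σ _ => contDiffOn_wedge_contactForm σ
    (contDiffOn_contractConst (contDiffOn_zeta hW hα σ I) _)

theorem contDiffOn_residual (hW : IsOpen W) {α : Form (n + 1) m k (n + 2)}
    (hα : ContDiffOn ℝ ∞ α (jetDom W k)) :
    ContDiffOn ℝ ∞ (residual α) (jetDom W (3 * k + 1)) := by
  rw [residual_eq]
  exact (contDiffOn_finset_sum fun I _ => contDiffOn_finset_sum fun j _ =>
    (contDiffOn_formalDI hW (contDiffOn_contactZeta hW hα _ j) _ _).const_smul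
      (((I.1 j + 1 : ℕ) : ℝ) / ((∑ i, I.1 i + 1 : ℕ) : ℝ))).neg

theorem pb_wedge_contactForm (hU : IsOpen U) (hs : ContDiffOn ℝ ∞ s U) (hx : x ∈ U)
    (σ : Fin m) (η : Form (n + 1) m (k + 1) q) :
    pb (jetOf (k + 1) s) (wedge (contactForm σ) η) x = 0 := by
  ext v
  rw [pb_apply, wedge_apply]
  refine Finset.sum_eq_zero fun i _ => ?_
  simp [contactForm_fderiv_jetOf hU hs hx]

theorem pb_contactZeta (hU : IsOpen U) (hs : ContDiffOn ℝ ∞ s U) (α : Form (n + 1) m k (n + 2))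
    (I : Fin (n + 1) → ℕ) (j : Fin (n + 1)) :
    Set.EqOn (pb (jetOf (2 * k + 1) s) (contactZeta α I j)) 0 U := by
  intro x hx
  rw [contactZeta, pb_finset_sum]
  exact Finset.sum_eq_zero fun σ _ => pb_wedge_contactForm hU hs hx σ _

theorem pb_residual (hU : IsOpen U) (hs : ContDiffOn ℝ ∞ s U) (hW : IsOpen W)
    (hsW : ∀ x ∈ U, (x, s x) ∈ W) (hx : x ∈ U) {α : Form (n + 1) m k (n + 2)}
    (hα : ContDiffOn ℝ ∞ α (jetDom W k)) :
    pb (jetOf (3 * k + 1) s) (residual α) x = 0 := by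
  have h1 : ∀ (I : MIdx (n + 1) k) (j : Fin (n + 1)),
      pb (jetOf (3 * k + 1) s) (formalDI (3 * k + 1) I.1 (contactZeta α (app I.1 j) j)) x = 0 := by
    intro I j
    rw [pb_formalDI hU hs hW hsW (contDiffOn_contactZeta hW hα _ j) (by have := I.2; omega) hx,
      partials_congr hU (pb_contactZeta hU hs α _ j) _ hx, partials_zero]
    rfl
  rw [residual_eq]
  ext v
  have h2 := fun I j => DFunLike.congr_fun (h1 I j) v
  simp only [pb_apply] at h2
  simp [pb_apply, h2]

theorem contractBase_pb (hU : IsOpen U) (hs : ContDiffOn ℝ ∞ s U) (hx : x ∈ U)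
    {η : Form (n + 1) m k (n + 1)} (hη : IsHor (η (jetOf k s x))) (j : Fin (n + 1)) :
    pb (jetOf k s) (contractConst (dx j) η) x = contractBase j (pb (jetOf k s) η x) := by
  ext v
  rw [contractBase_apply]
  refine hη.congr fun a => ?_
  refine Fin.cases ?_ (fun b => ?_) a
  · simp [fderiv_jetOf_fst hU hs hx, dx]
  · simp

/-- The contraction `∑_σ V^σ (j s)^* ζ^I_σ` of the coefficients of the decomposition of
`p_1 α`. -/
def zetaAlong (s V : (Fin (n + 1) → ℝ) → Fin m → ℝ) (α : Form (n + 1) m k (n + 2))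
    (I : Fin (n + 1) → ℕ) (x : Fin (n + 1) → ℝ) : (Fin (n + 1) → ℝ) [⋀^Fin (n + 1)]→L[ℝ] ℝ :=
  ∑ σ, V x σ • pb (jetOf (2 * k + 1) s) (zeta α σ I) x

theorem contDiffOn_zetaAlong (hU : IsOpen U) (hs : ContDiffOn ℝ ∞ s U) (hV : ContDiffOn ℝ ∞ V U)
    (hW : IsOpen W) (hsW : ∀ x ∈ U, (x, s x) ∈ W) {α : Form (n + 1) m k (n + 2)}
    (hα : ContDiffOn ℝ ∞ α (jetDom W k)) (I : Fin (n + 1) → ℕ) :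
    ContDiffOn ℝ ∞ (zetaAlong s V α I) U :=
  ContDiffOn.sum fun σ _ => ((contDiff_apply ℝ ℝ σ).comp_contDiffOn hV).smul
    (contDiffOn_pb hU hs hsW (contDiffOn_zeta hW hα σ I))

theorem pbi_contactZeta (hU : IsOpen U) (hs : ContDiffOn ℝ ∞ s U)
    (hW : IsOpen W) (hsW : ∀ x ∈ U, (x, s x) ∈ W) {α : Form (n + 1) m k (n + 2)}
    (hα : ContDiffOn ℝ ∞ α (jetDom W k)) (I : Fin (n + 1) → ℕ) (j : Fin (n + 1)) :
    Set.EqOn (pbi (jetOf (2 * k + 1) s) (vjet (2 * k + 1) V) (contactZeta α I j))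
      (fun x => contractBase j (zetaAlong s V α I x)) U := by
  intro x hx
  change _ = contractBase j (∑ σ, V x σ • pb (jetOf (2 * k + 1) s) (zeta α σ I) x)
  rw [contactZeta, pbi_finset_sum, map_sum]
  refine Finset.sum_congr rfl fun σ _ => ?_
  rw [pbi_wedge_contactForm hU hs hx, map_smul, contractBase_pb hU hs hx
    (isHor_zeta hW hα σ I (mapsTo_jetOf hsW _ hx))]

/-- The residual form contracts to derivatives $\partial_I$ of top forms contracted with
$\partial_j$; $d$ turns each contraction into $\partial_j$ and thereby appends $j$ to $I$. -/
theorem extDeriv_pbi_residual (hU : IsOpen U) (hs : ContDiffOn ℝ ∞ s U) (hV : ContDiffOn ℝ ∞ V U)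
    (hW : IsOpen W) (hsW : ∀ x ∈ U, (x, s x) ∈ W) (hx : x ∈ U) {α : Form (n + 1) m k (n + 2)}
    (hα : ContDiffOn ℝ ∞ α (jetDom W k)) :
    extDeriv (pbi (jetOf (3 * k + 1) s) (vjet (3 * k + 1) V) (residual α)) x =
      - ∑ I : MIdx (n + 1) k, ∑ j, (((I.1 j + 1 : ℕ) : ℝ) / ((∑ i, I.1 i + 1 : ℕ) : ℝ)) •
        partials (letters (app I.1 j)) (zetaAlong s V α (app I.1 j)) x := by
  have hz : ∀ I, ContDiffOn ℝ ∞ (zetaAlong s V α I) U :=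
    contDiffOn_zetaAlong hU hs hV hW hsW hα
  have h1 : Set.EqOn (pbi (jetOf (3 * k + 1) s) (vjet (3 * k + 1) V) (residual α))
      (fun y => - ∑ I : MIdx (n + 1) k, ∑ j,
        (((I.1 j + 1 : ℕ) : ℝ) / ((∑ i, I.1 i + 1 : ℕ) : ℝ)) •
          contractBase j (partials (letters I.1) (zetaAlong s V α (app I.1 j)) y)) U := by
    intro y hy
    have h2 : ∀ (I : MIdx (n + 1) k) (j : Fin (n + 1)),
        pbi (jetOf (3 * k + 1) s) (vjet (3 * k + 1) V)
          (formalDI (3 * k + 1) I.1 (contactZeta α (app I.1 j) j)) y =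
        contractBase j (partials (letters I.1) (zetaAlong s V α (app I.1 j)) y) := by
      intro I j
      rw [pbi_formalDI hU hs hV hW hsW (contDiffOn_contactZeta hW hα _ j)
        (by have := I.2; omega) hy, partials_congr hU (pbi_contactZeta hU hs hW hsW hα _ j) _ hy,
        partials_clm _ hU (hz _) _ hy]
    simp_rw [← h2]
    ext v
    simp [residual_eq, pbi_apply]
  have hd : ∀ (I : MIdx (n + 1) k) (j : Fin (n + 1)), DifferentiableAt ℝ
      (partials (letters I.1) (zetaAlong s V α (app I.1 j))) x := fun I j =>
    ((contDiffOn_partials hU (hz _) _).contDiffAt (hU.mem_nhds hx)).differentiableAt (by simp)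
  have h3 : HasFDerivAt (fun y => - ∑ I : MIdx (n + 1) k, ∑ j,
        (((I.1 j + 1 : ℕ) : ℝ) / ((∑ i, I.1 i + 1 : ℕ) : ℝ)) •
          contractBase j (partials (letters I.1) (zetaAlong s V α (app I.1 j)) y)) _ x :=
    (HasFDerivAt.fun_sum fun I _ => HasFDerivAt.fun_sum fun j _ =>
      ((contractBase j).hasFDerivAt.comp x (hd I j).hasFDerivAt).const_smul
        (((I.1 j + 1 : ℕ) : ℝ) / ((∑ i, I.1 i + 1 : ℕ) : ℝ))).neg
  rw [(h1.eventuallyEq_of_mem (hU.mem_nhds hx)).extDeriv_eq, extDeriv, h3.fderiv,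
    ← ContinuousAlternatingMap.alternatizeUncurryFinCLM_apply, map_neg, map_sum]
  congr 1
  refine Finset.sum_congr rfl fun I _ => ?_
  rw [map_sum]
  refine Finset.sum_congr rfl fun j _ => ?_
  have h4 : HasFDerivAt
      (fun y => contractBase j (partials (letters I.1) (zetaAlong s V α (app I.1 j)) y)) _ x :=
    (contractBase j).hasFDerivAt.comp x (hd I j).hasFDerivAt
  have h5 := extDeriv_contractBase (hd I j) j
  rw [extDeriv, h4.fderiv] at h5
  rw [map_smul, partials_app hU (hz _) _ _ hx]
  exact congrArg _ h5

/-- The coordinate residual operator yields residual forms. -/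
theorem isResidual_residual (hW : IsOpen W) {α : Form (n + 1) m k (n + 2)}
    (hα : ContDiffOn ℝ ∞ α (jetDom W k)) : IsResidual W α (residual α) := by
  have hR := contDiffOn_residual hW hα
  have hopen : ∀ {s : (Fin (n + 1) → ℝ) → Fin m → ℝ}, ContDiff ℝ ∞ s →
      IsOpen {x | (x, s x) ∈ W} := fun hs =>
    hW.preimage (continuous_id.prodMk hs.continuous)
  refine ⟨hR, ?_, fun K hK hK' => ?_⟩
  · refine eqOn_of_pb_eq (fun u _ => isHor_pc_zero _ u) (fun u _ _ _ => rfl) fun s hs x hx => ?_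
    rw [pb_pc_zero (hopen hs) hs.contDiffOn hx,
      pb_residual (hopen hs) hs.contDiffOn hW (fun _ h => h) hx hα]
    rfl
  · refine eqOn_of_pbi_eq (fun u _ => isContactOne_pull (isContactOne_pc_one _ _))
      (fun u hu => (isContactOne_pull (isContactOne_euler hW hα (proj_mem_jetDom hu))).add
        (isContactOne_pull (isContactOne_pc_one _ _))) fun s V hs hV x hx => ?_
    set U := {x | (x, s x) ∈ W} with hUdef
    have hU : IsOpen U := hopen hs
    have hsW : ∀ x ∈ U, (x, s x) ∈ W := fun _ h => h
    have hs' : ContDiffOn ℝ ∞ s U := hs.contDiffOn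
    have hV' : ContDiffOn ℝ ∞ V U := hV.contDiffOn
    have hadd : ∀ (f g : Form (n + 1) m K (n + 2)), pbi (jetOf K s) (vjet K V) (f + g) x =
      pbi (jetOf K s) (vjet K V) f x + pbi (jetOf K s) (vjet K V) g x := fun _ _ => rfl
    rw [hadd, pbi_pull hU hs' hx (by omega), pbi_pull hU hs' hx (by omega),
      pbi_pull hU hs' hx (by omega), pbi_extDeriv_pc_one hU hs' hV' hW hsW hx hR,
      extDeriv_pbi_residual hU hs' hV' hW hsW hx hα, neg_neg, pbi_euler hU hs' hx,
      pbi_pc_one_eq_sum hU hV' hx]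
    have ha : ∀ σ I, ContDiffOn ℝ ∞
        (pb (jetOf (k + 1) s) (contractConst (dy σ I) (pc 1 α))) U := fun σ I =>
      contDiffOn_pb hU hs' hsW (contDiffOn_contractConst_dy hα σ I)
    have ha0 : ∀ σ I, k < ∑ i, I i → Set.EqOn
        (pb (jetOf (k + 1) s) (contractConst (dy σ I) (pc 1 α))) 0 U := by
      intro σ I hI y _
      rw [contractConst_dy_eq_zero α σ hI]
      rfl
    have hVσ : ∀ σ, ContDiffOn ℝ ∞ (fun y => V y σ) U := fun σ =>
      (contDiff_apply ℝ ℝ σ).comp_contDiffOn hV'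
    have hzs : ∀ σ I, ContDiffOn ℝ ∞
        ((fun y => V y σ) • pb (jetOf (2 * k + 1) s) (zeta α σ I)) U := fun σ I =>
      (hVσ σ).smul (contDiffOn_pb hU hs' hsW (contDiffOn_zeta hW hα σ I))
    have hzA : ∀ I, zetaAlong s V α I =
        ∑ σ, (fun y => V y σ) • pb (jetOf (2 * k + 1) s) (zeta α σ I) := by
      intro I
      funext y
      simp [zetaAlong, Finset.sum_apply]
    -- Integration by parts, separately for each fibre index, moves all derivatives of the variation
    -- to the outside.
    have h1 : ∑ σ, ∑ I : MIdx (n + 1) k, partials (letters I.1) (fun y => V y σ) x •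
        pb (jetOf (k + 1) s) (contractConst (dy σ I.1) (pc 1 α)) x =
        ∑ I : MIdx (n + 1) k, partials (letters I.1) (zetaAlong s V α I.1) x := by
      have h2 : ∀ σ, ∑ I : MIdx (n + 1) k, partials (letters I.1) (fun y => V y σ) x •
          pb (jetOf (k + 1) s) (contractConst (dy σ I.1) (pc 1 α)) x =
          ∑ I : MIdx (n + 1) k, partials (letters I.1)
            ((fun y => V y σ) • pb (jetOf (2 * k + 1) s) (zeta α σ I.1)) x := by
        intro σ
        rw [sum_partials_smul_eq hU (hVσ σ) (ha σ) (ha0 σ) hx]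
        refine Finset.sum_congr rfl fun I _ => partials_congr hU (fun y hy => ?_) _ hx
        simp only [Pi.smul_apply']
        rw [pb_zeta hU hs' hW hsW hα σ I.1 hy]
      simp_rw [h2]
      rw [Finset.sum_comm]
      refine Finset.sum_congr rfl fun I _ => ?_
      rw [hzA, partials_sum _ _ hU (fun σ _ => hzs σ _) _ hx, Finset.sum_apply]
    -- The term $I=0$ is the contracted Euler form; splitting a letter off the other indices
    -- reproduces the exact term of the residual form.
    rw [h1, sum_midx_eq_zero_add fun I => partials (letters I) (zetaAlong s V α I) x]
    · rw [letters_zero]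
      rfl
    · intro I hI
      -- For $|I|>k$ every $\Psi^{I+J}_\sigma$ entering $\zeta^I_\sigma$ is zero.
      have h3 : Set.EqOn (zetaAlong s V α I) 0 U := by
        intro y hy
        refine Finset.sum_eq_zero fun σ _ => ?_
        rw [pb_zeta hU hs' hW hsW hα σ I hy, Finset.sum_apply, Finset.sum_eq_zero, smul_zero]
        intro J _
        have h4 : k < ∑ i, (I + J.1) i :=
          hI.trans_le (Finset.sum_le_sum fun i _ => Nat.le_add_right _ _)
        rw [Pi.smul_apply, contractConst_dy_eq_zero α σ h4]
        have h5 : pb (jetOf (k + 1) s) (0 : Form (n + 1) m (k + 1) (n + 1)) = 0 := rfl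
        rw [h5, partials_zero]
        simp
      rw [partials_congr hU h3 _ hx, partials_zero]
      rfl

end ResidualForm

/-! ### Prolongations of projectable vector fields -/

section Prolongation

variable {N m k l q : ℕ} {W : Set (Loc N m)} {ψ : Loc N m → Loc N m} {U : Set (Fin N → ℝ)}
  {s : (Fin N → ℝ) → Fin m → ℝ} {x : Fin N → ℝ}

/-- `ψ` is projectable on `W`: its horizontal components do not depend on the fibre
coordinates, infinitesimally. -/
def ProjectableOn (W : Set (Loc N m)) (ψ : Loc N m → Loc N m) : Prop :=
  ∀ z ∈ W, ∀ y, (fderiv ℝ ψ z (0, y)).1 = 0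

theorem contDiffOn_comp_pt {G : Type*} [NormedAddCommGroup G] [NormedSpace ℝ G] {f : Loc N m → G}
    (hf : ContDiffOn ℝ ∞ f W) : ContDiffOn ℝ ∞ (fun u : Jet N m k => f (pt u)) (jetDom W k) :=
  hf.comp ptL.contDiff.contDiffOn fun _ h => h

theorem contDiffOn_prolongCoeff (hW : IsOpen W) (hψ : ContDiffOn ℝ ∞ ψ W) (L : List (Fin N)) :
    ContDiffOn ℝ ∞ (prolongCoeff ψ L) (jetDom W L.length) := by
  induction L with
  | nil => exact contDiff_snd.comp_contDiffOn (contDiffOn_comp_pt hψ)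
  | cons j L ih =>
    refine ContDiffOn.sub (f := fun u : Jet N m (L.length + 1) =>
      fderiv ℝ (prolongCoeff ψ L) (proj (L.length + 1) L.length u) (totalVec j u))
      (g := fun u : Jet N m (L.length + 1) => ∑ i, (fderiv ℝ ψ (pt u) (Pi.single j 1, 0)).1 i •
            coord (k := L.length + 1) u (app (fun a => L.count a) i)) ?_ ?_
    · exact (contDiffOn_comp_proj (ih.fderiv_of_isOpen (isOpen_jetDom hW _) (m := ∞) (by simp))
        (L.length + 1)).clm_apply (contDiff_totalVec j).contDiffOn
    · refine ContDiffOn.sum fun i _ => ?_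
      have hc : ContDiffOn ℝ ∞ (fun u : Jet N m (L.length + 1) =>
          coord u (app (fun a => L.count a) i)) (jetDom W (L.length + 1)) :=
        (coordL _).contDiff.contDiffOn
      have hf : ContDiffOn ℝ ∞ (fun u : Jet N m (L.length + 1) =>
          (fderiv ℝ ψ (pt u) (Pi.single j 1, 0)).1 i) (jetDom W (L.length + 1)) :=
        ((contDiff_apply ℝ ℝ i).comp contDiff_fst).comp_contDiffOn
          ((contDiffOn_comp_pt (hψ.fderiv_of_isOpen hW (m := ∞) (by simp))).clm_apply
            contDiffOn_const)
      exact hf.smul hc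

theorem contDiffOn_prolong (hW : IsOpen W) (hψ : ContDiffOn ℝ ∞ ψ W) (k : ℕ) :
    ContDiffOn ℝ ∞ (prolong k ψ) (jetDom W k) :=
  (contDiff_fst.comp_contDiffOn (contDiffOn_comp_pt hψ)).prodMk (contDiffOn_pi.2 fun I =>
    contDiffOn_comp_proj (contDiffOn_prolongCoeff hW hψ (letters I.1)) k)

theorem contDiffOn_horPart (hW : IsOpen W) (hψ : ContDiffOn ℝ ∞ ψ W) (k : ℕ) :
    ContDiffOn ℝ ∞ (horPart k ψ) (jetDom W (k + 1)) := by
  unfold horPart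
  simp only [hor_apply]
  refine ContDiffOn.sum fun i _ => ?_
  have hc : ContDiffOn ℝ ∞ (fun u : Jet N m (k + 1) => (totalVec i u : Jet N m k))
      (jetDom W (k + 1)) := (contDiff_totalVec i).contDiffOn
  have hf : ContDiffOn ℝ ∞ (fun u : Jet N m (k + 1) => (prolong k ψ (proj (k + 1) k u)).1 i)
      (jetDom W (k + 1)) :=
    ((contDiff_apply ℝ ℝ i).comp contDiff_fst).comp_contDiffOn
      (contDiffOn_comp_proj (contDiffOn_prolong hW hψ k) (k + 1))
  exact hf.smul hc

theorem contDiffOn_vertPart (hW : IsOpen W) (hψ : ContDiffOn ℝ ∞ ψ W) (k : ℕ) :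
    ContDiffOn ℝ ∞ (vertPart k ψ) (jetDom W (k + 1)) :=
  (contDiffOn_comp_proj (contDiffOn_prolong hW hψ k) (k + 1)).sub (contDiffOn_horPart hW hψ k)

theorem vertPart_fst (k : ℕ) (ψ : Loc N m → Loc N m) (u : Jet N m (k + 1)) :
    (vertPart k ψ u).1 = 0 := ver_fst _ _

theorem fderiv_prolong_fst (hW : IsOpen W) (hψ : ContDiffOn ℝ ∞ ψ W) (hp : ProjectableOn W ψ)
    {u : Jet N m k} (hu : u ∈ jetDom W k) {w : Jet N m k} (hw : w.1 = 0) :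
    (fderiv ℝ (prolong k ψ) u w).1 = 0 := by
  have h1 : HasFDerivAt (prolong k ψ) _ u :=
    (((contDiffOn_prolong hW hψ k).contDiffAt
      ((isOpen_jetDom hW k).mem_nhds hu)).differentiableAt (by simp)).hasFDerivAt
  have h2 : HasFDerivAt (fun u => (prolong k ψ u).1) _ u := h1.fst
  have h3 : HasFDerivAt ψ _ (ptL u) :=
    ((hψ.contDiffAt (hW.mem_nhds hu)).differentiableAt (by simp)).hasFDerivAt
  have h4 : HasFDerivAt (fun u : Jet N m k => (ψ (pt u)).1) _ u := (h3.comp u ptL.hasFDerivAt).fst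
  have h5 := DFunLike.congr_fun (h2.unique h4) w
  have h6 : ptL w = (0, coord w 0) := Prod.ext hw rfl
  simp only [ContinuousLinearMap.comp_apply, h6] at h5
  exact h5.trans (hp _ hu _)

theorem proj_prolong {K : ℕ} (h : k ≤ K) (ψ : Loc N m → Loc N m) (u : Jet N m K) :
    proj K k (prolong K ψ u) = prolong k ψ (proj K k u) := by
  refine jet_ext ?_ fun I hI => ?_
  · simp [prolong]
  · rw [coord_proj _ hI, coord_of_le hI, coord_of_le (hI.trans h)]
    change prolongCoeff ψ (letters I) _ = prolongCoeff ψ (letters I) _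
    rw [proj_proj (by rwa [length_letters])]

/-- The horizontal components of `ψ` along a section. -/
def baseAlong (ψ : Loc N m → Loc N m) (s : (Fin N → ℝ) → Fin m → ℝ) (x : Fin N → ℝ) : Fin N → ℝ :=
  (ψ (x, s x)).1

/-- The vertical part `ψ^σ - y^σ_i ψ^i` of `ψ` along a section. -/
def vertAlong (ψ : Loc N m → Loc N m) (s : (Fin N → ℝ) → Fin m → ℝ) (x : Fin N → ℝ) : Fin m → ℝ :=
  (ψ (x, s x)).2 - ∑ i, baseAlong ψ s x i • partials [i] s x

theorem contDiffOn_baseAlong (hs : ContDiffOn ℝ ∞ s U) (hsW : ∀ x ∈ U, (x, s x) ∈ W)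
    (hψ : ContDiffOn ℝ ∞ ψ W) : ContDiffOn ℝ ∞ (baseAlong ψ s) U :=
  contDiff_fst.comp_contDiffOn (hψ.comp (contDiffOn_id.prodMk hs) hsW)

theorem contDiffOn_vertAlong (hU : IsOpen U) (hs : ContDiffOn ℝ ∞ s U)
    (hsW : ∀ x ∈ U, (x, s x) ∈ W) (hψ : ContDiffOn ℝ ∞ ψ W) :
    ContDiffOn ℝ ∞ (vertAlong ψ s) U :=
  (contDiff_snd.comp_contDiffOn (hψ.comp (contDiffOn_id.prodMk hs) hsW)).sub
    (ContDiffOn.sum fun i _ => ((contDiff_apply ℝ ℝ i).comp_contDiffOn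
      (contDiffOn_baseAlong hs hsW hψ)).smul (contDiffOn_partials hU hs [i]))

theorem fderiv_baseAlong_single (hU : IsOpen U) (hs : ContDiffOn ℝ ∞ s U)
    (hsW : ∀ x ∈ U, (x, s x) ∈ W) (hW : IsOpen W) (hψ : ContDiffOn ℝ ∞ ψ W)
    (hp : ProjectableOn W ψ) (hx : x ∈ U) (j : Fin N) :
    fderiv ℝ (baseAlong ψ s) x (Pi.single j 1) = (fderiv ℝ ψ (x, s x) (Pi.single j 1, 0)).1 := by
  have h1 : HasFDerivAt s _ x :=
    ((hs.contDiffAt (hU.mem_nhds hx)).differentiableAt (by simp)).hasFDerivAt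
  have h2 : HasFDerivAt ψ _ (x, s x) :=
    ((hψ.contDiffAt (hW.mem_nhds (hsW x hx))).differentiableAt (by simp)).hasFDerivAt
  have h3 : HasFDerivAt (baseAlong ψ s) _ x :=
    (HasFDerivAt.comp (g := ψ) (f := fun x => (x, s x)) x h2 ((hasFDerivAt_id x).prodMk h1)).fst
  rw [h3.fderiv]
  have h4 : ((Pi.single j 1, fderiv ℝ s x (Pi.single j 1)) : Loc N m) =
      (Pi.single j 1, 0) + (0, fderiv ℝ s x (Pi.single j 1)) := by simp
  change (fderiv ℝ ψ (x, s x) (Pi.single j 1, fderiv ℝ s x (Pi.single j 1))).1 = _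
  rw [h4, map_add, Prod.fst_add, hp _ (hsW x hx), add_zero]

/-- The recursion is solved by $\partial_L\psi_V^\sigma+\psi^iy^\sigma_{Li}$: differentiating the
second summand produces $y^\sigma_{Li}\,\partial_j\psi^i$, exactly what the recursion subtracts.
Projectability makes this derivative of $\psi^i$ along the section a derivative on the base. -/
theorem prolongCoeff_jetOf (hU : IsOpen U) (hs : ContDiffOn ℝ ∞ s U)
    (hsW : ∀ x ∈ U, (x, s x) ∈ W) (hW : IsOpen W) (hψ : ContDiffOn ℝ ∞ ψ W)
    (hp : ProjectableOn W ψ) (L : List (Fin N)) :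
    Set.EqOn (fun x => prolongCoeff ψ L (jetOf L.length s x))
      (fun x => partials L (vertAlong ψ s) x + ∑ i, baseAlong ψ s x i • partials (i :: L) s x)
      U := by
  induction L with
  | nil =>
    intro x _
    simp [prolongCoeff, vertAlong, partials]
  | cons j L ih =>
    intro x hx
    have hV := contDiffOn_vertAlong hU hs hsW hψ
    have hξ := contDiffOn_baseAlong hs hsW hψ
    have hc : HasFDerivAt (prolongCoeff ψ L) _ (jetOf L.length s x) :=
      (((contDiffOn_prolongCoeff hW hψ L).contDiffAt ((isOpen_jetDom hW _).mem_nhds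
        (mapsTo_jetOf hsW _ hx))).differentiableAt (by simp)).hasFDerivAt
    have hS : HasFDerivAt (jetOf L.length s) _ x :=
      (((contDiffOn_jetOf hU hs _).contDiffAt (hU.mem_nhds hx)).differentiableAt
        (by simp)).hasFDerivAt
    have h1 : HasFDerivAt (fun x => prolongCoeff ψ L (jetOf L.length s x)) _ x := hc.comp x hS
    have hd : ∀ (M : List (Fin N)), HasFDerivAt (partials M s) _ x := fun M =>
      (((contDiffOn_partials hU hs M).contDiffAt (hU.mem_nhds hx)).differentiableAt
        (by simp)).hasFDerivAt
    have hdξ : HasFDerivAt (baseAlong ψ s) _ x :=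
      ((hξ.contDiffAt (hU.mem_nhds hx)).differentiableAt (by simp)).hasFDerivAt
    have hdV : HasFDerivAt (partials L (vertAlong ψ s)) _ x :=
      (((contDiffOn_partials hU hV L).contDiffAt (hU.mem_nhds hx)).differentiableAt
        (by simp)).hasFDerivAt
    have h2 : HasFDerivAt (fun x => partials L (vertAlong ψ s) x +
        ∑ i, baseAlong ψ s x i • partials (i :: L) s x) _ x :=
      hdV.add (HasFDerivAt.fun_sum fun i _ => ((hasFDerivAt_pi'.1 hdξ) i).smul (hd (i :: L)))
    have h3 := DFunLike.congr_fun (h1.fderiv.symm.trans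
      (((ih.eventuallyEq_of_mem (hU.mem_nhds hx)).fderiv_eq).trans h2.fderiv)) (Pi.single j 1)
    simp only [ContinuousLinearMap.comp_apply, fderiv_jetOf_single hU hs hx, add_apply, sum_apply,
      smul_apply, ContinuousLinearMap.smulRight_apply, ContinuousLinearMap.proj_apply,
      fderiv_baseAlong_single hU hs hsW hW hψ hp hx] at h3
    change fderiv ℝ (prolongCoeff ψ L)
        (proj (L.length + 1) L.length (jetOf (L.length + 1) s x))
        (totalVec j (jetOf (L.length + 1) s x))
        - ∑ i, (fderiv ℝ ψ (pt (jetOf (L.length + 1) s x)) (Pi.single j 1, 0)).1 i •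
            coord (k := L.length + 1) (jetOf (L.length + 1) s x) (app (fun a => L.count a) i) = _
    have h4 : ∀ i, coord (jetOf (L.length + 1) s x) (app (fun a => L.count a) i) =
        partials (i :: L) s x := by
      intro i
      have h5 : ∑ a, L.count a = L.length := by
        rw [← length_letters]
        exact (letters_perm fun _ => rfl).length_eq
      rw [coord_jetOf (by rw [sum_app, h5])]
      exact partials_perm hU hs ((letters_app _ i).trans
        ((letters_perm fun _ => rfl).cons i)) hx
    simp only [h4]
    rw [proj_jetOf (Nat.le_succ _), h3, pt_jetOf, Finset.sum_add_distrib, ← add_assoc,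
      add_sub_cancel_right]
    congr 1
    refine Finset.sum_congr rfl fun i _ => ?_
    congr 1
    exact partials_perm hU hs (List.Perm.swap i j L) hx

/-- Splitting along a section: the vertical part is the prolongation of one variation, and the rest
is tangent to the prolonged section. -/
theorem prolong_jetOf (hU : IsOpen U) (hs : ContDiffOn ℝ ∞ s U)
    (hsW : ∀ x ∈ U, (x, s x) ∈ W) (hW : IsOpen W) (hψ : ContDiffOn ℝ ∞ ψ W)
    (hp : ProjectableOn W ψ) (hx : x ∈ U) :
    prolong k ψ (jetOf k s x) =
      vjet k (vertAlong ψ s) x + fderiv ℝ (jetOf k s) x (baseAlong ψ s x) := by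
  refine jet_ext ?_ fun I hI => ?_
  · rw [Prod.fst_add, fderiv_jetOf_fst hU hs hx]
    simp [prolong, vjet, baseAlong]
  · have hl : (letters I).length ≤ k := by rwa [length_letters]
    have h1 : coord (prolong k ψ (jetOf k s x)) I =
        prolongCoeff ψ (letters I) (proj k (letters I).length (jetOf k s x)) := coord_of_le hI
    have h2 := prolongCoeff_jetOf hU hs hsW hW hψ hp (letters I) hx
    simp only at h2
    rw [h1, proj_jetOf hl, h2, ← coordL_apply, map_add, coordL_apply, coord_vjet hI,
      fderiv_jetOf_apply hU hs hx, map_sum]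
    congr 1
    refine Finset.sum_congr rfl fun i _ => ?_
    rw [map_smul, coordL_apply, coord_totalVec _ _ hI, coord_jetOf (by rw [sum_app]; omega),
      partials_app hU hs I i hx]
    rfl

theorem horPart_jetOf (hU : IsOpen U) (hs : ContDiffOn ℝ ∞ s U) (hx : x ∈ U) :
    horPart k ψ (jetOf (k + 1) s x) = fderiv ℝ (jetOf k s) x (baseAlong ψ s x) := by
  rw [horPart, hor_jetOf hU hs hx, proj_jetOf (Nat.le_succ k)]
  simp [prolong, baseAlong]

theorem vertPart_jetOf (hU : IsOpen U) (hs : ContDiffOn ℝ ∞ s U)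
    (hsW : ∀ x ∈ U, (x, s x) ∈ W) (hW : IsOpen W) (hψ : ContDiffOn ℝ ∞ ψ W)
    (hp : ProjectableOn W ψ) (hx : x ∈ U) :
    vertPart k ψ (jetOf (k + 1) s x) = vjet k (vertAlong ψ s) x := by
  have h : vertPart k ψ (jetOf (k + 1) s x) =
      prolong k ψ (proj (k + 1) k (jetOf (k + 1) s x)) - horPart k ψ (jetOf (k + 1) s x) := rfl
  rw [h, horPart_jetOf hU hs hx, proj_jetOf (Nat.le_succ k), prolong_jetOf hU hs hsW hW hψ hp hx,
    add_sub_cancel_right]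

end Prolongation

/-! ### Lie derivatives along prolongations -/

section Lie

variable {N m k l q : ℕ} {W : Set (Loc N m)} {ψ : Loc N m → Loc N m}

theorem contDiffOn_lie (hW : IsOpen W) (hψ : ContDiffOn ℝ ∞ ψ W) {η : Form N m k q}
    (hη : ContDiffOn ℝ ∞ η (jetDom W k)) : ContDiffOn ℝ ∞ (lie (prolong k ψ) η) (jetDom W k) :=
  contDiffOn_lieAlong (isOpen_jetDom hW k) (isOpen_jetDom hW k) (fun _ h => h)
    (contDiffOn_prolong hW hψ k) hη

theorem isHor_lie (hW : IsOpen W) (hψ : ContDiffOn ℝ ∞ ψ W) (hp : ProjectableOn W ψ)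
    {η : Form N m k q} (hs : ContDiffOn ℝ ∞ η (jetDom W k)) (hη : ∀ u ∈ jetDom W k, IsHor (η u))
    {u : Jet N m k} (hu : u ∈ jetDom W k) : IsHor (lie (prolong k ψ) η u) :=
  isHor_lieAlong (D := jetDom W k) (fun _ h => h) (fun _ hw => fderiv_prolong_fst hW hψ hp hu hw)
    ((isOpen_jetDom hW k).mem_nhds hu) hη (differentiableAt_of_contDiffOn_jetDom hW hs hu)

/-- Prolongations of different orders are related by the projections. This allows the first
variation formula, valid only at a common higher order, to be differentiated again. -/
theorem lie_pull {K : ℕ} (h : k ≤ K) (hW : IsOpen W) (hψ : ContDiffOn ℝ ∞ ψ W) {η : Form N m k q}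
    (hη : ContDiffOn ℝ ∞ η (jetDom W k)) :
    Set.EqOn (lie (prolong K ψ) (pull K η)) (pull K (lie (prolong k ψ) η)) (jetDom W K) := by
  intro u hu
  have hu' : proj K k u ∈ jetDom W k := proj_mem_jetDom hu
  have h1 : HasFDerivAt η _ (proj K k u) :=
    (differentiableAt_of_contDiffOn_jetDom hW hη hu').hasFDerivAt
  have h0 : HasFDerivAt (fun u => η (proj K k u)) _ u :=
    HasFDerivAt.comp (g := η) u h1 (proj K k).hasFDerivAt
  let c : Jet N m k [⋀^Fin q]→L[ℝ] ℝ →L[ℝ] Jet N m K [⋀^Fin q]→L[ℝ] ℝ :=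
    ContinuousAlternatingMap.compContinuousLinearMapCLM (proj K k)
  have h2 : HasFDerivAt (pull K η) _ u :=
    HasFDerivAt.comp (f := fun u => η (proj K k u)) u c.hasFDerivAt h0
  have h3 : HasFDerivAt (prolong K ψ) _ u :=
    (((contDiffOn_prolong hW hψ K).contDiffAt
      ((isOpen_jetDom hW K).mem_nhds hu)).differentiableAt (by simp)).hasFDerivAt
  have h4 : HasFDerivAt (prolong k ψ) _ (proj K k u) :=
    (((contDiffOn_prolong hW hψ k).contDiffAt
      ((isOpen_jetDom hW k).mem_nhds hu')).differentiableAt (by simp)).hasFDerivAt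
  have h5 : HasFDerivAt (fun u => proj K k (prolong K ψ u)) _ u :=
    (proj K k).hasFDerivAt.comp u h3
  have h6 : HasFDerivAt (fun u => prolong k ψ (proj K k u)) _ u :=
    h4.comp u (proj K k).hasFDerivAt
  have h7 : (fun u => proj K k (prolong K ψ u)) = fun u => prolong k ψ (proj K k u) :=
    funext fun u => proj_prolong h ψ u
  rw [← h7] at h6
  have h8 := h5.unique h6
  simp only [lie, lieAlong, pull, ContinuousLinearMap.coe_id', id_eq]
  change (fderiv ℝ (pull K η) u (prolong K ψ u)).compContinuousLinearMap _ + _ = _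
  rw [h2.fderiv, mixed_comp, h8]
  have hadd : ∀ f g : Jet N m k [⋀^Fin q]→L[ℝ] ℝ, (f + g).compContinuousLinearMap (proj K k) =
    f.compContinuousLinearMap (proj K k) + g.compContinuousLinearMap (proj K k) := fun _ _ => rfl
  rw [hadd, mixed_compContinuousLinearMap]
  change (fderiv ℝ η (proj K k u) (proj K k (prolong K ψ u))).compContinuousLinearMap
    (proj K k) + _ = _
  rw [proj_prolong h]
  rfl

theorem lie_add {Z : Jet N m k → Jet N m k} {f g : Form N m k q} {u : Jet N m k}
    (hf : DifferentiableAt ℝ f u) (hg : DifferentiableAt ℝ g u) :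
    lie Z (f + g) u = lie Z f u + lie Z g u := by
  have h : fderiv ℝ (f + g) u = fderiv ℝ f u + fderiv ℝ g u := fderiv_add hf hg
  ext v
  simp only [lie, lieAlong, ContinuousLinearMap.coe_id', id_eq, h, mixed_one_apply,
    ContinuousAlternatingMap.add_apply, ContinuousAlternatingMap.compContinuousLinearMap_apply,
    add_apply, Pi.add_apply, Finset.sum_add_distrib]
  ring

theorem lie_congr (hW : IsOpen W) {Z : Jet N m k → Jet N m k} {f g : Form N m k q}
    (h : Set.EqOn f g (jetDom W k)) : Set.EqOn (lie Z f) (lie Z g) (jetDom W k) := by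
  intro u hu
  have h1 : fderiv ℝ f u = fderiv ℝ g u :=
    (h.eventuallyEq_of_mem ((isOpen_jetDom hW k).mem_nhds hu)).fderiv_eq
  simp only [lie, lieAlong, ContinuousLinearMap.coe_id', id_eq, h1, h hu]

end Lie

/-! ### The first variation formula -/

section FirstVariation

variable {n m k l q : ℕ} {W : Set (Loc (n + 1) m)} {ψ : Loc (n + 1) m → Loc (n + 1) m}
  {U : Set (Fin (n + 1) → ℝ)} {s : (Fin (n + 1) → ℝ) → Fin m → ℝ} {x : Fin (n + 1) → ℝ}

theorem contDiffOn_eulerContract (hW : IsOpen W) (hψ : ContDiffOn ℝ ∞ ψ W)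
    {lam : Form (n + 1) m k (n + 1)} (hl : ContDiffOn ℝ ∞ lam (jetDom W k)) :
    ContDiffOn ℝ ∞ (eulerContract ψ lam) (jetDom W (2 * k + 2)) :=
  contDiffOn_contract (contDiffOn_euler hW (contDiffOn_extDeriv (isOpen_jetDom hW k) hl))
    (contDiffOn_vertPart hW hψ _)

theorem isHor_eulerContract (hW : IsOpen W) {lam : Form (n + 1) m k (n + 1)}
    (hl : ContDiffOn ℝ ∞ lam (jetDom W k)) {u : Jet (n + 1) m (2 * k + 2)}
    (hu : u ∈ jetDom W (2 * k + 2)) : IsHor (eulerContract ψ lam u) := by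
  have h := isHor_curryLeft (isContactOne_euler hW
    (contDiffOn_extDeriv (isOpen_jetDom hW k) hl) (proj_mem_jetDom hu))
    (vertPart_fst (2 * k + 1) ψ u)
  rintro v ⟨a, ha⟩
  exact h _ ⟨a, by simpa using ha⟩

theorem contDiffOn_noetherCurrent (hW : IsOpen W) (hψ : ContDiffOn ℝ ∞ ψ W)
    {lam : Form (n + 1) m k (n + 1)} (hl : ContDiffOn ℝ ∞ lam (jetDom W k))
    {R : Form (n + 1) m l (n + 1)} (hR : ContDiffOn ℝ ∞ R (jetDom W l)) :
    ContDiffOn ℝ ∞ (noetherCurrent ψ lam R) (jetDom W (k + l + 2)) :=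
  (contDiffOn_pull (contDiffOn_contract (contDiffOn_pc hR 1).neg
    (contDiffOn_vertPart hW hψ _)) _).add
    (contDiffOn_pull (contDiffOn_contract hl (contDiffOn_horPart hW hψ _)) _)

theorem isHor_noetherCurrent {lam : Form (n + 1) m k (n + 1)}
    (hl : ∀ u ∈ jetDom W k, IsHor (lam u)) (R : Form (n + 1) m l (n + 1))
    {u : Jet (n + 1) m (k + l + 2)} (hu : u ∈ jetDom W (k + l + 2)) :
    IsHor (noetherCurrent ψ lam R u) := by
  refine IsHor.add (isHor_pull ?_) (isHor_pull ?_)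
  · have h1 : IsContactOne ((-pc 1 R) (proj (l + 2) (l + 1) (proj (k + l + 2) (l + 2) u))) := by
      intro v hv
      have := isContactOne_pc_one R (proj (l + 2) (l + 1) (proj (k + l + 2) (l + 2) u)) v hv
      simp [this]
    have h := isHor_curryLeft h1 (vertPart_fst (l + 1) ψ (proj (k + l + 2) (l + 2) u))
    rintro v ⟨a, ha⟩
    exact h _ ⟨a, by simpa using ha⟩
  · have h := (hl (proj (k + 1) k (proj (k + l + 2) (k + 1) u))
      (proj_mem_jetDom (proj_mem_jetDom hu))).curryLeft
        (horPart k ψ (proj (k + l + 2) (k + 1) u))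
    rintro v ⟨a, ha⟩
    exact h _ ⟨a, by simpa using ha⟩

theorem pbi_prolong (hU : IsOpen U) (hs : ContDiffOn ℝ ∞ s U)
    (hsW : ∀ x ∈ U, (x, s x) ∈ W) (hW : IsOpen W) (hψ : ContDiffOn ℝ ∞ ψ W)
    (hp : ProjectableOn W ψ) (hx : x ∈ U) (η : Form (n + 1) m k (q + 1)) :
    pbi (jetOf k s) (fun y => prolong k ψ (jetOf k s y)) η x =
      pbi (jetOf k s) (vjet k (vertAlong ψ s)) η x +
        (pb (jetOf k s) η x).curryLeft (baseAlong ψ s x) := by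
  rw [pbi, prolong_jetOf hU hs hsW hW hψ hp hx, map_add]
  ext v
  refine congrArg (_ + ·) (congrArg (η _) (funext fun a => ?_))
  refine Fin.cases ?_ (fun b => ?_) a <;> simp

theorem pbi_vjet_of_isHor {V : (Fin (n + 1) → ℝ) → Fin m → ℝ} {η : Form (n + 1) m k (q + 1)}
    (hη : IsHor (η (jetOf k s x))) : pbi (jetOf k s) (vjet k V) η x = 0 := by
  ext v
  exact hη _ ⟨0, rfl⟩

theorem pb_eulerContract (hU : IsOpen U) (hs : ContDiffOn ℝ ∞ s U)
    (hsW : ∀ x ∈ U, (x, s x) ∈ W) (hW : IsOpen W) (hψ : ContDiffOn ℝ ∞ ψ W)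
    (hp : ProjectableOn W ψ) (hx : x ∈ U) (lam : Form (n + 1) m k (n + 1)) :
    pb (jetOf (2 * k + 2) s) (eulerContract ψ lam) x =
      pbi (jetOf (2 * k + 1) s) (vjet (2 * k + 1) (vertAlong ψ s)) (euler (extDeriv lam)) x := by
  rw [eulerContract, pb_contract hU hs hx, pbi, pbi, vertPart_jetOf hU hs hsW hW hψ hp hx]

theorem pb_noetherCurrent (hU : IsOpen U) (hs : ContDiffOn ℝ ∞ s U)
    (hsW : ∀ x ∈ U, (x, s x) ∈ W) (hW : IsOpen W) (hψ : ContDiffOn ℝ ∞ ψ W)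
    (hp : ProjectableOn W ψ) (hx : x ∈ U) (lam : Form (n + 1) m k (n + 1))
    (R : Form (n + 1) m l (n + 1)) :
    pb (jetOf (k + l + 2) s) (noetherCurrent ψ lam R) x =
      - pbi (jetOf l s) (vjet l (vertAlong ψ s)) R x +
        (pb (jetOf k s) lam x).curryLeft (baseAlong ψ s x) := by
  have hadd : ∀ f g : Form (n + 1) m (k + l + 2) n, pb (jetOf (k + l + 2) s) (f + g) x =
    pb (jetOf (k + l + 2) s) f x + pb (jetOf (k + l + 2) s) g x := fun _ _ => rfl
  rw [noetherCurrent, hadd, pb_pull hU hs hx (by omega), pb_pull hU hs hx (by omega),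
    pb_contract hU hs hx, pb_contract hU hs hx, ← pbi_pc_one hU hs hx]
  congr 1
  · rw [pbi, vertPart_jetOf hU hs hsW hW hψ hp hx]
    rfl
  · rw [pbi, horPart_jetOf hU hs hx]
    ext v
    refine congrArg (lam _) (funext fun a => ?_)
    refine Fin.cases ?_ (fun b => ?_) a <;> simp

/-- The decomposition of a form by means of a residual form, pulled back along a section. -/
theorem pbi_eq_of_isResidual {V : (Fin (n + 1) → ℝ) → Fin m → ℝ} (hU : IsOpen U)
    (hs : ContDiffOn ℝ ∞ s U) (hV : ContDiffOn ℝ ∞ V U) (hW : IsOpen W)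
    (hsW : ∀ x ∈ U, (x, s x) ∈ W) (hx : x ∈ U) {α : Form (n + 1) m k (n + 2)}
    {R : Form (n + 1) m l (n + 1)} (hR : IsResidual W α R) :
    pbi (jetOf k s) (vjet k V) α x =
      pbi (jetOf (2 * k + 1) s) (vjet (2 * k + 1) V) (euler α) x -
        extDeriv (pbi (jetOf l s) (vjet l V) R) x := by
  set K := 2 * k + 1 + (l + 2) with hK
  have hadd : ∀ f g : Form (n + 1) m K (n + 2), pbi (jetOf K s) (vjet K V) (f + g) x =
    pbi (jetOf K s) (vjet K V) f x + pbi (jetOf K s) (vjet K V) g x := fun _ _ => rfl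
  have h6 : pbi (jetOf K s) (vjet K V) (pull K (pc 1 α)) x =
      pbi (jetOf K s) (vjet K V) (pull K (euler α) + pull K (pc 1 (extDeriv (pc 1 R)))) x := by
    rw [pbi, pbi, hR.2.2 K (by omega) (by omega) (mapsTo_jetOf hsW K hx)]
  rwa [hadd, pbi_pull hU hs hx (by omega), pbi_pull hU hs hx (by omega),
    pbi_pull hU hs hx (by omega), pbi_pc_one hU hs hx,
    pbi_extDeriv_pc_one hU hs hV hW hsW hx hR.1, ← sub_eq_add_neg] at h6

/-- The first variation formula, pulled back along a section. -/
theorem pb_lie_eq (hU : IsOpen U) (hs : ContDiffOn ℝ ∞ s U)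
    (hsW : ∀ x ∈ U, (x, s x) ∈ W) (hW : IsOpen W) (hψ : ContDiffOn ℝ ∞ ψ W)
    (hp : ProjectableOn W ψ) (hx : x ∈ U) {lam : Form (n + 1) m k (n + 1)}
    (hl : ContDiffOn ℝ ∞ lam (jetDom W k)) (hlh : ∀ u ∈ jetDom W k, IsHor (lam u))
    {R : Form (n + 1) m l (n + 1)} (hR : IsResidual W (extDeriv lam) R) :
    pb (jetOf k s) (lie (prolong k ψ) lam) x =
      pb (jetOf (2 * k + 2) s) (eulerContract ψ lam) x +
        pb (jetOf (k + l + 2 + 2) s) (dH (noetherCurrent ψ lam R)) x := by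
  have hRs := hR.1
  have hV := contDiffOn_vertAlong hU hs hsW hψ
  have hS : ContDiffAt ℝ ∞ (jetOf k s) x := (contDiffOn_jetOf hU hs k).contDiffAt (hU.mem_nhds hx)
  have hu := mapsTo_jetOf hsW k hx
  have hZ : DifferentiableAt ℝ (prolong k ψ) (jetOf k s x) :=
    ((contDiffOn_prolong hW hψ k).contDiffAt
      ((isOpen_jetDom hW k).mem_nhds hu)).differentiableAt (by simp)
  have hd := differentiableAt_of_contDiffOn_jetDom hW hl hu
  have h1 : pb (jetOf k s) (lie (prolong k ψ) lam) x =
      pbL (jetOf k s) (fun y => prolong k ψ (jetOf k s y)) lam x :=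
    pb_lieAlong (p := ContinuousLinearMap.id ℝ _) (hS.differentiableAt (by simp)) hZ
  -- The vertical part of the field contributes nothing, as `lam` is horizontal.
  have h2 : Set.EqOn (pbi (jetOf k s) (fun y => prolong k ψ (jetOf k s y)) lam)
      (fun y => (pb (jetOf k s) lam y).curryLeft (baseAlong ψ s y)) U := by
    intro y hy
    rw [pbi_prolong hU hs hsW hW hψ hp hy, pbi_vjet_of_isHor (hlh _ (mapsTo_jetOf hsW k hy)),
      zero_add]
  -- The tangential part contracts the pull-back of $d\lambda$, whose degree exceeds the dimension
  -- of the base.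
  have h3 : pbi (jetOf k s) (fun y => prolong k ψ (jetOf k s y)) (extDeriv lam) x =
      pbi (jetOf k s) (vjet k (vertAlong ψ s)) (extDeriv lam) x := by
    rw [pbi_prolong hU hs hsW hW hψ hp hx, alternating_eq_zero_of_finrank_lt (by simp)
      (pb (jetOf k s) (extDeriv lam) x)]
    simp
  have h4 : pbi (jetOf k s) (vjet k (vertAlong ψ s)) (extDeriv lam) x =
      pb (jetOf (2 * k + 2) s) (eulerContract ψ lam) x -
        extDeriv (pbi (jetOf l s) (vjet l (vertAlong ψ s)) R) x := by
    rw [pbi_eq_of_isResidual hU hs hV hW hsW hx hR, pb_eulerContract hU hs hsW hW hψ hp hx]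
  have hζ : DifferentiableAt ℝ (fun y => prolong k ψ (jetOf k s y)) x :=
    hZ.comp x (hS.differentiableAt (by simp))
  have hdP : DifferentiableAt ℝ (pbi (jetOf l s) (vjet l (vertAlong ψ s)) R) x :=
    differentiableAt_pbi (differentiableAt_of_contDiffOn_jetDom hW hRs (mapsTo_jetOf hsW l hx))
      ((contDiffOn_jetOf hU hs l).contDiffAt (hU.mem_nhds hx))
      (((contDiffOn_vjet hU hV l).contDiffAt (hU.mem_nhds hx)).differentiableAt (by simp))
  have hdQ : DifferentiableAt ℝ
      (fun y => (pb (jetOf k s) lam y).curryLeft (baseAlong ψ s y)) x := by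
    refine (Filter.EventuallyEq.differentiableAt_iff
      (h2.eventuallyEq_of_mem (hU.mem_nhds hx))).1 ?_
    exact differentiableAt_pbi hd hS hζ
  have h7 : Set.EqOn (pb (jetOf (k + l + 2) s) (noetherCurrent ψ lam R))
      ((-1 : ℝ) • pbi (jetOf l s) (vjet l (vertAlong ψ s)) R +
        fun y => (pb (jetOf k s) lam y).curryLeft (baseAlong ψ s y)) U := by
    intro y hy
    rw [pb_noetherCurrent hU hs hsW hW hψ hp hy]
    change _ = (-1 : ℝ) • pbi (jetOf l s) (vjet l (vertAlong ψ s)) R y + _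
    congr 1
    ext v
    simp
  -- Cartan's formula: the contraction of $d\lambda$ gives the Euler term and the exact residual
  -- term, which joins $d(\psi_H\rfloor\lambda)$ to form $d$ of the Noether current.
  rw [h1, pbL_eq hd hS hζ, h3, h4,
    (h2.eventuallyEq_of_mem (hU.mem_nhds hx)).extDeriv_eq,
    pb_dH hU hs hW hsW hx (contDiffOn_noetherCurrent hW hψ hl hRs),
    (h7.eventuallyEq_of_mem (hU.mem_nhds hx)).extDeriv_eq,
    extDeriv_add (hdP.const_smul _) hdQ, extDeriv_smul]
  simp only [neg_smul, one_smul]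
  abel

/-- The first variation formula. -/
theorem pull_lie_eq (hW : IsOpen W) (hψ : ContDiffOn ℝ ∞ ψ W) (hp : ProjectableOn W ψ)
    {lam : Form (n + 1) m k (n + 1)}
    (hl : ContDiffOn ℝ ∞ lam (jetDom W k)) (hlh : ∀ u ∈ jetDom W k, IsHor (lam u))
    {R : Form (n + 1) m l (n + 1)} (hR : IsResidual W (extDeriv lam) R) {K : ℕ}
    (hK : 2 * k + 2 ≤ K) (hK' : k + l + 2 + 2 ≤ K) :
    Set.EqOn (pull K (lie (prolong k ψ) lam))
      (pull K (eulerContract ψ lam) + pull K (dH (noetherCurrent ψ lam R))) (jetDom W K) := by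
  refine eqOn_of_pb_eq
    (fun u hu => isHor_pull (isHor_lie hW hψ hp hl hlh (proj_mem_jetDom hu)))
    (fun u hu => (isHor_pull (isHor_eulerContract hW hl (proj_mem_jetDom hu))).add
      (isHor_pull (isHor_dH hW (fun v hv => isHor_noetherCurrent hlh R hv) (proj_mem_jetDom hu))))
    fun s hs x hx => ?_
  have hU : IsOpen {x | (x, s x) ∈ W} := hW.preimage (continuous_id.prodMk hs.continuous)
  have hadd : ∀ f g : Form (n + 1) m K (n + 1), pb (jetOf K s) (f + g) x =
    pb (jetOf K s) f x + pb (jetOf K s) g x := fun _ _ => rfl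
  rw [hadd, pb_pull hU hs.contDiffOn hx (by omega), pb_pull hU hs.contDiffOn hx (by omega),
    pb_pull hU hs.contDiffOn hx (by omega),
    pb_lie_eq hU hs.contDiffOn (fun _ h => h) hW hψ hp hx hl hlh hR]

end FirstVariation

/-! ### Euler–Lagrange forms of total divergences -/

section Divergence

open MeasureTheory

variable {N m k q : ℕ}

/-- Integration by parts against the constant function 1. -/
theorem integral_fderiv_apply_eq_zero {E : Type*} [NormedAddCommGroup E] [NormedSpace ℝ E]
    [FiniteDimensional ℝ E] [MeasurableSpace E] [BorelSpace E] (μ : Measure E) [μ.IsAddHaarMeasure]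
    {f : E → ℝ} (hf : ContDiff ℝ ∞ f) (hc : HasCompactSupport f) (v : E) :
    ∫ x, fderiv ℝ f x v ∂μ = 0 := by
  have h1 : Continuous fun x => fderiv ℝ f x v :=
    (hf.continuous_fderiv (by simp)).clm_apply continuous_const
  have h2 : HasCompactSupport fun x => fderiv ℝ f x v := by
    exact (hc.fderiv ℝ).comp_left (g := fun L : E →L[ℝ] ℝ => L v) (by simp)
  have h := integral_mul_fderiv_eq_neg_fderiv_mul_of_integrable (μ := μ) (f := fun _ : E => (1 : ℝ))
    (g := f) (v := v) (by simp)
    (by simpa using h1.integrable_of_hasCompactSupport h2)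
    (by simpa using hf.continuous.integrable_of_hasCompactSupport hc)
    (fun _ _ => differentiableAt_const _) (fun x _ => (hf.differentiable (by simp)) x)
  simpa using h

/-- Stokes' theorem for forms with compact support. -/
theorem integral_extDeriv_eq_zero {E : Type*} [NormedAddCommGroup E] [NormedSpace ℝ E]
    [FiniteDimensional ℝ E] [MeasurableSpace E] [BorelSpace E] (μ : Measure E) [μ.IsAddHaarMeasure]
    {γ : E → E [⋀^Fin q]→L[ℝ] ℝ} (hγ : ContDiff ℝ ∞ γ) (hc : HasCompactSupport γ)
    (v : Fin (q + 1) → E) : ∫ x, extDeriv γ x v ∂μ = 0 := by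
  have hs : ∀ w, ContDiff ℝ ∞ fun x => γ x w := fun w =>
    (ContinuousAlternatingMap.apply ℝ E ℝ w).contDiff.comp hγ
  have hcs : ∀ w, HasCompactSupport fun x => γ x w := fun w =>
    hc.comp_left (g := fun f : E [⋀^Fin q]→L[ℝ] ℝ => f w) (by simp)
  have h1 : ∀ x, extDeriv γ x v =
      ∑ i, (-1 : ℝ) ^ i.val * fderiv ℝ (fun x => γ x (i.removeNth v)) x (v i) := fun x => by
    simp [extDeriv_apply ((hγ.differentiable (by simp)) x) v]
  simp_rw [h1]
  rw [integral_finsetSum]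
  · refine Finset.sum_eq_zero fun i _ => ?_
    rw [integral_const_mul, integral_fderiv_apply_eq_zero μ (hs _) (hcs _), mul_zero]
  · intro i _
    refine Integrable.const_mul (Continuous.integrable_of_hasCompactSupport
      (((hs _).continuous_fderiv (by simp)).clm_apply continuous_const) ?_) _
    exact ((hcs _).fderiv ℝ).comp_left (g := fun L : E →L[ℝ] ℝ => L (v i)) (by simp)

theorem isContactOne_extDeriv {D : Set (Jet N m k)} {η : Form N m k q} {u : Jet N m k}
    (hD : D ∈ nhds u) (hη : ∀ y ∈ D, IsHor (η y)) (hd : DifferentiableAt ℝ η u) :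
    IsContactOne (extDeriv η u) := by
  rintro v ⟨a, b, hab, ha, hb⟩
  rw [extDeriv_apply hd]
  refine Finset.sum_eq_zero fun i _ => ?_
  obtain ⟨c, hc⟩ : ∃ c, (i.removeNth v c).1 = 0 := by
    rcases eq_or_ne i a with rfl | hi
    · obtain ⟨c, hc⟩ := Fin.exists_succAbove_eq hab.symm
      exact ⟨c, by simpa [Fin.removeNth, hc] using hb⟩
    · obtain ⟨c, hc⟩ := Fin.exists_succAbove_eq hi.symm
      exact ⟨c, by simpa [Fin.removeNth, hc] using ha⟩
  have h2 : (fun y => η y (i.removeNth v)) =ᶠ[nhds u] fun _ => 0 := by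
    filter_upwards [hD] with y hy using hη y hy _ ⟨c, hc⟩
  rw [h2.fderiv_eq]
  simp

/-- Expanding every argument into vertical plus horizontal part, the terms with at least two
vertical parts vanish. -/
theorem pull_eq_pc_add_pc {η : Form N m k q} {u : Jet N m (k + 1)}
    (h : IsContactOne (η (proj (k + 1) k u))) : pull (k + 1) η u = pc 0 η u + pc 1 η u := by
  ext v
  have h1 : pull (k + 1) η u v = η (proj (k + 1) k u)
      ((fun a => ver u (proj (k + 1) k (v a))) + fun a => hor u (proj (k + 1) k (v a))) := by
    refine congrArg (η _) (funext fun a => ?_)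
    simp [ver]
  have h2 : ∀ i, pc i η u v = ∑ S ∈ Finset.powersetCard i (Finset.univ : Finset (Fin q)),
      η (proj (k + 1) k u) (S.piecewise (fun a => ver u (proj (k + 1) k (v a)))
        fun a => hor u (proj (k + 1) k (v a))) := by
    intro i
    rw [pc, mixed_apply]
    refine Finset.sum_congr rfl fun S _ => congrArg (η _) (funext fun a => ?_)
    by_cases ha : a ∈ S <;> simp [ha]
  rw [ContinuousAlternatingMap.add_apply, h1, h2, h2, alternating_map_add_expand,
    ← Finset.sum_union (Finset.pairwise_disjoint_powersetCard _ (by simp))]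
  symm
  refine Finset.sum_subset (Finset.subset_univ _) fun S _ hS => ?_
  have h3 : 1 < S.card := by
    by_contra hc
    apply hS
    simp only [Finset.mem_union, Finset.mem_powersetCard, Finset.subset_univ, true_and]
    omega
  obtain ⟨a, ha, b, hb, hab⟩ := Finset.one_lt_card.1 h3
  exact h _ ⟨a, b, hab, by simp [ha, ver_fst], by simp [hb, ver_fst]⟩

variable {W : Set (Loc N m)} {U : Set (Fin N → ℝ)} {s V : (Fin N → ℝ) → Fin m → ℝ}
  {x : Fin N → ℝ}

theorem contDiffOn_pbi (hU : IsOpen U) (hs : ContDiffOn ℝ ∞ s U) (hV : ContDiffOn ℝ ∞ V U)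
    (hsW : ∀ x ∈ U, (x, s x) ∈ W) {η : Form N m k (q + 1)}
    (hη : ContDiffOn ℝ ∞ η (jetDom W k)) : ContDiffOn ℝ ∞ (pbi (jetOf k s) (vjet k V) η) U := by
  refine contDiffOn_alternating fun v => ?_
  have hS := contDiffOn_jetOf hU hs k
  refine contDiffOn_alternating_apply
    (g := fun x => Matrix.vecCons (vjet k V x) fun a => fderiv ℝ (jetOf k s) x (v a))
    (hη.comp hS (mapsTo_jetOf hsW k)) fun a => ?_
  refine Fin.cases ?_ (fun b => ?_) a
  · exact contDiffOn_vjet hU hV k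
  · exact (hS.fderiv_of_isOpen hU (m := ∞) (by simp)).clm_apply contDiffOn_const

/-- With $\theta=dp_0\eta$, horizontality gives $d_H\eta=p_0\theta=\theta-p_1\theta$. As
$d\theta=0$, this leaves $-dp_1\theta$, whose contraction is exact by `pbi_extDeriv_pc_one`. -/
theorem pbi_extDeriv_dH (hU : IsOpen U) (hs : ContDiffOn ℝ ∞ s U) (hV : ContDiffOn ℝ ∞ V U)
    (hW : IsOpen W) (hsW : ∀ x ∈ U, (x, s x) ∈ W) (hx : x ∈ U) {η : Form N m k q}
    (hη : ContDiffOn ℝ ∞ η (jetDom W k)) (hηh : ∀ u ∈ jetDom W k, IsHor (η u)) :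
    pbi (jetOf (k + 2) s) (vjet (k + 2) V) (extDeriv (dH η)) x =
      extDeriv (pbi (jetOf (k + 1) s) (vjet (k + 1) V) (extDeriv (pc 0 η))) x := by
  set θ := extDeriv (pc 0 η) with hθ
  have h0 := contDiffOn_pc hη 0
  have hθs : ContDiffOn ℝ ∞ θ (jetDom W (k + 1)) := contDiffOn_extDeriv (isOpen_jetDom hW _) h0
  have h1 : Set.EqOn (dH η) (pull (k + 2) θ - pc 1 θ) (jetDom W (k + 2)) := by
    intro u hu
    have hu1 : proj (k + 2) (k + 1) u ∈ jetDom W (k + 1) := proj_mem_jetDom hu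
    rw [Pi.sub_apply, pull_eq_pc_add_pc (isContactOne_extDeriv
      ((isOpen_jetDom hW _).mem_nhds hu1) (fun y _ => isHor_pc_zero η y)
      (differentiableAt_of_contDiffOn_jetDom hW h0 hu1)), add_sub_cancel_right, dH,
      Finset.sum_apply, Finset.sum_eq_single 0 _ (by simp)]
    intro l _ hl
    have h2 : pc l η =ᶠ[nhds (proj (k + 2) (k + 1) u)] 0 := by
      filter_upwards [(isOpen_jetDom hW (k + 1)).mem_nhds hu1] with y hy
      exact pc_eq_zero (hηh _ (proj_mem_jetDom hy)) hl
    have h3 : extDeriv (pc l η) (proj (k + 2) (k + 1) u) = 0 := by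
      rw [h2.extDeriv_eq, extDeriv, Pi.zero_def, fderiv_const_apply]
      exact map_zero (ContinuousAlternatingMap.alternatizeUncurryFinCLM ℝ _ _)
    exact pc_eq_zero (h3 ▸ fun _ _ => rfl) hl
  have hu := mapsTo_jetOf hsW (k + 2) hx
  have h4 : extDeriv (dH η) (jetOf (k + 2) s x) = - extDeriv (pc 1 θ) (jetOf (k + 2) s x) := by
    have h5 : dH η =ᶠ[nhds (jetOf (k + 2) s x)] pull (k + 2) θ + (-1 : ℝ) • pc 1 θ := by
      filter_upwards [(isOpen_jetDom hW (k + 2)).mem_nhds hu] with y hy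
      rw [h1 hy]
      ext v
      simp [sub_eq_add_neg]
    have h6 : pull (k + 2) θ = pb (proj (k + 2) (k + 1)) θ := by
      funext y
      simp [pull, pb]
    have h7 : proj (k + 2) (k + 1) (jetOf (k + 2) s x) ∈ jetDom W (k + 1) := proj_mem_jetDom hu
    have h8 : extDeriv θ (proj (k + 2) (k + 1) (jetOf (k + 2) s x)) = 0 :=
      extDeriv_extDeriv_apply (h0.contDiffAt ((isOpen_jetDom hW _).mem_nhds h7))
        (by simpa using two_le_infty)
    have h9 : extDeriv (pull (k + 2) θ) (jetOf (k + 2) s x) = 0 := by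
      rw [h6, extDeriv_pb (differentiableAt_of_contDiffOn_jetDom hW hθs h7)
        (proj (k + 2) (k + 1)).contDiff.contDiffAt, pb, h8]
      rfl
    rw [h5.extDeriv_eq, extDeriv_add
      (differentiableAt_of_contDiffOn_jetDom hW (contDiffOn_pull hθs _) hu)
      ((differentiableAt_of_contDiffOn_jetDom hW (contDiffOn_pc hθs 1) hu).const_smul _),
      extDeriv_smul, h9, zero_add]
    ext v
    simp
  have h10 : pbi (jetOf (k + 2) s) (vjet (k + 2) V) (extDeriv (dH η)) x =
      - pbi (jetOf (k + 2) s) (vjet (k + 2) V) (extDeriv (pc 1 θ)) x := by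
    rw [pbi, h4]
    rfl
  rw [h10, ← pbi_pc_one hU hs hx, pbi_extDeriv_pc_one hU hs hV hW hsW hx hθs, neg_neg]

/-- The fundamental lemma of the calculus of variations: by Stokes, `z` integrates to zero against
every test function supported in `U`. The potential must vanish where $\varphi$ vanishes locally, to
inherit its compact support. -/
theorem eqOn_zero_of_forall_smul_eq_extDeriv (hU : IsOpen U)
    {z : (Fin N → ℝ) → (Fin N → ℝ) [⋀^Fin (q + 1)]→L[ℝ] ℝ} (hz : ContDiffOn ℝ ∞ z U)
    (h : ∀ φ : (Fin N → ℝ) → ℝ, ContDiff ℝ ∞ φ →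
      ∃ γ : (Fin N → ℝ) → (Fin N → ℝ) [⋀^Fin q]→L[ℝ] ℝ, ContDiffOn ℝ ∞ γ U ∧
        (∀ x, φ =ᶠ[nhds x] 0 → γ x = 0) ∧ ∀ x ∈ U, φ x • z x = extDeriv γ x) :
    Set.EqOn z 0 U := by
  intro x hx
  ext v
  have hzv : ContinuousOn (fun x => z x v) U :=
    ((ContinuousAlternatingMap.apply ℝ (Fin N → ℝ) ℝ v).contDiff.comp_contDiffOn hz).continuousOn
  have h1 : ∀ᵐ x, x ∈ U → z x v = 0 := by
    refine hU.ae_eq_zero_of_integral_contDiff_smul_eq_zero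
      (hzv.locallyIntegrableOn hU.measurableSet) fun φ hφ hφc hφU => ?_
    obtain ⟨γ, hγs, hγ0, hγ⟩ := h φ hφ
    have h2 : ∀ x ∉ tsupport φ, γ =ᶠ[nhds x] 0 := fun x hx => by
      filter_upwards [(isClosed_tsupport φ).isOpen_compl.mem_nhds hx] with y hy
      exact hγ0 y (notMem_tsupport_iff_eventuallyEq.1 hy)
    -- Smoothness is assumed only on `U`, but off the support of $\varphi$, which lies in `U`, the
    -- potential is locally zero.
    have h3 : ContDiff ℝ ∞ γ := contDiff_iff_contDiffAt.2 fun x => by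
      by_cases hx : x ∈ tsupport φ
      · exact hγs.contDiffAt (hU.mem_nhds (hφU hx))
      · exact contDiffAt_const.congr_of_eventuallyEq (h2 x hx)
    have h4 : HasCompactSupport γ := HasCompactSupport.intro hφc fun x hx => (h2 x hx).eq_of_nhds
    rw [← integral_extDeriv_eq_zero volume h3 h4 v]
    refine integral_congr_ae (Filter.Eventually.of_forall fun x => ?_)
    by_cases hx : x ∈ U
    · simp [← hγ x hx]
    · have hx' : x ∉ tsupport φ := fun h => hx (hφU h)
      have h5 : extDeriv γ x = 0 := by
        rw [(h2 x hx').extDeriv_eq, extDeriv, Pi.zero_def, fderiv_const_apply]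
        exact map_zero (ContinuousAlternatingMap.alternatizeUncurryFinCLM ℝ _ _)
      simp [h5, image_eq_zero_of_notMem_tsupport hx']
  have h6 : Set.EqOn (fun x => z x v) (fun _ => 0) U :=
    Measure.eqOn_open_of_ae_eq ((ae_restrict_iff' hU.measurableSet).2 h1) hU hzv
      continuousOn_const
  exact h6 hx

theorem vjet_eq_zero (h : V =ᶠ[nhds x] 0) : vjet k V x = 0 := by
  have h1 : ∀ L : List (Fin N), partials L V =ᶠ[nhds x] 0 := by
    intro L
    induction L with
    | nil => exact h
    | cons i L ih =>
      filter_upwards [ih.eventuallyEq_nhds] with y hy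
      simp [partials, hy.fderiv_eq, Pi.zero_def]
  refine jet_ext rfl fun I hI => ?_
  rw [coord_vjet hI, (h1 _).eq_of_nhds, ← coordL_apply, map_zero]
  rfl

end Divergence

/-! ### Vanishing of the Euler–Lagrange term for total divergences. -/

section DivergenceVariation

variable {n m k l : ℕ} {W : Set (Loc (n + 1) m)} {ψ : Loc (n + 1) m → Loc (n + 1) m}
  {U : Set (Fin (n + 1) → ℝ)} {s V : (Fin (n + 1) → ℝ) → Fin m → ℝ} {x : Fin (n + 1) → ℝ}

/-- The Euler–Lagrange form of a total divergence vanishes. -/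
theorem pbi_euler_extDeriv_dH (hU : IsOpen U) (hs : ContDiffOn ℝ ∞ s U)
    (hW : IsOpen W) (hsW : ∀ x ∈ U, (x, s x) ∈ W) (hx : x ∈ U) {η : Form (n + 1) m k n}
    (hη : ContDiffOn ℝ ∞ η (jetDom W k)) (hηh : ∀ u ∈ jetDom W k, IsHor (η u)) :
    pbi (jetOf (2 * (k + 2) + 1) s) (vjet (2 * (k + 2) + 1) V) (euler (extDeriv (dH η))) x = 0 := by
  set α := extDeriv (dH η) with hα
  have hαs : ContDiffOn ℝ ∞ α (jetDom W (k + 2)) :=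
    contDiffOn_extDeriv (isOpen_jetDom hW _) (contDiffOn_dH hW hη)
  have hR := isResidual_residual hW hαs
  have hθs : ContDiffOn ℝ ∞ (extDeriv (pc 0 η)) (jetDom W (k + 1)) :=
    contDiffOn_extDeriv (isOpen_jetDom hW _) (contDiffOn_pc hη 0)
  rw [pbi_euler hU hs hx]
  refine Finset.sum_eq_zero fun σ _ => ?_
  rw [eqOn_zero_of_forall_smul_eq_extDeriv hU (contDiffOn_pb hU hs hsW (contDiffOn_zeta hW hαs σ 0))
    (fun φ hφ => ?_) hx, Pi.zero_apply, smul_zero]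
  -- The variation $\varphi$ in the single fibre direction $\sigma$ isolates the coefficient
  -- $\zeta^0_\sigma$. Both the contraction of $d(d_H\eta)$ and the residual term are exact, and
  -- their potentials depend locally on $\varphi$.
  set V' : (Fin (n + 1) → ℝ) → Fin m → ℝ := fun y => φ y • Pi.single σ 1 with hV'
  have hVs : ContDiffOn ℝ ∞ V' U := (hφ.smul contDiff_const).contDiffOn
  have hA := contDiffOn_pbi hU hs hVs hsW hθs
  have hB := contDiffOn_pbi hU hs hVs hsW hR.1
  refine ⟨_, hA.add hB, fun y hy => ?_, fun y hy => ?_⟩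
  · have h1 : V' =ᶠ[nhds y] 0 := by
      filter_upwards [hy] with a ha
      simp [hV', ha]
    ext v
    simp only [ContinuousAlternatingMap.add_apply, pbi_apply, vjet_eq_zero h1]
    rw [ContinuousAlternatingMap.map_coord_zero _ 0 rfl,
      ContinuousAlternatingMap.map_coord_zero _ 0 rfl]
    simp
  · have h2 := pbi_eq_of_isResidual hU hs hVs hW hsW hy hR
    rw [hα, pbi_extDeriv_dH hU hs hVs hW hsW hy hη hηh, ← hα, pbi_euler hU hs hy,
      Finset.sum_eq_single σ (fun τ _ hτ => by simp [hV', hτ]) (by simp)] at h2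
    have h3 := extDeriv_fun_add ((hA.contDiffAt (hU.mem_nhds hy)).differentiableAt (by simp))
      ((hB.contDiffAt (hU.mem_nhds hy)).differentiableAt (by simp))
    rw [h3, h2]
    simp [hV']

/-- The first variation formula for total divergences. -/
theorem pull_lie_dH_eq (hW : IsOpen W) (hψ : ContDiffOn ℝ ∞ ψ W) (hp : ProjectableOn W ψ)
    {η : Form (n + 1) m k n}
    (hη : ContDiffOn ℝ ∞ η (jetDom W k)) (hηh : ∀ u ∈ jetDom W k, IsHor (η u))
    {R : Form (n + 1) m l (n + 1)} (hR : IsResidual W (extDeriv (dH η)) R) {K : ℕ}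
    (hK : k + 2 + l + 2 + 2 ≤ K) :
    Set.EqOn (pull K (lie (prolong (k + 2) ψ) (dH η)))
      (pull K (dH (noetherCurrent ψ (dH η) R))) (jetDom W K) := by
  have hl := contDiffOn_dH hW hη
  have hlh : ∀ u ∈ jetDom W (k + 2), IsHor (dH η u) := fun u hu => isHor_dH hW hηh hu
  refine eqOn_of_pb_eq
    (fun u hu => isHor_pull (isHor_lie hW hψ hp hl hlh (proj_mem_jetDom hu)))
    (fun u hu => isHor_pull
      (isHor_dH hW (fun v hv => isHor_noetherCurrent hlh R hv) (proj_mem_jetDom hu)))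
    fun s hs x hx => ?_
  have hU : IsOpen {x | (x, s x) ∈ W} := hW.preimage (continuous_id.prodMk hs.continuous)
  rw [pb_pull hU hs.contDiffOn hx (by omega), pb_pull hU hs.contDiffOn hx (by omega),
    pb_lie_eq hU hs.contDiffOn (fun _ h => h) hW hψ hp hx hl hlh hR,
    pb_eulerContract hU hs.contDiffOn (fun _ h => h) hW hψ hp hx,
    pbi_euler_extDeriv_dH hU hs.contDiffOn hW (fun _ h => h) hx hη hηh, zero_add]

end DivergenceVariation

/-! ### Projectable vector fields in fibred charts -/

section Chart

variable {EX : Type*} [NormedAddCommGroup EX] [NormedSpace ℝ EX]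
  {EY : Type*} [NormedAddCommGroup EY] [NormedSpace ℝ EY]
  {X : Type*} [TopologicalSpace X] [ChartedSpace EX X]
  {Y : Type*} [TopologicalSpace Y] [ChartedSpace EY Y] [IsManifold 𝓘(ℝ, EY) ∞ Y]
  {N m : ℕ} {π : Y → X}

theorem contDiffOn_inChart (ψ : ProjectableField (EX := EX) (EY := EY) π)
    (c : FiberedChart (EX := EX) (EY := EY) N m π) : ContDiffOn ℝ ∞ (ψ.inChart c) c.dom := by
  have h1 : ContMDiffOn 𝓘(ℝ, EY).tangent 𝓘(ℝ, Loc N m).tangent ∞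
      (tangentMapWithin 𝓘(ℝ, EY) 𝓘(ℝ, Loc N m) c.total c.total.source)
      (Bundle.TotalSpace.proj ⁻¹' c.total.source) :=
    c.smooth_total.contMDiffOn_tangentMapWithin (by simp) c.total.open_source.uniqueMDiffOn
  have h2 : ContMDiffOn 𝓘(ℝ, Loc N m) 𝓘(ℝ, EY).tangent ∞
      (fun z => (⟨c.total.symm z, ψ.field (c.total.symm z)⟩ : TangentBundle 𝓘(ℝ, EY) Y))
      c.total.target := ψ.smooth.comp_contMDiffOn c.smooth_total_symm
  have h3 := h1.comp h2 fun z hz => c.total.map_target hz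
  have h4 := (contMDiff_snd_tangentBundle_modelSpace (Loc N m) 𝓘(ℝ, Loc N m)
    (n := ∞)).comp_contMDiffOn h3
  refine (contMDiffOn_iff_contDiffOn.1 h4).congr fun z hz => ?_
  change mfderiv 𝓘(ℝ, EY) 𝓘(ℝ, Loc N m) c.total (c.total.symm z) _ =
    mfderivWithin 𝓘(ℝ, EY) 𝓘(ℝ, Loc N m) c.total c.total.source (c.total.symm z) _
  rw [mfderivWithin_of_isOpen c.total.open_source (c.total.map_target hz)]

/-- Differentiating $\mathrm{pr}_1\circ(\text{total chart})=(\text{base chart})\circ\pi$ expresses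
the horizontal components by the projected field `ξ` at the base point, and the base point depends
only on the first coordinate. -/
theorem inChart_fst [IsManifold 𝓘(ℝ, EX) ∞ X]
    (hπ : ContMDiff 𝓘(ℝ, EY) 𝓘(ℝ, EX) ∞ π) (ψ : ProjectableField (EX := EX) (EY := EY) π)
    (c : FiberedChart (EX := EX) (EY := EY) N m π) {w w' : Loc N m} (hw : w ∈ c.dom)
    (hw' : w' ∈ c.dom) (h : w.1 = w'.1) : (ψ.inChart c w).1 = (ψ.inChart c w').1 := by
  obtain ⟨ξ, hξ⟩ := ψ.projectable
  have h1 : ∀ z ∈ c.dom, (ψ.inChart c z).1 =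
      mfderiv 𝓘(ℝ, EX) 𝓘(ℝ, Fin N → ℝ) c.base (π (c.total.symm z)) (ξ (π (c.total.symm z))) := by
    intro z hz
    set p := c.total.symm z with hp
    have hps : p ∈ c.total.source := c.total.map_target hz
    have ht : HasMFDerivAt 𝓘(ℝ, EY) 𝓘(ℝ, Loc N m) c.total p _ :=
      ((c.smooth_total.contMDiffAt (c.total.open_source.mem_nhds hps)).mdifferentiableAt
        (by simp)).hasMFDerivAt
    have hb : HasMFDerivAt 𝓘(ℝ, EX) 𝓘(ℝ, Fin N → ℝ) c.base (π p) _ :=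
      ((c.smooth_base.contMDiffAt (c.base.open_source.mem_nhds
        (c.mapsTo p hps))).mdifferentiableAt (by simp)).hasMFDerivAt
    have hq : HasMFDerivAt 𝓘(ℝ, EY) 𝓘(ℝ, EX) π p _ :=
      (hπ.mdifferentiableAt (by simp)).hasMFDerivAt
    have hf : HasMFDerivAt 𝓘(ℝ, Loc N m) 𝓘(ℝ, Fin N → ℝ) Prod.fst (c.total p)
        (ContinuousLinearMap.fst ℝ (Fin N → ℝ) (Fin m → ℝ)) :=
      (ContinuousLinearMap.fst ℝ (Fin N → ℝ) (Fin m → ℝ)).hasMFDerivAt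
    have h2 := hf.comp p ht
    have h3 := (hb.comp p hq).congr_of_eventuallyEq (f₁ := Prod.fst ∘ c.total) (by
      filter_upwards [c.total.open_source.mem_nhds hps] with y hy using c.fst_total y hy)
    have h4 := DFunLike.congr_fun (hasMFDerivAt_unique h2 h3) (ψ.field p)
    rw [← hξ p]
    exact h4
  have h2 : ∀ z ∈ c.dom, π (c.total.symm z) = c.base.symm z.1 := by
    intro z hz
    have hps := c.total.map_target hz
    rw [← c.base.left_inv (c.mapsTo _ hps), ← c.fst_total _ hps, c.total.right_inv hz]
  rw [h1 w hw, h1 w' hw', h2 w hw, h2 w' hw', h]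

/-- The chart domain is open, so short fibre segments stay inside it; the horizontal components are
constant on them and their line derivative is zero. -/
theorem projectableOn_inChart [IsManifold 𝓘(ℝ, EX) ∞ X]
    (hπ : ContMDiff 𝓘(ℝ, EY) 𝓘(ℝ, EX) ∞ π) (ψ : ProjectableField (EX := EX) (EY := EY) π)
    (c : FiberedChart (EX := EX) (EY := EY) N m π) : ProjectableOn c.dom (ψ.inChart c) := by
  intro z hz y
  have hW : c.dom ∈ nhds z := c.total.open_target.mem_nhds hz
  have h1 : HasFDerivAt (ψ.inChart c) _ z :=
    (((contDiffOn_inChart ψ c).contDiffAt hW).differentiableAt (by simp)).hasFDerivAt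
  have h2 := (h1.fst.hasLineDerivAt (0, y)).deriv
  have h3 : Filter.Tendsto (fun t : ℝ => z + t • ((0, y) : Loc N m)) (nhds 0) (nhds z) := by
    have : Continuous fun t : ℝ => z + t • ((0, y) : Loc N m) := by fun_prop
    simpa using this.tendsto 0
  have h4 : (fun t : ℝ => (ψ.inChart c (z + t • ((0, y) : Loc N m))).1) =ᶠ[nhds 0]
      fun _ => (ψ.inChart c z).1 := by
    filter_upwards [h3 hW] with t ht
    exact inChart_fst hπ ψ c ht hz (by simp)
  rw [h4.deriv_eq, deriv_const] at h2
  exact h2.symm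

end Chart

end JetCalc

end

/-! ### The second variation formula. -/

theorem theorem3p2 {n m r : ℕ}
    {EX : Type*} [NormedAddCommGroup EX] [NormedSpace ℝ EX]
    {EY : Type*} [NormedAddCommGroup EY] [NormedSpace ℝ EY]
    {X : Type*} [TopologicalSpace X] [ChartedSpace EX X] [IsManifold 𝓘(ℝ, EX) ∞ X]
    {Y : Type*} [TopologicalSpace Y] [ChartedSpace EY Y] [IsManifold 𝓘(ℝ, EY) ∞ Y]
    (π : Y → X) (_hπ : IsFibration (EX := EX) (EY := EY) (n + 1) m π)
    (ρ : JetForm (EX := EX) (EY := EY) (n + 1) m π r (n + 1))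
    (ψ₁ ψ₂ : ProjectableField (EX := EX) (EY := EY) π)
    (c : FiberedChart (EX := EX) (EY := EY) (n + 1) m π) :
    -- the coordinate residual operator satisfies the decomposition formula over the chart
    (∀ (k : ℕ) (α : Form (n + 1) m k (n + 2)), ContDiffOn ℝ ∞ α (jetDom c.dom k) →
      IsResidual c.dom α (residual α)) ∧
    -- the second variation formula over the chart, for any choice of local residual forms
    ∀ (l₁ l₂ l₃ : ℕ) (R₁ : Form (n + 1) m l₁ (n + 1)) (R₂ : Form (n + 1) m l₂ (n + 1))
      (R₃ : Form (n + 1) m l₃ (n + 1)),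
      IsResidual c.dom (extDeriv (pc 0 (ρ.inChart c))) R₁ →
      IsResidual c.dom (extDeriv (eulerContract (ψ₁.inChart c) (pc 0 (ρ.inChart c)))) R₂ →
      IsResidual c.dom
        (extDeriv (dH (noetherCurrent (ψ₁.inChart c) (pc 0 (ρ.inChart c)) R₁))) R₃ →
    -- `K` is at least the order of each of the four forms
    ∀ K, r + 1 ≤ K → 2 * (2 * (r + 1) + 2) + 2 ≤ K →
      ((2 * (r + 1) + 2) + l₂ + 2) + 2 ≤ K → (((r + 1) + l₁ + 2 + 2) + l₃ + 2) + 2 ≤ K →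
      Set.EqOn
        (pull K (lie (prolong (r + 1) (ψ₂.inChart c))
            (lie (prolong (r + 1) (ψ₁.inChart c)) (pc 0 (ρ.inChart c)))))
        (pull K (eulerContract (ψ₂.inChart c) (eulerContract (ψ₁.inChart c) (pc 0 (ρ.inChart c))))
          + pull K (dH (noetherCurrent (ψ₂.inChart c)
              (eulerContract (ψ₁.inChart c) (pc 0 (ρ.inChart c))) R₂))
          + pull K (dH (noetherCurrent (ψ₂.inChart c)
              (dH (noetherCurrent (ψ₁.inChart c) (pc 0 (ρ.inChart c)) R₁)) R₃)))
        (jetDom c.dom K) := by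
  have hW : IsOpen c.dom := c.total.open_target
  refine ⟨fun k α hα => isResidual_residual hW hα, ?_⟩
  intro l₁ l₂ l₃ R₁ R₂ R₃ hR₁ hR₂ hR₃ K _ hK₁ hK₂ hK₃
  have hψ₁ := contDiffOn_inChart ψ₁ c
  have hψ₂ := contDiffOn_inChart ψ₂ c
  have hp₁ := projectableOn_inChart _hπ.smooth ψ₁ c
  have hp₂ := projectableOn_inChart _hπ.smooth ψ₂ c
  set lam := pc 0 (ρ.inChart c) with hlam
  have hl : ContDiffOn ℝ ∞ lam (jetDom c.dom (r + 1)) := contDiffOn_pc (ρ.smooth c) 0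
  have hlh : ∀ u ∈ jetDom c.dom (r + 1), IsHor (lam u) := fun u _ => isHor_pc_zero _ u
  have he := contDiffOn_eulerContract hW hψ₁ hl
  have heh : ∀ u ∈ jetDom c.dom (2 * (r + 1) + 2), IsHor (eulerContract (ψ₁.inChart c) lam u) :=
    fun u hu => isHor_eulerContract hW hl hu
  have hn := contDiffOn_noetherCurrent hW hψ₁ hl hR₁.1
  have hnh : ∀ u ∈ jetDom c.dom (r + 1 + l₁ + 2),
      IsHor (noetherCurrent (ψ₁.inChart c) lam R₁ u) :=
    fun u hu => isHor_noetherCurrent hlh R₁ hu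
  have hd := contDiffOn_dH hW hn
  have hfirst := pull_lie_eq hW hψ₁ hp₁ hl hlh hR₁ (K := K) (by omega) (by omega)
  have hE := pull_lie_eq hW hψ₂ hp₂ he heh hR₂ (K := K) (by omega) (by omega)
  have hD := pull_lie_dH_eq hW hψ₂ hp₂ hn hnh hR₃ (K := K) (by omega)
  intro u hu
  -- The outer Lie derivative is raised to order `K`, where the first variation formula for `ψ₁` can
  -- be inserted. It is then split and lowered again on each summand, so that the formulas for `ψ₂`
  -- apply.
  rw [← lie_pull (by omega) hW hψ₂ (contDiffOn_lie hW hψ₁ hl) hu,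
    lie_congr hW hfirst hu,
    lie_add (differentiableAt_of_contDiffOn_jetDom hW (contDiffOn_pull he K) hu)
      (differentiableAt_of_contDiffOn_jetDom hW (contDiffOn_pull hd K) hu),
    lie_pull (by omega) hW hψ₂ he hu, lie_pull (by omega) hW hψ₂ hd hu, hE hu, hD hu]
  rfl
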